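/- Let $M$ be a smooth $n$-dimensional manifold with a smooth pseudo-Riemannian metric $g$ of arbitrary signature, Levi-Civita connection $\nabla$, exterior derivative $d=e^a\wedge\nabla_a$ and co-differential $\delta=-X^a\lrcorner\nabla_a$, where $X_a$ is a local frame, $e^a$ the dual coframe, $e_a=g_{ab}e^b$, $X^a=g^{ab}X_b$. Juxtaposition of forms is the Clifford product ($e^ae^b+e^be^a=2g^{ab}$), $[\,\cdot,\cdot\,]$ its commutator, $\pi$ the degree operator, and $\wedge_k$ the contracted wedge product, $\alpha\wedge_0\beta=\alpha\wedge\beta$, $\alpha\wedge_k\beta=(X_a\lrcorner\alpha)\wedge_{k-1}(X^a\lrcorner\beta)$. A form $\omega$ is conformal Killing--Yano if $\nabla_a\omega=\frac1{\pi+1}X_a\lrcorner d\omega-\frac1{n-\pi+1}e_a\wedge\delta\omega$; it is KY if moreover $\delta\omega=0$, and CCKY if moreover $d\omega=0$. For a KY form $\kappa$ put $\kappa^a=X^a\lrcorner\kappa$, $\tilde\kappa=\frac{\pi-1}{2\pi}d\kappa$, $K_\kappa=\kappa^a\nabla_a+\tilde\kappa$; for a CCKY form $\omega$ put $\omega^a=e^a\wedge\omega$,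 $\tilde\omega=-\frac{n-\pi-1}{2(n-\pi)}\delta\omega$, $M_\omega=\omega^a\nabla_a+\tilde\omega$ (operators on Clifford objects, the coefficients acting by left Clifford multiplication). Let $\kappa,\lambda,\mu$ be KY forms of odd degrees $p,q,r$, and $\alpha,\beta,\omega$ CCKY forms of even degrees $a,b,c$, with $(r,c)\ne(1,n)$. Put $\{A,B\}^b=A^a(\nabla_aB^b)-B^a(\nabla_aA^b)+[A^b,\tilde B]-[B^b,\tilde A]$. The Killing--Yano brackets are $$[\kappa,\lambda]_{KY}=\tfrac1\pi\,e_b\wedge\{\kappa,\lambda\}^b,\qquad [\mu,\omega]_{KY}=\tfrac1{n-\pi}\,X_b\lrcorner\{\mu,\omega\}^b,\qquad [\alpha,\beta]_{KY}=\tfrac1\pi\,e_b\wedge\{\alpha,\beta\}^b .$$ If $[X^a\lrcorner\kappa,X_a\lrcorner\lambda]=0$, then $$[\kappa,\lambda]_{KY}=-\frac{pq}{p+q-1}\,\delta(\kappa\wedge\lambda).$$ If $[X^a\lrcorner\mu,e_a\wedge\omega]=0$, then $$[\mu,\omega]_{KY}=\frac{r(n-c)}{n+r-c-1}\,\frac{(-1)^{(r-1)/2}}{r!}\,d(\mu\wedge_r\omega).$$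 If $[e^a\wedge\alpha,e_a\wedge\beta]=0$, then $[\alpha,\beta]_{KY}=0$ when $a+b\le n$; when $n$ is odd and $a+b>n$, $$[\alpha,\beta]_{KY}=\frac{(n-a)(n-b)}{2n-a-b-1}\,\frac{(-1)^{(a+b-n-1)/2}}{(a+b-n)!}\,\delta(\alpha\wedge_{a+b-n}\beta);$$ and when $n$ is even and $a+b>n$, $$[\alpha,\beta]_{KY}=\frac{(n-a)(n-b)}{2n-a-b+1}\,\frac{(-1)^{(a+b-n-2)/2}}{(a+b-n-1)!}\Bigl(\alpha\wedge_{a+b-n-1}\bigl(\tfrac1{n-b+1}\delta\beta\bigr)-\bigl(\tfrac1{n-a+1}\delta\alpha\bigr)\wedge_{a+b-n-1}\beta\Bigr).$$ The same formulas hold for the brackets defined through operators: if $\nu$ is an odd KY form with $[K_\kappa,K_\lambda]=K_\nu$, or an even CCKY form without part of degree $n$ with $[K_\mu,M_\omega]=M_\nu$, or an odd KY form with $[M_\alpha,M_\beta]=K_\nu$, then $\nu$ equals the corresponding right-hand side above. -/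

import Mathlib

open scoped Manifold

noncomputable section

namespace KillingYano

/-! ### The exterior algebra at a point, in coordinates -/

/-- Inhomogeneous antisymmetric forms at a point of an `n`-dimensional coordinate domain: the
exterior algebra of the space `Fin n → ℝ` of covectors (written through their components).
The wedge product is the multiplication of this algebra. -/
abbrev Form (n : ℕ) : Type := ExteriorAlgebra ℝ (Fin n → ℝ)

/-- Fields of inhomogeneous forms on a coordinate domain. -/
abbrev LocalForm (n : ℕ) : Type := EuclideanSpace ℝ (Fin n) → Form n

/-- Metric components `g_{ij}` on a coordinate domain. -/
abbrev LocalMetric (n : ℕ) : Type := EuclideanSpace ℝ (Fin n) → Matrix (Fin n) (Fin n) ℝ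

variable {n : ℕ}

/-- The basis of the exterior algebra formed by the products of the coordinate one-forms. -/
def formBasis (n : ℕ) : Module.Basis (Finset (Fin n)) ℝ (Form n) :=
  (Pi.basisFun ℝ (Fin n)).ExteriorAlgebra

/-- The coordinate one-form `e^a`. -/
def cof (a : Fin n) : Form n := ExteriorAlgebra.ι ℝ (Pi.single a 1)

/-- The inner derivative `X_a ⌟ ω` along the `a`-th coordinate vector. -/
def hook (a : Fin n) : Form n →ₗ[ℝ] Form n :=
  CliffordAlgebra.contractLeft (Q := (0 : QuadraticForm ℝ (Fin n → ℝ))) (LinearMap.proj a)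

/-- The function `f(π)` of the degree operator `π`: multiplication of the part of degree `p`
by `f p`. -/
def degFun (f : ℕ → ℝ) (ω : Form n) : Form n :=
  ∑ p ∈ Finset.range (n + 1),
    f p • GradedAlgebra.proj (fun i : ℕ => ⋀[ℝ]^i (Fin n → ℝ)) p ω

/-- `X^a ⌟ ω = g^{ab} X_b ⌟ ω`, where `G = (g_{ab})`. -/
def hookUp (G : Matrix (Fin n) (Fin n) ℝ) (a : Fin n) (ω : Form n) : Form n :=
  ∑ b, G⁻¹ a b • hook b ω

/-- `e_a = g_{ab} e^b`. -/
def cofLow (G : Matrix (Fin n) (Fin n) ℝ) (a : Fin n) : Form n :=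
  ∑ b, G a b • cof b

/-- The contracted wedge product: `α ∧_0 β = α ∧ β` and
`α ∧_{k+1} β = (X_a ⌟ α) ∧_k (X^a ⌟ β)`. -/
def cwedge (G : Matrix (Fin n) (Fin n) ℝ) : ℕ → Form n → Form n → Form n
  | 0, α, β => α * β
  | k + 1, α, β => ∑ a, cwedge G k (hook a α) (hookUp G a β)

/-- The Clifford product on forms: the product of the Clifford algebra of the inverse metric
`g^{ab}` on covectors (so that `e^a e^b + e^b e^a = 2 g^{ab}`), transported to the exterior algebra
by the canonical linear isomorphism, which maps antisymmetrised Clifford products of covectors to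
their wedge products. -/
def cliff (G : Matrix (Fin n) (Fin n) ℝ) (α β : Form n) : Form n :=
  CliffordAlgebra.equivExterior (Matrix.toQuadraticForm' G⁻¹)
    ((CliffordAlgebra.equivExterior (Matrix.toQuadraticForm' G⁻¹)).symm α *
      (CliffordAlgebra.equivExterior (Matrix.toQuadraticForm' G⁻¹)).symm β)

/-- The Clifford commutator. -/
def comm (G : Matrix (Fin n) (Fin n) ℝ) (α β : Form n) : Form n :=
  cliff G α β - cliff G β α

/-! ### Differential operators on a coordinate domain -/

/-- The partial derivative of a field of forms, component by component. -/
def pderiv (a : Fin n) (ω : LocalForm n) (y : EuclideanSpace ℝ (Fin n)) : Form n :=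
  ∑ S : Finset (Fin n),
    fderiv ℝ (fun z => (formBasis n).repr (ω z) S) y (EuclideanSpace.single a 1) • formBasis n S

/-- The partial derivative `∂_a g_{ij}` of the metric components. -/
def pderivMetric (G : LocalMetric n) (a i j : Fin n) (y : EuclideanSpace ℝ (Fin n)) : ℝ :=
  fderiv ℝ (fun z => G z i j) y (EuclideanSpace.single a 1)

/-- The Christoffel symbols `Γ^i_{jk}` of the Levi-Civita connection. -/
def christoffel (G : LocalMetric n) (y : EuclideanSpace ℝ (Fin n)) (i j k : Fin n) : ℝ :=
  (1 / 2) * ∑ l, (G y)⁻¹ i l *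
    (pderivMetric G j l k y + pderivMetric G k l j y - pderivMetric G l j k y)

/-- The covariant derivative `∇_a ω`: the Levi-Civita connection, extended to forms as a derivation
of the exterior algebra with `∇_a e^i = - Γ^i_{aj} e^j`. -/
def nabla (G : LocalMetric n) (a : Fin n) (ω : LocalForm n) (y : EuclideanSpace ℝ (Fin n)) :
    Form n :=
  pderiv a ω y - ∑ i, ∑ j, christoffel G y i a j • (cof j * hook i (ω y))

/-- The exterior derivative `d = e^a ∧ ∇_a`. -/
def extd (G : LocalMetric n) (ω : LocalForm n) (y : EuclideanSpace ℝ (Fin n)) : Form n :=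
  ∑ a, cof a * nabla G a ω y

/-- The co-differential `δ = - X^a ⌟ ∇_a`. -/
def codiff (G : LocalMetric n) (ω : LocalForm n) (y : EuclideanSpace ℝ (Fin n)) : Form n :=
  -∑ a, hookUp (G y) a (nabla G a ω y)

/-- The twistor operator
`T_a ω = ∇_a ω - 1/(π+1) X_a ⌟ dω + 1/(n-π+1) e_a ∧ δω`. -/
def twistor (G : LocalMetric n) (a : Fin n) (ω : LocalForm n) (y : EuclideanSpace ℝ (Fin n)) :
    Form n :=
  nabla G a ω y
    - degFun (fun p => 1 / ((p : ℝ) + 1)) (hook a (extd G ω y))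
    + degFun (fun p => 1 / ((n : ℝ) - p + 1)) (cofLow (G y) a * codiff G ω y)

/-- The zeroth-order coefficient `(π-1)/(2π) dω` of the operator `K_ω`. -/
def tildeK (G : LocalMetric n) (ω : LocalForm n) (y : EuclideanSpace ℝ (Fin n)) : Form n :=
  degFun (fun p => ((p : ℝ) - 1) / (2 * p)) (extd G ω y)

/-- The zeroth-order coefficient `-(n-π-1)/(2(n-π)) δω` of the operator `M_ω`. -/
def tildeM (G : LocalMetric n) (ω : LocalForm n) (y : EuclideanSpace ℝ (Fin n)) : Form n :=
  -degFun (fun p => ((n : ℝ) - p - 1) / (2 * ((n : ℝ) - p))) (codiff G ω y)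

/-- The first-order operator `K_ω = X^a ⌟ ω ∇_a + (π-1)/(2π) dω`; the coefficients act on Clifford
objects by left Clifford multiplication. -/
def opK (G : LocalMetric n) (ω ψ : LocalForm n) : LocalForm n := fun y =>
  ∑ a, cliff (G y) (hookUp (G y) a (ω y)) (nabla G a ψ y) + cliff (G y) (tildeK G ω y) (ψ y)

/-- The first-order operator `M_ω = e^a ∧ ω ∇_a - (n-π-1)/(2(n-π)) δω`; the coefficients act on
Clifford objects by left Clifford multiplication. -/
def opM (G : LocalMetric n) (ω ψ : LocalForm n) : LocalForm n := fun y =>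
  ∑ a, cliff (G y) (cof a * ω y) (nabla G a ψ y) + cliff (G y) (tildeM G ω y) (ψ y)

/-- Smoothness of a field of forms on a set, through its components. -/
def SmoothOn (ω : LocalForm n) (U : Set (EuclideanSpace ℝ (Fin n))) : Prop :=
  ∀ S, ContDiffOn ℝ (⊤ : ℕ∞) (fun y => (formBasis n).repr (ω y) S) U

/-! ### The explicit Killing-Yano brackets on a coordinate domain -/

/-- The first-order coefficient (index `b`) of the commutator of the operators
`A^a ∇_a + A'` and `B^a ∇_a + B'` at a point, that is
`A^a (∇_a B^b) - B^a (∇_a A^b) + [A^b, B'] - [B^b, A']`.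
Here `dA a b` and `dB a b` stand for `∇_a A^b` and `∇_a B^b`. -/
def curly (G : Matrix (Fin n) (Fin n) ℝ) (A : Fin n → Form n) (dA : Fin n → Fin n → Form n)
    (A' : Form n) (B : Fin n → Form n) (dB : Fin n → Fin n → Form n) (B' : Form n)
    (b : Fin n) : Form n :=
  ∑ a, (cliff G (A a) (dB a b) - cliff G (B a) (dA a b)) + comm G (A b) B' - comm G (B b) A'

/-- The Killing-Yano bracket of two odd KY forms,
`(1/π) e_b ∧ {κ^a (∇_a λ^b) - λ^a (∇_a κ^b) + [κ^b, λ'] - [λ^b, κ']}`,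
with `κ^a = X^a ⌟ κ` and `κ' = (π-1)/(2π) dκ`, and likewise for `λ`. -/
def bracketKK (G : LocalMetric n) (κ lam : LocalForm n) (y : EuclideanSpace ℝ (Fin n)) : Form n :=
  degFun (fun p => 1 / (p : ℝ)) (∑ b, cofLow (G y) b *
    curly (G y)
      (fun a => hookUp (G y) a (κ y)) (fun a b => hookUp (G y) b (nabla G a κ y)) (tildeK G κ y)
      (fun a => hookUp (G y) a (lam y)) (fun a b => hookUp (G y) b (nabla G a lam y))
      (tildeK G lam y) b)

/-- The Killing-Yano bracket of an odd KY form and an even CCKY form,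
`1/(n-π) X_b ⌟ {μ^a (∇_a ω^b) - ω^a (∇_a μ^b) + [μ^b, ω'] - [ω^b, μ']}`,
with `μ^a = X^a ⌟ μ`, `μ' = (π-1)/(2π) dμ`, `ω^a = e^a ∧ ω`, `ω' = -(n-π-1)/(2(n-π)) δω`. -/
def bracketKM (G : LocalMetric n) (μ ω : LocalForm n) (y : EuclideanSpace ℝ (Fin n)) : Form n :=
  degFun (fun p => 1 / ((n : ℝ) - p)) (∑ b, hook b
    (curly (G y)
      (fun a => hookUp (G y) a (μ y)) (fun a b => hookUp (G y) b (nabla G a μ y)) (tildeK G μ y)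
      (fun a => cof a * ω y) (fun a b => cof b * nabla G a ω y) (tildeM G ω y) b))

/-- The Killing-Yano bracket of two even CCKY forms,
`(1/π) e_b ∧ {α^a (∇_a β^b) - β^a (∇_a α^b) + [α^b, β'] - [β^b, α']}`,
with `α^a = e^a ∧ α` and `α' = -(n-π-1)/(2(n-π)) δα`, and likewise for `β`. -/
def bracketMM (G : LocalMetric n) (α β : LocalForm n) (y : EuclideanSpace ℝ (Fin n)) : Form n :=
  degFun (fun p => 1 / (p : ℝ)) (∑ b, cofLow (G y) b *
    curly (G y)
      (fun a => cof a * α y) (fun a b => cof b * nabla G a α y) (tildeM G α y)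
      (fun a => cof a * β y) (fun a b => cof b * nabla G a β y) (tildeM G β y) b)

/-! ### Metrics and forms on a manifold -/

variable {M : Type*} [TopologicalSpace M] [ChartedSpace (EuclideanSpace ℝ (Fin n)) M]

/-- Fields of bilinear forms on the tangent spaces of `M`. -/
abbrev MetricField (n : ℕ) (M : Type*) [TopologicalSpace M]
    [ChartedSpace (EuclideanSpace ℝ (Fin n)) M] :=
  (x : M) → LinearMap.BilinForm ℝ (TangentSpace (𝓡 n) x)

/-- Fields of inhomogeneous antisymmetric forms on `M`. -/
abbrev FormField (n : ℕ) (M : Type*) [TopologicalSpace M]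
    [ChartedSpace (EuclideanSpace ℝ (Fin n)) M] :=
  (x : M) → ExteriorAlgebra ℝ (Module.Dual ℝ (TangentSpace (𝓡 n) x))

/-- The `i`-th coordinate vector of the chart `φ` at the point with coordinates `y`. -/
def coordVec (φ : OpenPartialHomeomorph M (EuclideanSpace ℝ (Fin n)))
    (y : EuclideanSpace ℝ (Fin n)) (i : Fin n) : TangentSpace (𝓡 n) (φ.symm y) :=
  mfderiv (𝓡 n) (𝓡 n) φ.symm y (EuclideanSpace.single i (1 : ℝ) : EuclideanSpace ℝ (Fin n))

/-- The components of a metric in the chart `φ`. -/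
def metricRep (g : MetricField n M) (φ : OpenPartialHomeomorph M (EuclideanSpace ℝ (Fin n))) :
    LocalMetric n := fun y =>
  Matrix.of fun i j => g (φ.symm y) (coordVec φ y i) (coordVec φ y j)

/-- The coordinate expression of a form in the chart `φ`: a covector is replaced by its components
with respect to the coordinate vectors. -/
def formRep (ω : FormField n M) (φ : OpenPartialHomeomorph M (EuclideanSpace ℝ (Fin n))) :
    LocalForm n := fun y =>
  ExteriorAlgebra.map
    (LinearMap.pi fun i => Module.Dual.eval ℝ (TangentSpace (𝓡 n) (φ.symm y)) (coordVec φ y i))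
    (ω (φ.symm y))

/-- A smooth pseudo-Riemannian metric of arbitrary signature. -/
structure IsPseudoRiemannian (g : MetricField n M) : Prop where
  symm : ∀ x, (g x).IsSymm
  nondegenerate : ∀ x, (g x).Nondegenerate
  smooth : ∀ φ ∈ atlas (EuclideanSpace ℝ (Fin n)) M, ∀ i j,
    ContDiffOn ℝ (⊤ : ℕ∞) (fun y => metricRep g φ y i j) φ.target

/-- Smooth fields of forms on `M`. -/
def IsSmooth (ω : FormField n M) : Prop :=
  ∀ φ ∈ atlas (EuclideanSpace ℝ (Fin n)) M, SmoothOn (formRep ω φ) φ.target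

/-- Homogeneous forms of degree `p`. -/
def IsHomogeneous (p : ℕ) (ω : FormField n M) : Prop :=
  ∀ x, ω x ∈ ⋀[ℝ]^p (Module.Dual ℝ (TangentSpace (𝓡 n) x))

/-- The part of degree `p` of `ω` vanishes. -/
def NoPart (p : ℕ) (ω : FormField n M) : Prop :=
  ∀ x, GradedAlgebra.proj
    (fun i : ℕ => ⋀[ℝ]^i (Module.Dual ℝ (TangentSpace (𝓡 n) x))) p (ω x) = 0

/-- Killing-Yano forms: smooth (inhomogeneous) forms with `T_a ω = 0` and `δω = 0`. -/
def IsKY (g : MetricField n M) (ω : FormField n M) : Prop :=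
  IsSmooth ω ∧ ∀ φ ∈ atlas (EuclideanSpace ℝ (Fin n)) M, ∀ y ∈ φ.target,
    (∀ a, twistor (metricRep g φ) a (formRep ω φ) y = 0) ∧
      codiff (metricRep g φ) (formRep ω φ) y = 0

/-- Closed conformal Killing-Yano forms: smooth (inhomogeneous) forms with `T_a ω = 0` and
`dω = 0`. -/
def IsCCKY (g : MetricField n M) (ω : FormField n M) : Prop :=
  IsSmooth ω ∧ ∀ φ ∈ atlas (EuclideanSpace ℝ (Fin n)) M, ∀ y ∈ φ.target,
    (∀ a, twistor (metricRep g φ) a (formRep ω φ) y = 0) ∧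
      extd (metricRep g φ) (formRep ω φ) y = 0

/-- The necessary condition `[X^a ⌟ κ, X_a ⌟ λ] = 0` for two KY forms. -/
def NecessaryKK (g : MetricField n M) (κ lam : FormField n M) : Prop :=
  ∀ φ ∈ atlas (EuclideanSpace ℝ (Fin n)) M, ∀ y ∈ φ.target,
    ∑ a, comm (metricRep g φ y) (hookUp (metricRep g φ y) a (formRep κ φ y))
      (hook a (formRep lam φ y)) = 0

/-- The necessary condition `[X^a ⌟ μ, e_a ∧ ω] = 0` for a KY form and a CCKY form. -/
def NecessaryKM (g : MetricField n M) (μ ω : FormField n M) : Prop :=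
  ∀ φ ∈ atlas (EuclideanSpace ℝ (Fin n)) M, ∀ y ∈ φ.target,
    ∑ a, comm (metricRep g φ y) (hookUp (metricRep g φ y) a (formRep μ φ y))
      (cofLow (metricRep g φ y) a * formRep ω φ y) = 0

/-- The necessary condition `[e^a ∧ α, e_a ∧ β] = 0` for two CCKY forms. -/
def NecessaryMM (g : MetricField n M) (α β : FormField n M) : Prop :=
  ∀ φ ∈ atlas (EuclideanSpace ℝ (Fin n)) M, ∀ y ∈ φ.target,
    ∑ a, comm (metricRep g φ y) (cof a * formRep α φ y)
      (cofLow (metricRep g φ y) a * formRep β φ y) = 0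

/-- `ν` is the Killing-Yano bracket of the KY forms `κ` and `λ` in the sense of operators:
an odd KY form with `[K_κ, K_λ] = K_ν`. -/
def IsBracketKK (g : MetricField n M) (κ lam ν : FormField n M) : Prop :=
  IsKY g ν ∧ (∀ p, Even p → NoPart p ν) ∧
    ∀ φ ∈ atlas (EuclideanSpace ℝ (Fin n)) M, ∀ ψ : LocalForm n, SmoothOn ψ φ.target →
      ∀ y ∈ φ.target,
        opK (metricRep g φ) (formRep κ φ) (opK (metricRep g φ) (formRep lam φ) ψ) y
          - opK (metricRep g φ) (formRep lam φ) (opK (metricRep g φ) (formRep κ φ) ψ) y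
          = opK (metricRep g φ) (formRep ν φ) ψ y

/-- `ν` is the Killing-Yano bracket of the KY form `μ` and the CCKY form `ω` in the sense of
operators: an even CCKY form with `[K_μ, M_ω] = M_ν`. As `M_ν` does not see the part of `ν` of top
degree `n`, this part is normalised to zero. -/
def IsBracketKM (g : MetricField n M) (μ ω ν : FormField n M) : Prop :=
  IsCCKY g ν ∧ (∀ p, Odd p → NoPart p ν) ∧ NoPart n ν ∧
    ∀ φ ∈ atlas (EuclideanSpace ℝ (Fin n)) M, ∀ ψ : LocalForm n, SmoothOn ψ φ.target →
      ∀ y ∈ φ.target,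
        opK (metricRep g φ) (formRep μ φ) (opM (metricRep g φ) (formRep ω φ) ψ) y
          - opM (metricRep g φ) (formRep ω φ) (opK (metricRep g φ) (formRep μ φ) ψ) y
          = opM (metricRep g φ) (formRep ν φ) ψ y

/-- `ν` is the Killing-Yano bracket of the CCKY forms `α` and `β` in the sense of operators:
an odd KY form with `[M_α, M_β] = K_ν`. -/
def IsBracketMM (g : MetricField n M) (α β ν : FormField n M) : Prop :=
  IsKY g ν ∧ (∀ p, Even p → NoPart p ν) ∧
    ∀ φ ∈ atlas (EuclideanSpace ℝ (Fin n)) M, ∀ ψ : LocalForm n, SmoothOn ψ φ.target →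
      ∀ y ∈ φ.target,
        opM (metricRep g φ) (formRep α φ) (opM (metricRep g φ) (formRep β φ) ψ) y
          - opM (metricRep g φ) (formRep β φ) (opM (metricRep g φ) (formRep α φ) ψ) y
          = opK (metricRep g φ) (formRep ν φ) ψ y

end KillingYano

end

/-!
Killing-Yano brackets of odd Killing-Yano (KY) forms and even closed conformal Killing-Yano (CCKY)
forms.

The argument rests on the fact that the two kinds of forms obey the same identities in the Clifford
algebra of the inverse metric. For a KY form `κ` of odd degree `p` put `k = dκ/(p+1)`; for a CCKY
form `κ` of even degree `c` put `p = n - c` and `k = -δκ/(n-c+1)`. In both cases the operator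
attached to `κ` is `A^a ∇_a + A'` with `A^a = ½{e^a, κ}` and `A' = (p/2) k`, and
`∇_a κ = ½[e_a, k]` (`OperatorData`, `OperatorOn`). Moreover `κ` and `k` are eigenvectors of
`S x = e^a x e_a`, an operator which acts on forms of degree `d` as the scalar `(-1)^d (n - 2d)`
(`toForm_S`). All the computations are then consequences of the anticommutation relations alone
(`CliffordFrame`).

For two such forms `κ, λ` (of "degrees" `p, q`, with companions `k, l`) the necessary condition says
exactly that `Y = [κ, λ]` satisfies `S Y = (n - 2(p+q)) Y` (`CliffordFrame.sum_comm_up_low`), so `Y`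
is zero or a multiple of a single contracted wedge product of `κ` and `λ`. The
Levi-Civita connection is a derivation of the Clifford product (`MetricOn.nabla_cliff`), so the
derivatives `∇_b Y` satisfy the same equation. Contracting them with `e^b` by commutators and
anticommutators gives two eigenvalue equations. The second kills all anticommutators in the contracted
first-order coefficient `{κ, λ}^b`, and the first reduces what is left to `(pq/2) Q`, where
`Q = [k, λ] + [κ, l]` (`CliffordFrame.sum_f_curly`). The first also shows that at most two homogeneous
parts of `Q` are non-zero and that `δY` (or `dY`) is a combination of these (`sum_comm_cof_dY`,
`pr_comm_eq_zero_of_sval`). The Clifford product is a sum of contracted wedge products with explicit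
coefficients (`cliff_eq_sum`), and exchanging the factors only changes signs of the homogeneous parts
(`pr_cliff_swap`); this sign shows that at most one part of `Q` survives. If it is the
lower one, comparison with `δY` or `dY` gives the formula; for two CCKY forms in even dimension it is
the upper one, which is written out directly (`bracketMM_eq_of_even`).

For the brackets defined by operators, the commutator identity is tested on functions times the unit
(`MetricOn.coeff_of_commutator`): quadratic functions give the necessary condition, and coordinate
functions identify the first-order coefficient of the operator of `ν` with `{κ, λ}^b`. As `ν` is
recovered from this coefficient by Euler's identity, it is the explicit bracket.
-/

noncomputable section

namespace KillingYano

variable {n : ℕ}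

/-! ### Degrees and inner derivatives -/

/-- The parity involution `(-1)^π` of the exterior algebra. -/
abbrev inv : Form n →ₐ[ℝ] Form n := CliffordAlgebra.involute

/-- The part of degree `d` of a form. -/
abbrev pr (d : ℕ) : Form n →ₗ[ℝ] Form n :=
  GradedAlgebra.proj (fun i : ℕ => ⋀[ℝ]^i (Fin n → ℝ)) d

lemma pr_of_mem {d : ℕ} {x : Form n} (h : x ∈ ⋀[ℝ]^d (Fin n → ℝ)) : pr d x = x := by
  rw [GradedAlgebra.proj_apply]
  exact DirectSum.decompose_of_mem_same _ h

lemma pr_of_mem_ne {d e : ℕ} {x : Form n} (h : x ∈ ⋀[ℝ]^d (Fin n → ℝ)) (hde : d ≠ e) :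
    pr e x = 0 := by
  rw [GradedAlgebra.proj_apply]
  exact DirectSum.decompose_of_mem_ne _ h hde

lemma pr_mem (d : ℕ) (x : Form n) : pr d x ∈ ⋀[ℝ]^d (Fin n → ℝ) := by
  rw [GradedAlgebra.proj_apply]
  exact Subtype.property _

lemma eq_zero_of_mem {d : ℕ} (hd : n < d) {x : Form n} (h : x ∈ ⋀[ℝ]^d (Fin n → ℝ)) : x = 0 := by
  have h1 : Module.finrank ℝ (⋀[ℝ]^d (Fin n → ℝ)) = 0 := by
    rw [exteriorPower.finrank_eq, Module.finrank_fin_fun, Nat.choose_eq_zero_of_lt hd]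
  have := Module.finrank_zero_iff.mp h1
  exact congrArg Subtype.val (Subsingleton.elim (⟨x, h⟩ : ⋀[ℝ]^d (Fin n → ℝ)) 0)

lemma pr_eq_zero {d : ℕ} (hd : n < d) (x : Form n) : pr d x = 0 :=
  eq_zero_of_mem hd (pr_mem d x)

lemma sum_pr (x : Form n) : ∑ d ∈ Finset.range (n + 1), pr d x = x := by
  classical
  conv_rhs => rw [← DirectSum.sum_support_decompose (fun i : ℕ => ⋀[ℝ]^i (Fin n → ℝ)) x]
  symm
  apply Finset.sum_subset
  · intro d hd
    rw [GradedAlgebra.mem_support_iff] at hd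
    by_contra h
    exact hd (pr_eq_zero (by simpa using h) x)
  · intro d _ hd
    rw [GradedAlgebra.mem_support_iff, not_not] at hd
    exact hd

lemma pr_ext {x y : Form n} (h : ∀ d, pr d x = pr d y) : x = y := by
  rw [← sum_pr x, ← sum_pr y]
  exact Finset.sum_congr rfl fun d _ => h d

lemma pr_pr (d e : ℕ) (x : Form n) : pr d (pr e x) = if d = e then pr d x else 0 := by
  split_ifs with h
  · subst h
    exact pr_of_mem (pr_mem _ _)
  · exact pr_of_mem_ne (pr_mem _ _) (Ne.symm h)

lemma pr_degFun (f : ℕ → ℝ) (d : ℕ) (x : Form n) : pr d (degFun f x) = f d • pr d x := by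
  unfold degFun
  rw [map_sum]
  simp_rw [map_smul]
  change ∑ p ∈ Finset.range (n + 1), f p • pr d (pr p x) = _
  simp_rw [pr_pr]
  by_cases hd : d < n + 1
  · simp [hd]
  · rw [pr_eq_zero (by omega), smul_zero]
    refine Finset.sum_eq_zero fun p hp => ?_
    simp

lemma degFun_of_mem (f : ℕ → ℝ) {d : ℕ} {x : Form n} (h : x ∈ ⋀[ℝ]^d (Fin n → ℝ)) :
    degFun f x = f d • x := by
  refine pr_ext fun e => ?_
  rw [pr_degFun, map_smul]
  by_cases hde : d = e
  · rw [hde]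
  · rw [pr_of_mem_ne h hde, smul_zero, smul_zero]

/-- Induction over forms by wedge products with one-forms from the left. -/
lemma form_induction {P : Form n → Prop} (scalar : ∀ r, P (algebraMap ℝ _ r))
    (add : ∀ x y, P x → P y → P (x + y))
    (mul : ∀ x v, P x → P (ExteriorAlgebra.ι ℝ v * x)) (x : Form n) : P x :=
  CliffordAlgebra.left_induction (0 : QuadraticForm ℝ (Fin n → ℝ)) scalar add mul x

/-- Induction over homogeneous forms. -/
lemma mem_induction {C : ℕ → Form n → Prop} (scalar : ∀ r, C 0 (algebraMap ℝ _ r))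
    (add : ∀ i x y, C i x → C i y → C i (x + y))
    (mul : ∀ i v x, x ∈ ⋀[ℝ]^i (Fin n → ℝ) → C i x → C (i + 1) (ExteriorAlgebra.ι ℝ v * x))
    {d : ℕ} {x : Form n} (h : x ∈ ⋀[ℝ]^d (Fin n → ℝ)) : C d x := by
  refine Submodule.pow_induction_on_left' (M := LinearMap.range (ExteriorAlgebra.ι ℝ))
    (C := fun i x _ => C i x) scalar (fun x y i _ _ => add i x y) ?_ h
  rintro m ⟨v, rfl⟩ i x hx hc
  exact mul i v x hx hc

lemma wedge_mem {p q : ℕ} {x y : Form n} (hx : x ∈ ⋀[ℝ]^p (Fin n → ℝ))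
    (hy : y ∈ ⋀[ℝ]^q (Fin n → ℝ)) : x * y ∈ ⋀[ℝ]^(p + q) (Fin n → ℝ) :=
  SetLike.mul_mem_graded hx hy

lemma ι_mem (v : Fin n → ℝ) : ExteriorAlgebra.ι ℝ v ∈ ⋀[ℝ]^1 (Fin n → ℝ) := by
  have h : ExteriorAlgebra.ι ℝ v ∈ LinearMap.range (ExteriorAlgebra.ι ℝ (M := Fin n → ℝ)) ^ 1 := by
    rw [pow_one]
    exact ⟨v, rfl⟩
  exact h

lemma cof_mem (a : Fin n) : cof a ∈ ⋀[ℝ]^1 (Fin n → ℝ) := ι_mem _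

lemma cof_mul_mem (a : Fin n) {p : ℕ} {x : Form n} (hx : x ∈ ⋀[ℝ]^p (Fin n → ℝ)) :
    cof a * x ∈ ⋀[ℝ]^(p + 1) (Fin n → ℝ) := by
  rw [add_comm]; exact wedge_mem (cof_mem a) hx

lemma inv_ι (v : Fin n → ℝ) : inv (ExteriorAlgebra.ι ℝ v) = -ExteriorAlgebra.ι ℝ v :=
  CliffordAlgebra.involute_ι v

lemma inv_cof (a : Fin n) : inv (cof a) = -cof a := inv_ι _

lemma inv_of_mem {d : ℕ} {x : Form n} (h : x ∈ ⋀[ℝ]^d (Fin n → ℝ)) : inv x = (-1 : ℝ) ^ d • x := by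
  refine mem_induction (C := fun d x => inv x = (-1 : ℝ) ^ d • x) ?_ ?_ ?_ h
  · intro r; simp
  · intro i x y hx hy; rw [map_add, hx, hy, smul_add]
  · intro i v x _ hx
    rw [map_mul, inv_ι, hx, pow_succ, mul_smul_comm, neg_mul]
    simp

lemma inv_even {d : ℕ} (hd : Even d) {x : Form n} (h : x ∈ ⋀[ℝ]^d (Fin n → ℝ)) : inv x = x := by
  rw [inv_of_mem h, hd.neg_one_pow, one_smul]

lemma inv_odd {d : ℕ} (hd : Odd d) {x : Form n} (h : x ∈ ⋀[ℝ]^d (Fin n → ℝ)) : inv x = -x := by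
  rw [inv_of_mem h, hd.neg_one_pow, neg_one_smul]

lemma pr_inv (d : ℕ) (x : Form n) : pr d (inv x) = (-1 : ℝ) ^ d • pr d x := by
  have h : inv x = degFun (fun e => (-1) ^ e) x := by
    conv_lhs => rw [← sum_pr x]
    rw [map_sum]
    exact Finset.sum_congr rfl fun e _ => inv_of_mem (pr_mem e x)
  rw [h, pr_degFun]

/-- A form of one parity has no parts of the other parity. -/
lemma pr_eq_zero_of_inv_eq {d : ℕ} {x : Form n} (hx : inv x = -((-1 : ℝ) ^ d • x)) :
    pr d x = 0 := by
  have h := pr_inv d x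
  rw [hx, map_neg, map_smul, neg_eq_iff_add_eq_zero, ← two_smul ℝ, smul_smul] at h
  exact (smul_eq_zero.mp h).resolve_left
    (mul_ne_zero two_ne_zero (pow_ne_zero _ (by norm_num)))

/-- Contraction of a form with a vector, given as a linear functional on covectors. -/
abbrev ctr (d : Module.Dual ℝ (Fin n → ℝ)) : Form n →ₗ[ℝ] Form n :=
  CliffordAlgebra.contractLeft (Q := (0 : QuadraticForm ℝ (Fin n → ℝ))) d

lemma hook_eq (a : Fin n) : hook a = ctr (n := n) (LinearMap.proj a) := rfl

lemma hookUp_eq (G : Matrix (Fin n) (Fin n) ℝ) (a : Fin n) (x : Form n) :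
    hookUp G a x = ctr (∑ b, G⁻¹ a b • LinearMap.proj b) x := by
  simp [hookUp, hook, map_sum, LinearMap.sum_apply]

lemma ctr_ι_mul (d : Module.Dual ℝ (Fin n → ℝ)) (v : Fin n → ℝ) (x : Form n) :
    ctr d (ExteriorAlgebra.ι ℝ v * x) = d v • x - ExteriorAlgebra.ι ℝ v * ctr d x :=
  CliffordAlgebra.contractLeft_ι_mul _ _ _

lemma ctr_ctr (d e : Module.Dual ℝ (Fin n → ℝ)) (x : Form n) :
    ctr d (ctr e x) = -ctr e (ctr d x) :=
  CliffordAlgebra.contractLeft_comm _ _ _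

lemma ctr_cof_mul (d : Module.Dual ℝ (Fin n → ℝ)) (a : Fin n) (x : Form n) :
    ctr d (cof a * x) = d (Pi.single a 1) • x - cof a * ctr d x := ctr_ι_mul _ _ _

lemma hook_cof_mul (a b : Fin n) (x : Form n) :
    hook a (cof b * x) = (if a = b then (1 : ℝ) else 0) • x - cof b * hook a x := by
  rw [hook_eq, ctr_cof_mul]
  simp [Pi.single_apply]

lemma hook_hook (a b : Fin n) (x : Form n) : hook a (hook b x) = -hook b (hook a x) :=
  ctr_ctr _ _ _

lemma inv_ctr (d : Module.Dual ℝ (Fin n → ℝ)) (x : Form n) : inv (ctr d x) = -ctr d (inv x) := by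
  induction x using form_induction with
  | scalar r => simp [ctr]
  | add x y hx hy => simp only [map_add, hx, hy, neg_add]
  | mul x m hx =>
    simp only [ctr_ι_mul, map_mul, inv_ι, map_sub, map_smul, hx, neg_mul, map_neg]
    noncomm_ring

lemma inv_hook (a : Fin n) (x : Form n) : inv (hook a x) = -hook a (inv x) := inv_ctr _ _

/-- The inner derivative is an antiderivation. -/
lemma ctr_mul (d : Module.Dual ℝ (Fin n → ℝ)) (x y : Form n) :
    ctr d (x * y) = ctr d x * y + inv x * ctr d y := by
  induction x using form_induction with
  | scalar r => simp [ctr, ← Algebra.smul_def]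
  | add x x' hx hy => simp only [add_mul, map_add, hx, hy]; abel
  | mul x m hx =>
    rw [mul_assoc, ctr_ι_mul, ctr_ι_mul, hx, map_mul inv, inv_ι]
    simp only [sub_mul, mul_add, smul_mul_assoc, mul_assoc, neg_mul]
    abel

lemma ctr_mem (d : Module.Dual ℝ (Fin n → ℝ)) {p : ℕ} {x : Form n}
    (hx : x ∈ ⋀[ℝ]^p (Fin n → ℝ)) :
    ctr d x ∈ ⋀[ℝ]^(p - 1) (Fin n → ℝ) ∧ (p = 0 → ctr d x = 0) := by
  refine mem_induction (C := fun p x => ctr d x ∈ ⋀[ℝ]^(p - 1) (Fin n → ℝ) ∧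
    (p = 0 → ctr d x = 0)) ?_ ?_ ?_ hx
  · intro r; simp [ctr]
  · rintro i x y ⟨hx, hx'⟩ ⟨hy, hy'⟩
    refine ⟨by rw [map_add]; exact add_mem hx hy, fun h => by rw [map_add, hx' h, hy' h, add_zero]⟩
  · rintro i v x hx ⟨h1, h2⟩
    refine ⟨?_, by simp⟩
    rw [ctr_ι_mul]
    refine sub_mem (Submodule.smul_mem _ _ hx) ?_
    rcases Nat.eq_zero_or_pos i with h | h
    · rw [h2 h, mul_zero]; exact zero_mem _
    · have := wedge_mem (ι_mem v) h1
      rwa [show 1 + (i - 1) = i + 1 - 1 by omega] at this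

lemma hook_mem (a : Fin n) {p : ℕ} {x : Form n} (hx : x ∈ ⋀[ℝ]^p (Fin n → ℝ)) :
    hook a x ∈ ⋀[ℝ]^(p - 1) (Fin n → ℝ) := (ctr_mem _ hx).1

lemma hook_of_mem_zero (a : Fin n) {x : Form n} (hx : x ∈ ⋀[ℝ]^0 (Fin n → ℝ)) :
    hook a x = 0 := (ctr_mem _ hx).2 rfl

lemma sum_cof_smul (v : Fin n → ℝ) : ∑ a, v a • cof a = ExteriorAlgebra.ι ℝ v := by
  simp only [cof, ← map_smul, ← map_sum]
  congr 1
  ext i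
  simp [Finset.sum_apply, Pi.single_apply]

/-- Euler's identity `e^a ∧ X_a ⌟ ω = π ω`. -/
lemma sum_cof_hook {p : ℕ} {x : Form n} (hx : x ∈ ⋀[ℝ]^p (Fin n → ℝ)) :
    ∑ a, cof a * hook a x = (p : ℝ) • x := by
  refine mem_induction (C := fun p x => ∑ a, cof a * hook a x = (p : ℝ) • x) ?_ ?_ ?_ hx
  · intro r; simp [hook]
  · intro i x y hx hy; simp only [map_add, mul_add, Finset.sum_add_distrib, hx, hy, smul_add]
  · intro i v x _ hx
    have h1 : ∀ a, cof a * hook a (ExteriorAlgebra.ι ℝ v * x)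
        = (v a • cof a) * x + ExteriorAlgebra.ι ℝ v * (cof a * hook a x) := fun a => by
      have h2 : cof a * ExteriorAlgebra.ι ℝ v = -(ExteriorAlgebra.ι ℝ v * cof a) :=
        eq_neg_of_add_eq_zero_left (ExteriorAlgebra.ι_add_mul_swap (R := ℝ) (Pi.single a 1) v)
      rw [hook_eq, ctr_ι_mul, mul_sub, ← mul_assoc, ← mul_assoc, h2]
      simp
    simp_rw [h1, Finset.sum_add_distrib, ← Finset.sum_mul, ← Finset.mul_sum]
    rw [sum_cof_smul, hx]
    push_cast
    rw [mul_smul_comm, add_smul, one_smul, add_comm]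

lemma sum_hook_cof {p : ℕ} {x : Form n} (hx : x ∈ ⋀[ℝ]^p (Fin n → ℝ)) :
    ∑ a, hook a (cof a * x) = ((n : ℝ) - p) • x := by
  simp_rw [hook_cof_mul, Finset.sum_sub_distrib]
  rw [sum_cof_hook hx, sub_smul]
  simp [← Nat.cast_smul_eq_nsmul ℝ]

/-- Graded commutativity of the wedge product with a one-form. -/
lemma ι_mul_comm (v : Fin n → ℝ) (x : Form n) :
    x * ExteriorAlgebra.ι ℝ v = ExteriorAlgebra.ι ℝ v * inv x := by
  induction x using form_induction with
  | scalar r => simp [Algebra.commutes]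
  | add x y hx hy => simp only [map_add, add_mul, mul_add, hx, hy]
  | mul x m hx =>
    rw [map_mul, inv_ι, mul_assoc, hx, ← mul_assoc, neg_mul, mul_neg, ← mul_assoc,
      eq_neg_of_add_eq_zero_left (ExteriorAlgebra.ι_add_mul_swap (R := ℝ) m v), neg_mul]

lemma wedge_comm {p q : ℕ} {x y : Form n} (hx : x ∈ ⋀[ℝ]^p (Fin n → ℝ))
    (hy : y ∈ ⋀[ℝ]^q (Fin n → ℝ)) : y * x = (-1 : ℝ) ^ (p * q) • (x * y) := by
  refine mem_induction (C := fun p x => y * x = (-1 : ℝ) ^ (p * q) • (x * y)) ?_ ?_ ?_ hx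
  · intro r; simp [Algebra.commutes]
  · intro i x x' hx hx'; rw [mul_add, add_mul, smul_add, hx, hx']
  · intro i v x _ hx
    rw [← mul_assoc, ι_mul_comm, inv_of_mem hy, mul_assoc, smul_mul_assoc, hx, mul_smul_comm,
      mul_smul_comm, smul_smul, mul_assoc, ← pow_add]
    congr 2; ring

/-! ### The contracted wedge products -/

/-- The vector with components `G⁻¹ v`, metrically dual to the covector `v`, as a functional on
covectors. -/
def sharp (G : Matrix (Fin n) (Fin n) ℝ) (v : Fin n → ℝ) : Module.Dual ℝ (Fin n → ℝ) :=
  ∑ a, v a • ∑ b, G⁻¹ a b • LinearMap.proj b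

lemma sharp_single (G : Matrix (Fin n) (Fin n) ℝ) (a : Fin n) (x : Form n) :
    ctr (sharp G (Pi.single a 1)) x = hookUp G a x := by
  rw [hookUp_eq]
  congr 2
  simp [sharp, Pi.single_apply]

lemma ctr_sharp (G : Matrix (Fin n) (Fin n) ℝ) (v : Fin n → ℝ) (x : Form n) :
    ctr (sharp G v) x = ∑ a, v a • hookUp G a x := by
  simp_rw [hookUp_eq]
  simp [sharp, map_sum, map_smul, LinearMap.sum_apply, LinearMap.smul_apply]

/-- The contracted wedge product as a bilinear map. -/
def cwL (G : Matrix (Fin n) (Fin n) ℝ) : ℕ → Form n →ₗ[ℝ] Form n →ₗ[ℝ] Form n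
  | 0 => LinearMap.mul ℝ (Form n)
  | k + 1 => ∑ a, (cwL G k).compl₁₂ (hook a) (ctr (sharp G (Pi.single a 1)))

lemma cwedge_eq (G : Matrix (Fin n) (Fin n) ℝ) (k : ℕ) (x y : Form n) :
    cwedge G k x y = cwL G k x y := by
  induction k generalizing x y with
  | zero => rfl
  | succ k ih =>
    simp [cwedge, cwL, ih, LinearMap.sum_apply, sharp_single]

variable (G : Matrix (Fin n) (Fin n) ℝ)

lemma cwL_succ (k : ℕ) (x y : Form n) :
    cwL G (k + 1) x y = ∑ a, cwL G k (hook a x) (hookUp G a y) := by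
  simp [cwL, LinearMap.sum_apply, sharp_single]

lemma hookUp_mem (a : Fin n) {p : ℕ} {x : Form n} (hx : x ∈ ⋀[ℝ]^p (Fin n → ℝ)) :
    hookUp G a x ∈ ⋀[ℝ]^(p - 1) (Fin n → ℝ) := by
  rw [hookUp_eq]; exact (ctr_mem _ hx).1

lemma hookUp_of_mem_zero (a : Fin n) {x : Form n} (hx : x ∈ ⋀[ℝ]^0 (Fin n → ℝ)) :
    hookUp G a x = 0 := by
  rw [hookUp_eq]; exact (ctr_mem _ hx).2 rfl

lemma inv_hookUp (a : Fin n) (x : Form n) : inv (hookUp G a x) = -hookUp G a (inv x) := by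
  rw [hookUp_eq, hookUp_eq, inv_ctr]

lemma hookUp_neg (a : Fin n) (x : Form n) : hookUp G a (-x) = -hookUp G a x := by
  rw [hookUp_eq, hookUp_eq, map_neg]

lemma hookUp_smul (a : Fin n) (r : ℝ) (x : Form n) : hookUp G a (r • x) = r • hookUp G a x := by
  rw [hookUp_eq, hookUp_eq, map_smul]

lemma hookUp_add (a : Fin n) (x y : Form n) : hookUp G a (x + y) = hookUp G a x + hookUp G a y := by
  rw [hookUp_eq, hookUp_eq, hookUp_eq, map_add]

lemma inv_cwL (k : ℕ) (x y : Form n) : inv (cwL G k x y) = cwL G k (inv x) (inv y) := by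
  induction k generalizing x y with
  | zero => exact map_mul inv x y
  | succ k ih =>
    simp_rw [cwL_succ, map_sum, ih, inv_hook, inv_hookUp, map_neg, LinearMap.neg_apply, neg_neg]

lemma cwL_eq_zero_left {k p : ℕ} (hk : p < k) {x : Form n} (hx : x ∈ ⋀[ℝ]^p (Fin n → ℝ))
    (y : Form n) : cwL G k x y = 0 := by
  induction k generalizing p x y with
  | zero => omega
  | succ k ih =>
    rw [cwL_succ]
    refine Finset.sum_eq_zero fun a _ => ?_
    rcases Nat.eq_zero_or_pos p with h | h
    · subst h
      rw [hook_of_mem_zero a hx, map_zero, LinearMap.zero_apply]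
    · exact ih (by omega) (hook_mem a hx) _

lemma cwL_eq_zero_right {k q : ℕ} (hk : q < k) (x : Form n) {y : Form n}
    (hy : y ∈ ⋀[ℝ]^q (Fin n → ℝ)) : cwL G k x y = 0 := by
  induction k generalizing q x y with
  | zero => omega
  | succ k ih =>
    rw [cwL_succ]
    refine Finset.sum_eq_zero fun a _ => ?_
    rcases Nat.eq_zero_or_pos q with h | h
    · subst h
      rw [hookUp_of_mem_zero G a hy, map_zero]
    · exact ih (by omega) _ (hookUp_mem G a hy)

lemma cwL_eq_zero_of_lt {k : ℕ} (hk : n < k) (x y : Form n) : cwL G k x y = 0 := by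
  rw [← sum_pr x, map_sum, LinearMap.sum_apply]
  refine Finset.sum_eq_zero fun d hd => ?_
  have := Finset.mem_range.mp hd
  exact cwL_eq_zero_left G (by omega) (pr_mem d x) y

lemma cwL_mem {k p q e : ℕ} (h : e + 2 * k = p + q) {x y : Form n}
    (hx : x ∈ ⋀[ℝ]^p (Fin n → ℝ)) (hy : y ∈ ⋀[ℝ]^q (Fin n → ℝ)) :
    cwL G k x y ∈ ⋀[ℝ]^e (Fin n → ℝ) := by
  induction k generalizing p q x y with
  | zero =>
    have := wedge_mem hx hy
    rwa [show p + q = e by omega] at this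
  | succ k ih =>
    rw [cwL_succ]
    refine Submodule.sum_mem _ fun a _ => ?_
    rcases Nat.eq_zero_or_pos p with hp | hp
    · subst hp
      rw [hook_of_mem_zero a hx, map_zero, LinearMap.zero_apply]
      exact zero_mem _
    rcases Nat.eq_zero_or_pos q with hq | hq
    · subst hq
      rw [hookUp_of_mem_zero G a hy, map_zero]
      exact zero_mem _
    exact ih (by omega) (hook_mem a hx) (hookUp_mem G a hy)

lemma pr_cwL {k p q : ℕ} (e : ℕ) {x y : Form n}
    (hx : x ∈ ⋀[ℝ]^p (Fin n → ℝ)) (hy : y ∈ ⋀[ℝ]^q (Fin n → ℝ)) :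
    pr e (cwL G k x y) = if e + 2 * k = p + q then cwL G k x y else 0 := by
  split_ifs with h
  · exact pr_of_mem (cwL_mem G h hx hy)
  · by_cases h1 : p + q < 2 * k
    · have : cwL G k x y = 0 := by
        by_cases h2 : p < k
        · exact cwL_eq_zero_left G h2 hx y
        · exact cwL_eq_zero_right G (by omega) x hy
      rw [this, map_zero]
    · exact pr_of_mem_ne (cwL_mem G (e := p + q - 2 * k) (by omega) hx hy) (by omega)

lemma inverse_symm (hG : G.IsSymm) (a b : Fin n) : G⁻¹ a b = G⁻¹ b a := by
  conv_lhs => rw [← hG.eq, ← Matrix.transpose_nonsing_inv]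
  rfl

lemma sum_hookUp_hook (hG : G.IsSymm) {N : Type*} [AddCommGroup N] [Module ℝ N]
    (f : Form n →ₗ[ℝ] Form n →ₗ[ℝ] N) (x y : Form n) :
    ∑ a, f (hookUp G a x) (hook a y) = ∑ a, f (hook a x) (hookUp G a y) := by
  simp only [hookUp, map_sum, map_smul, LinearMap.sum_apply, LinearMap.smul_apply]
  rw [Finset.sum_comm]
  simp_rw [inverse_symm G hG]

lemma cwL_comm (hG : G.IsSymm) {k p q : ℕ} {x y : Form n}
    (hx : x ∈ ⋀[ℝ]^p (Fin n → ℝ)) (hy : y ∈ ⋀[ℝ]^q (Fin n → ℝ)) :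
    cwL G k y x = (-1 : ℝ) ^ (p * q + p * k + q * k + k) • cwL G k x y := by
  induction k generalizing p q x y with
  | zero => simpa [cwL] using wedge_comm hx hy
  | succ k ih =>
    rw [cwL_succ, cwL_succ, Finset.smul_sum, ← sum_hookUp_hook G hG (cwL G k)]
    refine Finset.sum_congr rfl fun a _ => ?_
    rcases Nat.eq_zero_or_pos p with hp | hp
    · subst hp
      rw [hook_of_mem_zero a hx]
      simp
    rcases Nat.eq_zero_or_pos q with hq | hq
    · subst hq
      rw [hookUp_of_mem_zero G a hy]
      simp
    rw [ih (hook_mem a hx) (hookUp_mem G a hy)]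
    obtain ⟨p, rfl⟩ := Nat.exists_eq_succ_of_ne_zero hp.ne'
    obtain ⟨q, rfl⟩ := Nat.exists_eq_succ_of_ne_zero hq.ne'
    simp only [Nat.succ_eq_add_one, Nat.add_sub_cancel]
    rw [show (p + 1) * (q + 1) + (p + 1) * (k + 1) + (q + 1) * (k + 1) + (k + 1)
      = (p * q + p * k + q * k + k) + 2 * (p + q + k + 2) by ring,
      pow_add _ (p * q + p * k + q * k + k), pow_mul _ 2]
    simp

lemma ctr_cwL (d : Module.Dual ℝ (Fin n → ℝ)) (k : ℕ) (x y : Form n) :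
    ctr d (cwL G k x y) = (-1 : ℝ) ^ k • cwL G k (ctr d x) y + cwL G k (inv x) (ctr d y) := by
  induction k generalizing x y with
  | zero => simpa [cwL] using ctr_mul d x y
  | succ k ih =>
    simp_rw [cwL_succ, map_sum, ih, Finset.sum_add_distrib, Finset.smul_sum]
    congr 1
    · refine Finset.sum_congr rfl fun a _ => ?_
      rw [hook_eq, ctr_ctr, map_neg, LinearMap.neg_apply, pow_succ]
      simp
    · refine Finset.sum_congr rfl fun a _ => ?_
      rw [hookUp_eq, ctr_ctr, ← hookUp_eq, inv_hook, map_neg, map_neg, LinearMap.neg_apply, neg_neg]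

/-- The recursion in the first factor which matches that of the Clifford product. -/
lemma cwL_ι_mul (k : ℕ) (v : Fin n → ℝ) (x y : Form n) :
    cwL G k (ExteriorAlgebra.ι ℝ v * x) y = (-1 : ℝ) ^ k • (ExteriorAlgebra.ι ℝ v * cwL G k x y)
      + (k : ℝ) • cwL G (k - 1) x (ctr (sharp G v) y) := by
  induction k generalizing x y with
  | zero => simp [cwL, mul_assoc]
  | succ k ih =>
    rw [cwL_succ, cwL_succ]
    have h1 : ∀ a, cwL G k (hook a (ExteriorAlgebra.ι ℝ v * x)) (hookUp G a y)
        = v a • cwL G k x (hookUp G a y)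
          + ((-1 : ℝ) ^ (k + 1) • (ExteriorAlgebra.ι ℝ v * cwL G k (hook a x) (hookUp G a y))
          + (k : ℝ) • cwL G (k - 1) (hook a x) (hookUp G a (ctr (sharp G v) y))) := fun a => by
      have h2 : ctr (sharp G v) (hookUp G a y) = -hookUp G a (ctr (sharp G v) y) := by
        rw [hookUp_eq, hookUp_eq, ctr_ctr]
      rw [hook_eq, ctr_ι_mul, map_sub, LinearMap.sub_apply, ih, map_smul, LinearMap.smul_apply,
        ← hook_eq, h2, map_neg, pow_succ]
      simp only [LinearMap.proj_apply]
      module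
    simp_rw [h1, Finset.sum_add_distrib, ← Finset.smul_sum, ← Finset.mul_sum]
    rcases k with _ | k
    · rw [ctr_sharp]
      simp [map_sum]
      abel
    · simp only [Nat.add_sub_cancel, ← cwL_succ]
      have h2 : ∑ a, v a • cwL G (k + 1) x (hookUp G a y)
          = cwL G (k + 1) x (ctr (sharp G v) y) := by
        simp only [ctr_sharp, map_sum, map_smul]
      rw [h2]
      push_cast
      module

/-! ### The Clifford product in terms of contracted wedge products -/

/-- The coefficient `(-1)^{k(k+1)/2} / k!` of the `k`-fold contraction in the Clifford product. -/
def clc (k : ℕ) : ℝ := (-1) ^ (k * (k + 1) / 2) / (k.factorial : ℝ)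

lemma clc_zero : clc 0 = 1 := by simp [clc]

lemma clc_succ (k : ℕ) : clc (k + 1) * (-1) ^ (k + 1) * ((k + 1 : ℕ) : ℝ) = clc k := by
  have h : (k + 1) * (k + 1 + 1) / 2 = k * (k + 1) / 2 + (k + 1) := by
    rw [show (k + 1) * (k + 1 + 1) = k * (k + 1) + (k + 1) * 2 by ring,
      Nat.add_mul_div_right _ _ (by norm_num)]
  have h2 : ((-1 : ℝ) ^ (k + 1)) * (-1) ^ (k + 1) = 1 := by
    rw [← mul_pow]; norm_num
  unfold clc
  rw [h, Nat.factorial_succ, pow_add]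
  generalize (-1 : ℝ) ^ (k + 1) = s at *
  have h3 : (k.factorial : ℝ) ≠ 0 := Nat.cast_ne_zero.mpr (Nat.factorial_ne_zero k)
  have h4 : ((k : ℝ) + 1) ≠ 0 := by positivity
  push_cast
  field_simp
  rw [pow_two, h2]

lemma inv_iterate_mul (k : ℕ) (v : Fin n → ℝ) (x : Form n) :
    inv^[k] (ExteriorAlgebra.ι ℝ v * x) = (-1 : ℝ) ^ k • (ExteriorAlgebra.ι ℝ v * inv^[k] x) := by
  induction k with
  | zero => simp
  | succ k ih =>
    rw [Function.iterate_succ_apply', Function.iterate_succ_apply', ih, map_smul, map_mul, inv_ι,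
      pow_succ]
    simp

lemma inv_iterate_ctr (k : ℕ) (d : Module.Dual ℝ (Fin n → ℝ)) (x : Form n) :
    inv^[k] (ctr d x) = (-1 : ℝ) ^ k • ctr d (inv^[k] x) := by
  induction k with
  | zero => simp
  | succ k ih =>
    rw [Function.iterate_succ_apply', Function.iterate_succ_apply', ih, map_smul, inv_ctr,
      pow_succ]
    simp

lemma inv_iterate_add (k : ℕ) (x y : Form n) : inv^[k] (x + y) = inv^[k] x + inv^[k] y :=
  iterate_map_add inv k x y

lemma inv_iterate_of_mem (k : ℕ) {d : ℕ} {x : Form n} (h : x ∈ ⋀[ℝ]^d (Fin n → ℝ)) :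
    inv^[k] x = (-1 : ℝ) ^ (d * k) • x := by
  induction k with
  | zero => simp
  | succ k ih =>
    rw [Function.iterate_succ_apply', ih, map_smul, inv_of_mem h, smul_smul, ← pow_add, mul_add,
      mul_one]

/-- The linear isomorphism from the Clifford algebra of the inverse metric to forms. -/
abbrev toForm : CliffordAlgebra (Matrix.toQuadraticForm' G⁻¹) ≃ₗ[ℝ] Form n :=
  CliffordAlgebra.equivExterior (Matrix.toQuadraticForm' G⁻¹)

/-- Left Clifford multiplication by a covector is the sum of the wedge product and the contraction
with it. -/
lemma toForm_ι_mul (hG : G.IsSymm) (v : Fin n → ℝ) (x) :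
    toForm G (CliffordAlgebra.ι _ v * x)
      = ExteriorAlgebra.ι ℝ v * toForm G x + ctr (sharp G v) (toForm G x) := by
  have h : (QuadraticMap.associated (R := ℝ) (-Matrix.toQuadraticForm' G⁻¹)) v = -sharp G v := by
    refine LinearMap.ext fun w => ?_
    have hs : ∑ x, w x * ∑ y, G⁻¹ x y * v y = ∑ x, v x * ∑ y, G⁻¹ x y * w y := by
      simp_rw [Finset.mul_sum]
      rw [Finset.sum_comm]
      refine Finset.sum_congr rfl fun i _ => Finset.sum_congr rfl fun j _ => ?_
      rw [inverse_symm G hG]; ring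
    simp only [QuadraticMap.associated_apply, Matrix.toQuadraticForm', sharp,
      LinearMap.BilinMap.toQuadraticMap_apply, _root_.neg_apply,
      Matrix.toLinearMap₂'_apply', dotProduct, Matrix.mulVec, map_add, LinearMap.add_apply]
    simp only [hs, neg_add_rev]
    simp [← Finset.mul_sum]
    ring
  have h' : ∀ z : Form n, CliffordAlgebra.contractLeft
      ((QuadraticMap.associated (R := ℝ) (-Matrix.toQuadraticForm' G⁻¹)) v) z
      = -ctr (sharp G v) z := fun z => by rw [h, map_neg, LinearMap.neg_apply]
  have h3 := CliffordAlgebra.changeForm_ι_mul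
    (CliffordAlgebra.changeForm.associated_neg_proof (Q := Matrix.toQuadraticForm' G⁻¹)) v x
  rw [h', sub_neg_eq_add] at h3
  exact h3

lemma cliff_eq (x y : Form n) :
    cliff G x y = toForm G ((toForm G).symm x * (toForm G).symm y) := rfl

lemma cliff_ι_mul (hG : G.IsSymm) (v : Fin n → ℝ) (x y : Form n) :
    cliff G (ExteriorAlgebra.ι ℝ v * x) y = ExteriorAlgebra.ι ℝ v * cliff G x y
      + ctr (sharp G v) (cliff G x y) - cliff G (ctr (sharp G v) x) y := by
  have h : (toForm G).symm (ExteriorAlgebra.ι ℝ v * x)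
      = CliffordAlgebra.ι _ v * (toForm G).symm x - (toForm G).symm (ctr (sharp G v) x) := by
    rw [eq_sub_iff_add_eq, ← map_add, LinearEquiv.symm_apply_eq, toForm_ι_mul G hG,
      LinearEquiv.apply_symm_apply]
  rw [cliff_eq, h, sub_mul, map_sub, mul_assoc, toForm_ι_mul G hG]
  rfl

/-- The Clifford product as a bilinear map. -/
def cliffL : Form n →ₗ[ℝ] Form n →ₗ[ℝ] Form n :=
  ((LinearMap.mul ℝ _).compl₁₂ (toForm G).symm.toLinearMap (toForm G).symm.toLinearMap).compr₂
    (toForm G).toLinearMap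

lemma cliffL_apply (x y : Form n) : cliff G x y = cliffL G x y := rfl

lemma cliff_algebraMap (r : ℝ) (y : Form n) : cliff G (algebraMap ℝ _ r) y = r • y := by
  have h1 : (toForm G).symm (algebraMap ℝ (Form n) r) = algebraMap ℝ _ r := by
    rw [LinearEquiv.symm_apply_eq]
    simp [toForm]
  rw [cliff_eq, h1, ← Algebra.smul_def, map_smul, LinearEquiv.apply_symm_apply]

lemma cliff_one_right (x : Form n) : cliff G x 1 = x := by
  have h1 : (toForm G).symm (1 : Form n) = 1 := by
    rw [LinearEquiv.symm_apply_eq]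
    simp [toForm]
  rw [cliff_eq, h1, mul_one, LinearEquiv.apply_symm_apply]

/-- The expansion of `cliff_eq_sum` for a homogeneous first factor, by induction on its degree. -/
lemma cliff_eq_sum_of_mem (hG : G.IsSymm) (y : Form n) (m : ℕ) :
    ∀ d ≤ m, ∀ x ∈ ⋀[ℝ]^d (Fin n → ℝ),
      cliff G x y = ∑ k ∈ Finset.range (n + 2), clc k • cwL G k (inv^[k] x) y := by
  have hadd : ∀ x x', cliff G x y = ∑ k ∈ Finset.range (n + 2), clc k • cwL G k (inv^[k] x) y →
      cliff G x' y = ∑ k ∈ Finset.range (n + 2), clc k • cwL G k (inv^[k] x') y →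
      cliff G (x + x') y = ∑ k ∈ Finset.range (n + 2), clc k • cwL G k (inv^[k] (x + x')) y := by
    intro x x' hx hx'
    simp only [inv_iterate_add, map_add, LinearMap.add_apply, smul_add, Finset.sum_add_distrib,
      ← hx, ← hx', cliffL_apply]
  have hscalar : ∀ r, cliff G (algebraMap ℝ _ r) y
      = ∑ k ∈ Finset.range (n + 2), clc k • cwL G k (inv^[k] (algebraMap ℝ _ r)) y := by
    intro r
    rw [cliff_algebraMap, Finset.sum_eq_single 0]
    · simp [clc_zero, cwL, Algebra.smul_def]
    · intro k _ hk
      have h2 : algebraMap ℝ (Form n) r ∈ ⋀[ℝ]^0 (Fin n → ℝ) := SetLike.algebraMap_mem_graded _ r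
      rw [inv_iterate_of_mem k h2, map_smul, LinearMap.smul_apply,
        cwL_eq_zero_left G (Nat.pos_of_ne_zero hk) h2, smul_zero, smul_zero]
    · simp
  induction m with
  | zero =>
    intro d hd x hx
    refine mem_induction (C := fun d x => d ≤ 0 → cliff G x y
      = ∑ k ∈ Finset.range (n + 2), clc k • cwL G k (inv^[k] x) y) (fun r _ => hscalar r)
      (fun i x x' hx hx' hi => hadd x x' (hx hi) (hx' hi)) (fun i v x _ _ hi => by omega) hx hd
  | succ m ih =>
    intro d hd x hx
    refine mem_induction (C := fun d x => d ≤ m + 1 → cliff G x y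
      = ∑ k ∈ Finset.range (n + 2), clc k • cwL G k (inv^[k] x) y) (fun r _ => hscalar r)
      (fun i x x' hx hx' hi => hadd x x' (hx hi) (hx' hi)) (fun i v x hx _ hi => ?_) hx hd
    rw [cliff_ι_mul G hG, ih i (by omega) x hx, ih (i - 1) (by omega) _ (ctr_mem _ hx).1,
      Finset.mul_sum, map_sum]
    have h1 : ∀ k, clc k • cwL G k (inv^[k] (ExteriorAlgebra.ι ℝ v * x)) y
        = ExteriorAlgebra.ι ℝ v * (clc k • cwL G k (inv^[k] x) y)
          + (clc k * (-1) ^ k * (k : ℝ)) • cwL G (k - 1) (inv^[k] x) (ctr (sharp G v) y) := by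
      intro k
      have h2 : ((-1 : ℝ) ^ k) * (-1) ^ k = 1 := by rw [← mul_pow]; norm_num
      rw [inv_iterate_mul, map_smul, LinearMap.smul_apply, cwL_ι_mul, mul_smul_comm, smul_add,
        smul_add, smul_smul, smul_smul, smul_smul, smul_smul, mul_assoc (clc k), h2, mul_one]
    have h3 : ∀ k, ctr (sharp G v) (clc k • cwL G k (inv^[k] x) y)
        = clc k • cwL G k (inv^[k] (ctr (sharp G v) x)) y
          + clc k • cwL G k (inv^[k + 1] x) (ctr (sharp G v) y) := by
      intro k
      rw [map_smul, ctr_cwL, inv_iterate_ctr, map_smul, LinearMap.smul_apply, smul_add,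
        Function.iterate_succ_apply']
    simp_rw [h1, h3, Finset.sum_add_distrib]
    rw [add_sub_assoc, add_sub_cancel_left]
    congr 1
    -- shift the summation index: the recursion of the coefficients matches the two sums
    conv_rhs => rw [Finset.sum_range_succ']
    rw [Finset.sum_range_succ, cwL_eq_zero_of_lt G (Nat.lt_succ_self n)]
    simp_rw [clc_succ]
    simp

/-- The Clifford product is the sum over all `k` of the `k`-fold contracted wedge products, with
coefficients `(-1)^{k(k+1)/2} / k!` and the sign `(-1)^{kπ}` on the first factor. -/
lemma cliff_eq_sum (hG : G.IsSymm) (x y : Form n) :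
    cliff G x y = ∑ k ∈ Finset.range (n + 2), clc k • cwL G k (inv^[k] x) y := by
  conv_lhs => rw [← sum_pr x, cliffL_apply, map_sum, LinearMap.sum_apply]
  conv_rhs => rw [← sum_pr x]
  have h : ∀ k, inv^[k] (∑ d ∈ Finset.range (n + 1), pr d x)
      = ∑ d ∈ Finset.range (n + 1), inv^[k] (pr d x) := fun k => by
    have h1 : ∀ z : Form n, inv^[k] z = ((inv (n := n)).toLinearMap ^ k) z := fun z =>
      by rw [Module.End.pow_apply]; rfl
    simp_rw [h1, map_sum]
  simp_rw [h, map_sum, LinearMap.sum_apply, Finset.smul_sum]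
  rw [Finset.sum_comm]
  exact Finset.sum_congr rfl fun d _ => cliff_eq_sum_of_mem G hG y d d le_rfl _ (pr_mem d x)

lemma pr_cliff (hG : G.IsSymm) {p q d k : ℕ} (h : d + 2 * k = p + q) {x y : Form n}
    (hx : x ∈ ⋀[ℝ]^p (Fin n → ℝ)) (hy : y ∈ ⋀[ℝ]^q (Fin n → ℝ)) :
    pr d (cliff G x y) = (clc k * (-1) ^ (p * k)) • cwL G k x y := by
  rw [cliff_eq_sum G hG, map_sum]
  simp_rw [fun j => inv_iterate_of_mem j hx, map_smul, LinearMap.smul_apply, map_smul,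
    pr_cwL G d hx hy]
  by_cases hk : k < n + 2
  · rw [Finset.sum_eq_single k]
    · rw [if_pos h, smul_smul]
    · intro j _ hj
      rw [if_neg (by omega), smul_zero, smul_zero]
    · intro h; exact absurd (Finset.mem_range.mpr hk) h
  · rw [cwL_eq_zero_of_lt G (by omega), smul_zero]
    refine Finset.sum_eq_zero fun j hj => ?_
    rw [if_neg (by have := Finset.mem_range.mp hj; omega), smul_zero, smul_zero]

lemma pr_cliff_eq_zero (hG : G.IsSymm) {p q d : ℕ} (h : ∀ k, d + 2 * k ≠ p + q) {x y : Form n}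
    (hx : x ∈ ⋀[ℝ]^p (Fin n → ℝ)) (hy : y ∈ ⋀[ℝ]^q (Fin n → ℝ)) :
    pr d (cliff G x y) = 0 := by
  rw [cliff_eq_sum G hG, map_sum]
  simp_rw [fun j => inv_iterate_of_mem j hx, map_smul, LinearMap.smul_apply, map_smul,
    pr_cwL G d hx hy]
  exact Finset.sum_eq_zero fun j _ => by rw [if_neg (h j), smul_zero, smul_zero]

/-- The homogeneous parts of the Clifford products in the two orders agree up to a sign. -/
lemma pr_cliff_swap (hG : G.IsSymm) {p q d k : ℕ} (h : d + 2 * k = p + q) {x y : Form n}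
    (hx : x ∈ ⋀[ℝ]^p (Fin n → ℝ)) (hy : y ∈ ⋀[ℝ]^q (Fin n → ℝ)) :
    pr d (cliff G y x) = (-1 : ℝ) ^ (p * q + k) • pr d (cliff G x y) := by
  rw [pr_cliff G hG h hx hy, pr_cliff G hG (by rw [h, add_comm]) hy hx, cwL_comm G hG hx hy,
    smul_smul, smul_smul]
  congr 1
  have h2 : ((-1 : ℝ) ^ (q * k)) * (-1) ^ (q * k) = 1 := by rw [← mul_pow]; norm_num
  rw [pow_add, pow_add, pow_add, pow_add]
  linear_combination (clc k * (-1) ^ (p * q) * (-1) ^ (p * k) * (-1) ^ k) * h2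

lemma comm_eq (x y : Form n) : comm G x y = cliffL G x y - cliffL G y x := rfl

lemma pr_comm_eq_zero (hG : G.IsSymm) {p q d : ℕ} (h : ∀ k, d + 2 * k = p + q → Even (p * q + k))
    {x y : Form n} (hx : x ∈ ⋀[ℝ]^p (Fin n → ℝ)) (hy : y ∈ ⋀[ℝ]^q (Fin n → ℝ)) :
    pr d (comm G x y) = 0 := by
  unfold comm
  rw [map_sub, sub_eq_zero]
  by_cases hk : ∃ k, d + 2 * k = p + q
  · obtain ⟨k, hk⟩ := hk
    rw [pr_cliff_swap G hG hk hx hy, (h k hk).neg_one_pow, one_smul]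
  · push Not at hk
    rw [pr_cliff_eq_zero G hG hk hx hy,
      pr_cliff_eq_zero G hG (by simpa [add_comm q p] using hk) hy hx]

lemma pr_comm (hG : G.IsSymm) {p q d k : ℕ} (h : d + 2 * k = p + q) (ho : Odd (p * q + k))
    {x y : Form n} (hx : x ∈ ⋀[ℝ]^p (Fin n → ℝ)) (hy : y ∈ ⋀[ℝ]^q (Fin n → ℝ)) :
    pr d (comm G x y) = (2 * clc k * (-1) ^ (p * k)) • cwL G k x y := by
  unfold comm
  rw [map_sub, pr_cliff_swap G hG h hx hy, ho.neg_one_pow, pr_cliff G hG h hx hy, smul_smul,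
    ← sub_smul]
  congr 1; ring

lemma inv_cliff (hG : G.IsSymm) (x y : Form n) :
    inv (cliff G x y) = cliff G (inv x) (inv y) := by
  rw [cliff_eq_sum G hG, cliff_eq_sum G hG, map_sum]
  refine Finset.sum_congr rfl fun k _ => ?_
  rw [map_smul, inv_cwL, ← Function.iterate_succ_apply' inv k x, Function.iterate_succ_apply]

lemma cliff_cof_left (hG : G.IsSymm) (a : Fin n) (x : Form n) :
    cliff G (cof a) x = cof a * x + hookUp G a x := by
  have h := cliff_ι_mul G hG (Pi.single a 1) 1 x
  have h0 : ctr (sharp G (Pi.single a 1)) (1 : Form n) = 0 := CliffordAlgebra.contractLeft_one _ _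
  have h1 : cliff G 1 x = x := by simpa using cliff_algebraMap G 1 x
  rw [h1, mul_one, h0, cliffL_apply G 0, map_zero, LinearMap.zero_apply, sub_zero,
    sharp_single] at h
  exact h

lemma cliff_cof_right (hG : G.IsSymm) (a : Fin n) (x : Form n) :
    cliff G x (cof a) = cof a * inv x - hookUp G a (inv x) := by
  have h0 : ∀ k, cwL G (k + 1 + 1) (inv^[k + 1 + 1] x) (cof a) = 0 := fun k =>
    cwL_eq_zero_right G (by omega) _ (cof_mem a)
  have h1 : ∀ b, hookUp G b (cof a) = algebraMap ℝ _ (G⁻¹ a b) := fun b => by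
    rw [hookUp_eq]
    simp only [ctr, cof]
    erw [CliffordAlgebra.contractLeft_ι]
    simp [Pi.single_apply, inverse_symm G hG a b]
  have h2 : clc 1 = -1 := by simp [clc]
  rw [cliff_eq_sum G hG, Finset.sum_range_succ', Finset.sum_range_succ']
  simp_rw [h0]
  simp only [smul_zero, Finset.sum_const_zero, zero_add, clc_zero, h2, cwL_succ, h1]
  simp only [cwL, hookUp, Function.iterate_succ, Function.iterate_zero, Function.comp, id_eq,
    LinearMap.mul_apply', ← Algebra.commutes, ← Algebra.smul_def, one_smul, neg_smul]
  rw [neg_add_eq_sub]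
  congr 1
  exact ι_mul_comm _ _

/-! ### The bracket in an abstract Clifford algebra -/

/-- A frame `e` of generators of a Clifford algebra and the dual frame `f` (`f a` is `e a` with
lowered index), together with the operator `S x = e^a x e_a`. -/
structure CliffordFrame (A : Type*) [Ring A] [Algebra ℝ A] (ι : Type*) [Fintype ι]
    [DecidableEq ι] where
  e : ι → A
  f : ι → A
  S : A →ₗ[ℝ] A
  rel : ∀ a b, e a * f b + f b * e a = if a = b then algebraMap ℝ A 2 else 0
  sum_e_f : ∀ x, ∑ a, e a * (x * f a) = S x
  sum_f_e : ∀ x, ∑ a, f a * (x * e a) = S x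

namespace CliffordFrame

variable {A : Type*} [Ring A] [Algebra ℝ A] {ι : Type*} [Fintype ι] [DecidableEq ι]
  (F : CliffordFrame A ι)

set_option linter.unusedVariables false in
/-- The dimension, as a real number. The frame is an argument only for the sake of the notation
`F.m`. -/
def m (F : CliffordFrame A ι) : ℝ := Fintype.card ι

lemma S_one : F.S 1 = algebraMap ℝ A F.m := by
  have h : (2 : ℝ) • F.S 1 = (2 : ℝ) • algebraMap ℝ A F.m := by
    calc (2 : ℝ) • F.S 1 = ∑ a, (F.e a * F.f a + F.f a * F.e a) := by
          rw [two_smul, Finset.sum_add_distrib]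
          conv_lhs => enter [1]; rw [← F.sum_e_f]
          conv_lhs => enter [2]; rw [← F.sum_f_e]
          simp only [one_mul]
      _ = (2 : ℝ) • algebraMap ℝ A F.m := by
          simp [F.rel, m, Algebra.smul_def, Finset.card_univ]
          exact Nat.cast_comm _ _
  exact smul_right_injective A (two_ne_zero (α := ℝ)) h

lemma e_mul_f (a b : ι) : F.e a * F.f b = (if a = b then algebraMap ℝ A 2 else 0) - F.f b * F.e a :=
  eq_sub_of_add_eq (F.rel a b)

lemma f_mul_e (a b : ι) : F.f b * F.e a = (if a = b then algebraMap ℝ A 2 else 0) - F.e a * F.f b :=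
  eq_sub_of_add_eq' (F.rel a b)

lemma S_f_mul (a : ι) (x : A) : F.S (F.f a * x) = (2 : ℝ) • (x * F.f a) - F.f a * F.S x := by
  rw [← F.sum_e_f, ← F.sum_e_f]
  have h : ∀ b, F.e b * (F.f a * x * F.f b) = (if b = a then (2 : ℝ) • (x * F.f b) else 0)
      - F.f a * (F.e b * (x * F.f b)) := fun b => by
    rw [← mul_assoc, ← mul_assoc, e_mul_f, sub_mul, sub_mul]
    split_ifs <;> simp [Algebra.smul_def, mul_assoc]
  simp_rw [h, Finset.sum_sub_distrib, ← Finset.mul_sum]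
  simp

lemma S_mul_e (a : ι) (x : A) : F.S (x * F.e a) = (2 : ℝ) • (F.e a * x) - F.S x * F.e a := by
  rw [← F.sum_e_f, ← F.sum_e_f]
  have h : ∀ b, F.e b * (x * F.e a * F.f b) = (if a = b then (2 : ℝ) • (F.e b * x) else 0)
      - F.e b * (x * F.f b) * F.e a := fun b => by
    rw [mul_assoc, e_mul_f, mul_sub, mul_sub]
    split_ifs <;> simp [Algebra.smul_def, mul_assoc, ← Algebra.commutes, Algebra.left_comm]
  simp_rw [h, Finset.sum_sub_distrib, ← Finset.sum_mul]
  simp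

lemma S_e_mul (a : ι) (x : A) : F.S (F.e a * x) = (2 : ℝ) • (x * F.e a) - F.e a * F.S x := by
  rw [← F.sum_f_e, ← F.sum_f_e]
  have h : ∀ b, F.f b * (F.e a * x * F.e b) = (if a = b then (2 : ℝ) • (x * F.e b) else 0)
      - F.e a * (F.f b * (x * F.e b)) := fun b => by
    rw [← mul_assoc, ← mul_assoc, f_mul_e, sub_mul, sub_mul]
    split_ifs <;> simp [Algebra.smul_def, mul_assoc]
  simp_rw [h, Finset.sum_sub_distrib, ← Finset.mul_sum]
  simp

lemma S_mul_f (a : ι) (x : A) : F.S (x * F.f a) = (2 : ℝ) • (F.f a * x) - F.S x * F.f a := by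
  rw [← F.sum_f_e, ← F.sum_f_e]
  have h : ∀ b, F.f b * (x * F.f a * F.e b) = (if b = a then (2 : ℝ) • (F.f b * x) else 0)
      - F.f b * (x * F.e b) * F.f a := fun b => by
    rw [mul_assoc, f_mul_e, mul_sub, mul_sub]
    split_ifs <;> simp [Algebra.smul_def, mul_assoc, ← Algebra.commutes, Algebra.left_comm]
  simp_rw [h, Finset.sum_sub_distrib, ← Finset.sum_mul]
  simp

lemma sum_e_mul (x y : A) : ∑ a, F.e a * (x * F.f a * y) = F.S x * y := by
  rw [← F.sum_e_f, Finset.sum_mul]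
  simp only [mul_assoc]

lemma sum_mul_e (x y : A) : ∑ a, (x * F.f a * y) * F.e a = x * F.S y := by
  rw [← F.sum_f_e, Finset.mul_sum]
  simp only [mul_assoc]

lemma sum_f_mul (x y : A) : ∑ a, F.f a * (x * F.e a * y) = F.S x * y := by
  rw [← F.sum_f_e, Finset.sum_mul]
  simp only [mul_assoc]

lemma sum_mul_f (x y : A) : ∑ a, (x * F.e a * y) * F.f a = x * F.S y := by
  rw [← F.sum_e_f, Finset.mul_sum]
  simp only [mul_assoc]

lemma S_one_mul (x : A) : F.S 1 * x = F.m • x := by rw [F.S_one, Algebra.smul_def]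

lemma mul_S_one (x : A) : x * F.S 1 = F.m • x := by
  rw [F.S_one, ← Algebra.commutes, Algebra.smul_def]

/-- The first-order coefficient `½{e^a, κ}` of the operator attached to `κ`. -/
def up (κ : A) (a : ι) : A := (1 / 2 : ℝ) • (F.e a * κ + κ * F.e a)

/-- The coefficient `up` with lowered index. -/
def low (κ : A) (a : ι) : A := (1 / 2 : ℝ) • (F.f a * κ + κ * F.f a)

/-- The covariant derivative `½[e_a, k]` of `κ`. -/
def der (k : A) (a : ι) : A := (1 / 2 : ℝ) • (F.f a * k - k * F.f a)

/-- The covariant derivative of the commutator `[κ, λ]`. -/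
def derComm (κ k lam l : A) (b : ι) : A :=
  (F.der k b * lam - lam * F.der k b) + (κ * F.der l b - F.der l b * κ)

/-- The first-order coefficient of the commutator of two operators. -/
def curly (p q : ℝ) (κ k lam l : A) (b : ι) : A :=
  ∑ a, (F.up κ a * F.up (F.der l a) b - F.up lam a * F.up (F.der k a) b)
    + (F.up κ b * ((q / 2) • l) - ((q / 2) • l) * F.up κ b)
    - (F.up lam b * ((p / 2) • k) - ((p / 2) • k) * F.up lam b)

lemma sum_e_derComm (κ k lam l : A) : ∑ b, F.e b * F.derComm κ k lam l b
    = (1 / 2 : ℝ) • (F.m • (k * lam) - F.S k * lam - F.S lam * k + F.S (lam * k)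
      + F.S κ * l - F.S (κ * l) - F.m • (l * κ) + F.S l * κ) := by
  have h : ∀ b, F.e b * F.derComm κ k lam l b = (1 / 2 : ℝ) • (
      F.e b * (1 * F.f b * (k * lam)) - F.e b * (k * F.f b * lam) - F.e b * (lam * F.f b * k)
      + F.e b * (lam * k * F.f b * 1) + F.e b * (κ * F.f b * l) - F.e b * (κ * l * F.f b * 1)
      - F.e b * (1 * F.f b * (l * κ)) + F.e b * (l * F.f b * κ)) := fun b => by
    simp only [derComm, der, smul_mul_assoc, mul_smul_comm, ← smul_sub, ← smul_add]
    noncomm_ring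
  simp only [h, ← Finset.smul_sum, Finset.sum_add_distrib, Finset.sum_sub_distrib,
    sum_e_mul, S_one_mul]
  simp only [mul_one]

lemma sum_derComm_e (κ k lam l : A) : ∑ b, F.derComm κ k lam l b * F.e b
    = (1 / 2 : ℝ) • (F.S (k * lam) - k * F.S lam - lam * F.S k + F.m • (lam * k)
      + κ * F.S l - F.m • (κ * l) - F.S (l * κ) + l * F.S κ) := by
  have h : ∀ b, F.derComm κ k lam l b * F.e b = (1 / 2 : ℝ) • (
      (1 * F.f b * (k * lam)) * F.e b - (k * F.f b * lam) * F.e b - (lam * F.f b * k) * F.e b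
      + (lam * k * F.f b * 1) * F.e b + (κ * F.f b * l) * F.e b - (κ * l * F.f b * 1) * F.e b
      - (1 * F.f b * (l * κ)) * F.e b + (l * F.f b * κ) * F.e b) := fun b => by
    simp only [derComm, der, smul_mul_assoc, mul_smul_comm, ← smul_sub, ← smul_add]
    noncomm_ring
  simp only [h, ← Finset.smul_sum, Finset.sum_add_distrib, Finset.sum_sub_distrib,
    sum_mul_e, mul_S_one]
  simp only [one_mul]

lemma S_up {x : A} {c : ℝ} (h : F.S x = c • x) (a : ι) : F.S (F.up x a) = (2 - c) • F.up x a := by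
  simp only [up, map_smul, map_add, S_e_mul, S_mul_e, h, mul_smul_comm, smul_mul_assoc]
  module

lemma S_der {x : A} {c : ℝ} (h : F.S x = c • x) (a : ι) :
    F.S (F.der x a) = (-2 - c) • F.der x a := by
  simp only [der, map_smul, map_sub, S_f_mul, S_mul_f, h, mul_smul_comm, smul_mul_assoc]
  module

/-- Contraction of the first summand of the commutator coefficient. -/
lemma sum_f_up_mul {p q : ℝ} {κ l : A} (hκ : F.S κ = (2 * p - F.m) • κ)
    (hl : F.S l = (F.m - 2 * q - 2) • l) :
    ∑ b, (F.f b * (∑ a, F.up κ a * F.up (F.der l a) b)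
      + (∑ a, F.up κ a * F.up (F.der l a) b) * F.f b)
    = (1 / 8 : ℝ) • ((2 * p + 2 * q + 2 - F.m) • F.S (κ * l) - F.S (F.S (κ * l))
      + (F.m + 2 - 2 * p + 2 * q) • ((2 * p + 2 * q + 2 - F.m) • (κ * l) - F.S (κ * l))) := by
  have h1 : ∑ a, F.up κ a * F.der l a
      = (1 / 4 : ℝ) • ((2 * p + 2 * q + 2 - F.m) • (κ * l) - F.S (κ * l)) := by
    have h : ∀ a, F.up κ a * F.der l a = (1 / 4 : ℝ) • (F.e a * (κ * F.f a * l)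
        - F.e a * (κ * l * F.f a * 1) + κ * (F.e a * (1 * F.f a * l))
        - κ * (F.e a * (l * F.f a * 1))) := fun a => by
      simp only [up, der, smul_mul_assoc, mul_smul_comm, smul_smul]
      norm_num
      noncomm_ring
    simp_rw [h, ← Finset.smul_sum, Finset.sum_sub_distrib, Finset.sum_add_distrib,
      Finset.sum_sub_distrib, ← Finset.mul_sum, sum_e_mul, S_one_mul, mul_one, hκ, hl,
      mul_smul_comm, smul_mul_assoc]
    module
  have h2 : ∀ a, ∑ b, (F.f b * (F.up κ a * F.up (F.der l a) b)
      + (F.up κ a * F.up (F.der l a) b) * F.f b)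
      = (1 / 2 : ℝ) • ((F.m + 2 - 2 * p + 2 * q) • (F.up κ a * F.der l a)
        + F.S (F.up κ a * F.der l a)) := fun a => by
    have hx := F.S_up hκ a
    have hy := F.S_der hl a
    generalize F.up κ a = x at *
    generalize F.der l a = y at *
    have h : ∀ b, F.f b * (x * F.up y b) + (x * F.up y b) * F.f b = (1 / 2 : ℝ) • (
        F.f b * (x * F.e b * y) + F.f b * (x * y * F.e b * 1) + (x * F.e b * y) * F.f b
        + (x * y * F.e b * 1) * F.f b) := fun b => by
      simp only [up, smul_mul_assoc, mul_smul_comm, ← smul_add]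
      congr 1
      noncomm_ring
    simp_rw [h, ← Finset.smul_sum, Finset.sum_add_distrib, sum_f_mul, sum_mul_f, mul_S_one, hx, hy,
      mul_one, smul_mul_assoc, mul_smul_comm]
    module
  simp_rw [Finset.mul_sum, Finset.sum_mul, ← Finset.sum_add_distrib]
  rw [Finset.sum_comm]
  simp_rw [h2, ← Finset.smul_sum, Finset.sum_add_distrib, ← Finset.smul_sum, ← map_sum, h1,
    map_smul, map_sub, map_smul]
  module

/-- Contraction of a commutator summand of the commutator coefficient. -/
lemma sum_f_comm_up {p q : ℝ} {κ l : A} (hκ : F.S κ = (2 * p - F.m) • κ)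
    (hl : F.S l = (F.m - 2 * q - 2) • l) :
    ∑ b, (F.f b * (F.up κ b * l - l * F.up κ b) + (F.up κ b * l - l * F.up κ b) * F.f b)
      = (1 / 2 : ℝ) • (F.S (κ * l - l * κ) + (F.m + 2 * p - 2 * q - 2) • (κ * l - l * κ)) := by
  have h : ∀ b, F.f b * (F.up κ b * l - l * F.up κ b) + (F.up κ b * l - l * F.up κ b) * F.f b
      = (1 / 2 : ℝ) • (
      F.f b * (1 * F.e b * (κ * l)) + F.f b * (κ * F.e b * l) - F.f b * (l * F.e b * κ)
      - F.f b * (l * κ * F.e b * 1) + (1 * F.e b * (κ * l)) * F.f b + (κ * F.e b * l) * F.f b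
      - (l * F.e b * κ) * F.f b - (l * κ * F.e b * 1) * F.f b) := fun b => by
    simp only [up, smul_mul_assoc, mul_smul_comm, ← smul_sub, ← smul_add]
    congr 1
    noncomm_ring
  simp_rw [h, ← Finset.smul_sum, Finset.sum_sub_distrib, Finset.sum_add_distrib,
    Finset.sum_sub_distrib, Finset.sum_add_distrib, sum_f_mul, sum_mul_f, mul_S_one, S_one_mul,
    hκ, hl, mul_one, one_mul, smul_mul_assoc, mul_smul_comm, map_sub]
  module

/-- The contracted commutator of the first-order coefficients, as an eigenvalue equation for the
commutator of the forms themselves. -/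
lemma sum_comm_up_low {p q : ℝ} {κ lam : A} (hκ : F.S κ = (2 * p - F.m) • κ)
    (hlam : F.S lam = (2 * q - F.m) • lam) :
    ∑ a, (F.up κ a * F.low lam a - F.low lam a * F.up κ a)
      = (1 / 4 : ℝ) • (F.S (κ * lam - lam * κ)
        - (F.m - 2 * (p + q)) • (κ * lam - lam * κ)) := by
  have h : ∀ a, F.up κ a * F.low lam a - F.low lam a * F.up κ a = (1 / 4 : ℝ) • (
      F.e a * (κ * F.f a * lam) + F.e a * (κ * lam * F.f a * 1) + κ * (F.e a * (1 * F.f a * lam))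
      + κ * (F.e a * (lam * F.f a * 1)) - F.f a * (lam * F.e a * κ)
      - F.f a * (lam * κ * F.e a * 1) - lam * (F.f a * (1 * F.e a * κ))
      - lam * (F.f a * (κ * F.e a * 1))) := fun a => by
    simp only [up, low, smul_mul_assoc, mul_smul_comm, smul_smul, ← smul_sub]
    norm_num
    noncomm_ring
  simp_rw [h, ← Finset.smul_sum]
  simp only [Finset.sum_sub_distrib, Finset.sum_add_distrib, ← Finset.mul_sum, sum_e_mul,
    sum_f_mul, S_one_mul]
  simp only [mul_one, hκ, hlam, mul_smul_comm, smul_mul_assoc, map_sub]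
  module

section pair

variable {p q : ℝ} {κ k lam l : A} (hκ : F.S κ = (2 * p - F.m) • κ)
  (hk : F.S k = (F.m - 2 * p - 2) • k) (hlam : F.S lam = (2 * q - F.m) • lam)
  (hl : F.S l = (F.m - 2 * q - 2) • l)

include hκ hk hlam hl

/-- The commutators of the derivative of `[κ, λ]` with the frame see only the commutators
`[k, λ] + [κ, l]`. -/
lemma sum_comm_e_derComm : ∑ b, (F.e b * F.derComm κ k lam l b - F.derComm κ k lam l b * F.e b)
    = (1 / 2 : ℝ) • ((2 * p + 2 * q + 2 - F.m) • ((k * lam - lam * k) + (κ * l - l * κ))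
      - F.S ((k * lam - lam * k) + (κ * l - l * κ))) := by
  rw [Finset.sum_sub_distrib, sum_e_derComm, sum_derComm_e]
  simp only [hκ, hk, hlam, hl, smul_mul_assoc, mul_smul_comm, map_add, map_sub]
  module

/-- The anticommutators of the derivative of `[κ, λ]` with the frame see only the anticommutators
`{k, λ}` and `{κ, l}`. -/
lemma sum_anticomm_e_derComm :
    ∑ b, (F.e b * F.derComm κ k lam l b + F.derComm κ k lam l b * F.e b)
    = (1 / 2 : ℝ) • ((F.S (k * lam + lam * k) + (F.m + 2 * p - 2 * q + 2) • (k * lam + lam * k))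
      - (F.S (κ * l + l * κ) + (F.m + 2 * q - 2 * p + 2) • (κ * l + l * κ))) := by
  rw [Finset.sum_add_distrib, sum_e_derComm, sum_derComm_e]
  simp only [hκ, hk, hlam, hl, smul_mul_assoc, mul_smul_comm, map_add]
  module

omit hκ hk hlam hl in
lemma S_sum_comm {Y : ι → A} {c : ℝ} (hY : ∀ b, F.S (Y b) = c • Y b) :
    F.S (∑ b, (F.e b * Y b - Y b * F.e b)) = (-2 - c) • ∑ b, (F.e b * Y b - Y b * F.e b) := by
  rw [map_sum, Finset.smul_sum]
  refine Finset.sum_congr rfl fun b _ => ?_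
  rw [map_sub, S_e_mul, S_mul_e, hY, mul_smul_comm, smul_mul_assoc]
  module

omit hκ hk hlam hl in
lemma S_sum_anticomm {Y : ι → A} {c : ℝ} (hY : ∀ b, F.S (Y b) = c • Y b) :
    F.S (∑ b, (F.e b * Y b + Y b * F.e b)) = (2 - c) • ∑ b, (F.e b * Y b + Y b * F.e b) := by
  rw [map_sum, Finset.smul_sum]
  refine Finset.sum_congr rfl fun b _ => ?_
  rw [map_add, S_e_mul, S_mul_e, hY, mul_smul_comm, smul_mul_assoc]
  module

/-- The contracted commutator coefficient collapses to `pq/2 ([k, λ] + [κ, l])`, as soon as the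
derivative `Y_b` of `[κ, λ]` lies in one eigenspace of `S`. The anticommutators of the forms drop out
by the eigenvalue equation for `{e^b, Y_b}`, and the quadratic polynomial in `S` acting on their
commutators is reduced to a constant by the eigenvalue equation for `[e^b, Y_b]`. -/
lemma sum_f_curly (hY : ∀ b, F.S (F.derComm κ k lam l b)
      = (F.m - 2 * (p + q)) • F.derComm κ k lam l b) :
    ∑ b, (F.f b * F.curly p q κ k lam l b + F.curly p q κ k lam l b * F.f b)
      = (p * q) • ((k * lam - lam * k) + (κ * l - l * κ)) := by
  have h1 := F.sum_f_up_mul hκ hl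
  have h2 := F.sum_f_up_mul hlam hk
  have h3 := F.sum_f_comm_up hκ hl
  have h4 := F.sum_f_comm_up hlam hk
  have hW := F.S_sum_comm hY
  have hZ := F.S_sum_anticomm hY
  rw [F.sum_comm_e_derComm hκ hk hlam hl] at hW
  rw [F.sum_anticomm_e_derComm hκ hk hlam hl] at hZ
  have h : ∀ b, F.f b * F.curly p q κ k lam l b + F.curly p q κ k lam l b * F.f b
      = (F.f b * (∑ a, F.up κ a * F.up (F.der l a) b)
          + (∑ a, F.up κ a * F.up (F.der l a) b) * F.f b)
        - (F.f b * (∑ a, F.up lam a * F.up (F.der k a) b)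
          + (∑ a, F.up lam a * F.up (F.der k a) b) * F.f b)
        + (q / 2) • (F.f b * (F.up κ b * l - l * F.up κ b)
          + (F.up κ b * l - l * F.up κ b) * F.f b)
        - (p / 2) • (F.f b * (F.up lam b * k - k * F.up lam b)
          + (F.up lam b * k - k * F.up lam b) * F.f b) := fun b => by
    simp only [curly, Finset.sum_sub_distrib, mul_add, add_mul, mul_sub, sub_mul, smul_mul_assoc,
      mul_smul_comm, smul_add, smul_sub]
    abel
  simp_rw [h, Finset.sum_sub_distrib, Finset.sum_add_distrib, Finset.sum_sub_distrib,
    ← Finset.smul_sum]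
  rw [h1, h2, h3, h4]
  simp only [map_add, map_sub, map_smul] at hW hZ ⊢
  linear_combination (norm := module) (1 / 8 : ℝ) • hZ + (1 / 8 : ℝ) • hW

end pair

end CliffordFrame

/-! ### The Clifford algebra of the metric at a point -/

section frame

variable {G : Matrix (Fin n) (Fin n) ℝ}

lemma hook_cof (a b : Fin n) : hook a (cof b) = algebraMap ℝ (Form n) (if a = b then 1 else 0) := by
  have h := hook_cof_mul a b (1 : Form n)
  have h0 : hook a (1 : Form n) = 0 := CliffordAlgebra.contractLeft_one _ _
  rw [mul_one, h0, mul_zero, sub_zero] at h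
  rw [h, Algebra.algebraMap_eq_smul_one]

lemma inv_cofLow (a : Fin n) : inv (cofLow G a) = -cofLow G a := by
  simp [cofLow, inv_cof]

lemma sum_mul_hookUp (hG' : G * G⁻¹ = 1) (a : Fin n) (x : Form n) :
    ∑ b, G a b • hookUp G b x = hook a x := by
  simp only [hookUp, Finset.smul_sum, smul_smul]
  rw [Finset.sum_comm]
  simp_rw [← Finset.sum_smul, ← Matrix.mul_apply, hG', Matrix.one_apply]
  simp

lemma sum_inverse_mul_cofLow (hG' : G * G⁻¹ = 1) (a : Fin n) :
    ∑ b, G⁻¹ a b • cofLow G b = cof a := by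
  have h : G⁻¹ * G = 1 := mul_eq_one_comm.mp hG'
  simp only [cofLow, Finset.smul_sum, smul_smul]
  rw [Finset.sum_comm]
  simp_rw [← Finset.sum_smul, ← Matrix.mul_apply, h, Matrix.one_apply]
  simp

lemma hookUp_cofLow (hG : G.IsSymm) (hG' : G * G⁻¹ = 1) (a b : Fin n) :
    hookUp G a (cofLow G b) = algebraMap ℝ _ (if a = b then 1 else 0) := by
  have h : G⁻¹ * G = 1 := mul_eq_one_comm.mp hG'
  simp only [hookUp, cofLow, map_sum, map_smul, hook_cof]
  have h2 : ∀ c d, G⁻¹ a c • G b d • algebraMap ℝ (Form n) (if c = d then (1 : ℝ) else 0)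
      = if c = d then algebraMap ℝ (Form n) (G⁻¹ a c * G c b) else 0 := fun c d => by
    split_ifs with hcd
    · rw [smul_smul, hcd, hG.apply, Algebra.algebraMap_eq_smul_one, Algebra.algebraMap_eq_smul_one,
        smul_smul, mul_one]
    · simp
  simp_rw [Finset.smul_sum, h2]
  simp_rw [Finset.sum_ite_eq, Finset.mem_univ, if_true, ← map_sum, ← Matrix.mul_apply, h,
    Matrix.one_apply]

lemma cliff_cofLow_left (hG : G.IsSymm) (hG' : G * G⁻¹ = 1) (a : Fin n) (x : Form n) :
    cliff G (cofLow G a) x = cofLow G a * x + hook a x := by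
  rw [cliffL_apply, ← sum_mul_hookUp hG']
  conv_lhs => rw [cofLow]
  simp only [map_sum, map_smul, LinearMap.sum_apply, LinearMap.smul_apply, ← cliffL_apply,
    cliff_cof_left G hG, smul_add, Finset.sum_add_distrib]
  simp [cofLow, Finset.sum_mul]

lemma cliff_cofLow_right (hG : G.IsSymm) (hG' : G * G⁻¹ = 1) (a : Fin n) (x : Form n) :
    cliff G x (cofLow G a) = cofLow G a * inv x - hook a (inv x) := by
  rw [cliffL_apply, ← sum_mul_hookUp hG']
  conv_lhs => rw [cofLow]
  simp only [map_sum, map_smul, ← cliffL_apply,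
    cliff_cof_right G hG, smul_sub, Finset.sum_sub_distrib]
  simp [cofLow, Finset.sum_mul]

lemma toForm_symm_mul (x y : Form n) :
    (toForm G).symm x * (toForm G).symm y = (toForm G).symm (cliff G x y) := by
  rw [cliff_eq, LinearEquiv.symm_apply_apply]

lemma toForm_algebraMap (r : ℝ) : toForm G (algebraMap ℝ _ r) = algebraMap ℝ _ r := by
  simp [toForm]

/-- The coordinate coframe as a frame of the Clifford algebra. -/
def frame (hG : G.IsSymm) (hG' : G * G⁻¹ = 1) :
    CliffordFrame (CliffordAlgebra (Matrix.toQuadraticForm' G⁻¹)) (Fin n) where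
  e a := (toForm G).symm (cof a)
  f a := (toForm G).symm (cofLow G a)
  S := ∑ a, LinearMap.mulLeft ℝ ((toForm G).symm (cof a)) ∘ₗ
    LinearMap.mulRight ℝ ((toForm G).symm (cofLow G a))
  rel a b := by
    rw [toForm_symm_mul, toForm_symm_mul, ← map_add, LinearEquiv.symm_apply_eq,
      cliff_cof_left G hG, cliff_cof_right G hG, inv_cofLow, hookUp_neg, hookUp_cofLow hG hG']
    split_ifs
    · rw [toForm_algebraMap, show (2 : ℝ) = 1 + 1 by norm_num, map_add]
      noncomm_ring
    · simp
  sum_e_f x := by simp [LinearMap.sum_apply]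
  sum_f_e x := by
    simp only [cofLow, map_sum, map_smul, Finset.sum_mul, LinearMap.sum_apply, LinearMap.comp_apply,
      LinearMap.mulLeft_apply, LinearMap.mulRight_apply, Finset.mul_sum, smul_mul_assoc,
      mul_smul_comm]
    rw [Finset.sum_comm]
    simp_rw [hG.apply]

/-- The eigenvalue of `x ↦ e^a x e_a` on forms of degree `d`. -/
def sval (n d : ℕ) : ℝ := (-1) ^ d * (n - 2 * d)

lemma frame_m (hG : G.IsSymm) (hG' : G * G⁻¹ = 1) : (frame hG hG').m = n := by
  simp [CliffordFrame.m]

lemma sum_hookUp_cofLow_mul (hG : G.IsSymm) (hG' : G * G⁻¹ = 1) (x : Form n) :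
    ∑ a, hookUp G a (cofLow G a * x) = ∑ a, hook a (cof a * x) := by
  simp_rw [← sum_inverse_mul_cofLow hG', hookUp, Finset.sum_mul, map_sum, smul_mul_assoc, map_smul]
  rw [Finset.sum_comm]
  simp_rw [inverse_symm G hG]

lemma eq_zero_of_eq_neg {x : Form n} (h : x = -x) : x = 0 := by
  have h2 : (2 : ℝ) • x = 0 := by
    rw [two_smul]
    nth_rewrite 1 [h]
    exact neg_add_cancel x
  exact (smul_eq_zero_iff_right two_ne_zero).mp h2

lemma sum_cof_mul_cofLow (hG : G.IsSymm) : ∑ a, cof a * cofLow G a = 0 := by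
  have h : ∑ a, cof a * cofLow G a = -∑ a, cof a * cofLow G a := by
    conv_lhs => simp only [cofLow, Finset.mul_sum]
    rw [Finset.sum_comm]
    simp only [cofLow, Finset.mul_sum, ← Finset.sum_neg_distrib]
    refine Finset.sum_congr rfl fun a _ => Finset.sum_congr rfl fun b _ => ?_
    rw [hG.apply, mul_smul_comm, mul_smul_comm, ← smul_neg]
    congr 1
    exact eq_neg_of_add_eq_zero_left (ExteriorAlgebra.ι_add_mul_swap (R := ℝ) _ _)
  exact eq_zero_of_eq_neg h

lemma sum_hookUp_hook_eq_zero (hG : G.IsSymm) (x : Form n) :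
    ∑ a, hookUp G a (hook a x) = 0 := by
  have h : ∑ a, hookUp G a (hook a x) = -∑ a, hookUp G a (hook a x) := by
    conv_lhs => simp only [hookUp]
    rw [Finset.sum_comm]
    simp only [hookUp, ← Finset.sum_neg_distrib]
    refine Finset.sum_congr rfl fun a _ => Finset.sum_congr rfl fun b _ => ?_
    rw [hook_hook, smul_neg, inverse_symm G hG]
  exact eq_zero_of_eq_neg h

lemma toForm_S_of_mem (hG : G.IsSymm) (hG' : G * G⁻¹ = 1) {d : ℕ} {x : Form n}
    (hx : x ∈ ⋀[ℝ]^d (Fin n → ℝ)) :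
    toForm G ((frame hG hG').S ((toForm G).symm x)) = sval n d • x := by
  have h : ∀ a, toForm G ((frame hG hG').e a * ((toForm G).symm x * (frame hG hG').f a))
      = (-1 : ℝ) ^ d • (cof a * cofLow G a * x - cof a * hook a x + hookUp G a (cofLow G a * x)
        - hookUp G a (hook a x)) := fun a => by
    simp only [frame, toForm_symm_mul, LinearEquiv.apply_symm_apply, cliff_cofLow_right hG hG',
      cliff_cof_left G hG, inv_of_mem hx, map_smul, mul_smul_comm, ← smul_sub,
      sub_eq_add_neg (cofLow G a * x), hookUp_add, hookUp_neg]
    congr 1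
    rw [mul_add, mul_neg, mul_assoc]
    abel
  rw [← (frame hG hG').sum_e_f, map_sum]
  simp_rw [h, ← Finset.smul_sum, Finset.sum_sub_distrib, Finset.sum_add_distrib,
    Finset.sum_sub_distrib, ← Finset.sum_mul]
  rw [sum_cof_mul_cofLow hG, sum_hookUp_hook_eq_zero hG, sum_hookUp_cofLow_mul hG hG',
    sum_cof_hook hx, sum_hook_cof hx, sval, zero_mul]
  module

lemma toForm_S (hG : G.IsSymm) (hG' : G * G⁻¹ = 1) (x : Form n) :
    toForm G ((frame hG hG').S ((toForm G).symm x)) = degFun (sval n) x := by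
  conv_lhs => rw [← sum_pr x]
  simp only [map_sum, degFun]
  exact Finset.sum_congr rfl fun d _ => toForm_S_of_mem hG hG' (pr_mem d x)

lemma frame_S_of_mem (hG : G.IsSymm) (hG' : G * G⁻¹ = 1) {d : ℕ} {x : Form n}
    (hx : x ∈ ⋀[ℝ]^d (Fin n → ℝ)) {c : ℝ} (hc : sval n d = c) :
    (frame hG hG').S ((toForm G).symm x) = c • (toForm G).symm x := by
  rw [← map_smul, LinearEquiv.eq_symm_apply, toForm_S_of_mem hG hG' hx, hc]

lemma sval_even {d : ℕ} (hd : Even d) : sval n d = n - 2 * d := by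
  rw [sval, hd.neg_one_pow, one_mul]

lemma sval_odd {d : ℕ} (hd : Odd d) : sval n d = 2 * d - n := by
  rw [sval, hd.neg_one_pow]; ring

lemma cofLow_mul_of_even (hG : G.IsSymm) (hG' : G * G⁻¹ = 1) (a : Fin n) {x : Form n}
    (hx : inv x = x) :
    cofLow G a * x = (1 / 2 : ℝ) • (cliff G (cofLow G a) x + cliff G x (cofLow G a)) := by
  rw [cliff_cofLow_left hG hG', cliff_cofLow_right hG hG', hx]
  module

lemma hook_of_odd (hG : G.IsSymm) (hG' : G * G⁻¹ = 1) (a : Fin n) {x : Form n}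
    (hx : inv x = -x) :
    hook a x = (1 / 2 : ℝ) • (cliff G (cofLow G a) x + cliff G x (cofLow G a)) := by
  rw [cliff_cofLow_left hG hG', cliff_cofLow_right hG hG', hx, map_neg, mul_neg]
  module

lemma hook_of_even (hG : G.IsSymm) (hG' : G * G⁻¹ = 1) (a : Fin n) {x : Form n}
    (hx : inv x = x) :
    hook a x = (1 / 2 : ℝ) • (cliff G (cofLow G a) x - cliff G x (cofLow G a)) := by
  rw [cliff_cofLow_left hG hG', cliff_cofLow_right hG hG', hx]
  module

lemma cofLow_mul_of_odd (hG : G.IsSymm) (hG' : G * G⁻¹ = 1) (a : Fin n) {x : Form n}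
    (hx : inv x = -x) :
    cofLow G a * x = (1 / 2 : ℝ) • (cliff G (cofLow G a) x - cliff G x (cofLow G a)) := by
  rw [cliff_cofLow_left hG hG', cliff_cofLow_right hG hG', hx, map_neg, mul_neg]
  module

lemma cof_mul_of_even (hG : G.IsSymm) (a : Fin n) {x : Form n} (hx : inv x = x) :
    cof a * x = (1 / 2 : ℝ) • (cliff G (cof a) x + cliff G x (cof a)) := by
  rw [cliff_cof_left G hG, cliff_cof_right G hG, hx]
  module

lemma hookUp_of_odd (hG : G.IsSymm) (a : Fin n) {x : Form n} (hx : inv x = -x) :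
    hookUp G a x = (1 / 2 : ℝ) • (cliff G (cof a) x + cliff G x (cof a)) := by
  rw [cliff_cof_left G hG, cliff_cof_right G hG, hx, hookUp_neg, mul_neg]
  module

lemma hookUp_of_even (hG : G.IsSymm) (a : Fin n) {x : Form n} (hx : inv x = x) :
    hookUp G a x = (1 / 2 : ℝ) • (cliff G (cof a) x - cliff G x (cof a)) := by
  rw [cliff_cof_left G hG, cliff_cof_right G hG, hx]
  module

lemma cof_mul_of_odd (hG : G.IsSymm) (a : Fin n) {x : Form n} (hx : inv x = -x) :
    cof a * x = (1 / 2 : ℝ) • (cliff G (cof a) x - cliff G x (cof a)) := by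
  rw [cliff_cof_left G hG, cliff_cof_right G hG, hx, hookUp_neg, mul_neg]
  module

/-! ### Operators of odd Killing-Yano forms and even closed conformal Killing-Yano forms -/

/-- The data at a point of an operator `A^a ∇_a + A'` in a form common to the operators `K_κ` of odd
KY forms of degree `p` and `M_κ` of even CCKY forms of degree `n - p`: in the Clifford algebra
`A^a = ½{e^a, κ}`, `∇_a κ = ½[e_a, k]` and `A' = (p/2) k`. Here `dA a b` is `∇_a A^b`, `low` is `A`
with lowered index, and `ε = ±1` is the parity of the coefficients. -/
structure OperatorData (hG : G.IsSymm) (hG' : G * G⁻¹ = 1) (p ε : ℝ) (κ k : Form n)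
    (A : Fin n → Form n) (dA : Fin n → Fin n → Form n) (A' : Form n) (low : Fin n → Form n) :
    Prop where
  coeff : ∀ a, (toForm G).symm (A a) = (frame hG hG').up ((toForm G).symm κ) a
  coeff_low : ∀ a, (toForm G).symm (low a) = (frame hG hG').low ((toForm G).symm κ) a
  deriv : ∀ a b, (toForm G).symm (dA a b)
    = (frame hG hG').up ((frame hG hG').der ((toForm G).symm k) a) b
  tilde : A' = (p / 2) • k
  parity_coeff : ∀ a, inv (A a) = ε • A a
  parity_deriv : ∀ a b, inv (dA a b) = ε • dA a b
  parity_tilde : inv A' = ε • A'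
  S_form : (frame hG hG').S ((toForm G).symm κ) = (2 * p - n) • (toForm G).symm κ
  S_der : (frame hG hG').S ((toForm G).symm k) = (n - 2 * p - 2) • (toForm G).symm k

lemma operatorData_KY (hG : G.IsSymm) (hG' : G * G⁻¹ = 1) {p : ℕ} (hp : Odd p) {κ k : Form n}
    (hκ : κ ∈ ⋀[ℝ]^p (Fin n → ℝ)) (hk : k ∈ ⋀[ℝ]^(p + 1) (Fin n → ℝ)) :
    OperatorData hG hG' p 1 κ k (fun a => hookUp G a κ) (fun a b => hookUp G b (hook a k))
      (((p : ℝ) / 2) • k) (fun a => hook a κ) where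
  coeff a := by
    rw [hookUp_of_odd hG a (inv_odd hp hκ)]
    simp only [CliffordFrame.up, frame, map_smul, map_add, toForm_symm_mul]
  coeff_low a := by
    rw [hook_of_odd hG hG' a (inv_odd hp hκ)]
    simp only [CliffordFrame.low, frame, map_smul, map_add, toForm_symm_mul]
  deriv a b := by
    rw [hookUp_of_odd hG b (inv_odd hp (hook_mem a hk)), hook_of_even hG hG' a
      (inv_even hp.add_one hk)]
    simp only [CliffordFrame.up, CliffordFrame.der, frame, ← map_sub, ← map_smul, ← map_add,
      toForm_symm_mul]
  tilde := rfl
  parity_coeff a := by rw [inv_hookUp, inv_odd hp hκ, hookUp_neg, neg_neg, one_smul]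
  parity_deriv a b := by
    rw [inv_hookUp, inv_odd hp (hook_mem a hk), hookUp_neg, neg_neg, one_smul]
  parity_tilde := by rw [map_smul, inv_even hp.add_one hk, one_smul]
  S_form := frame_S_of_mem hG hG' hκ (sval_odd hp)
  S_der := frame_S_of_mem hG hG' hk (by rw [sval_even hp.add_one]; push_cast; ring)

lemma operatorData_CCKY (hG : G.IsSymm) (hG' : G * G⁻¹ = 1) {c : ℕ} (hc : Even c) {ω w : Form n}
    (hω : ω ∈ ⋀[ℝ]^c (Fin n → ℝ)) (hw : w ∈ ⋀[ℝ]^(c - 1) (Fin n → ℝ)) (hw' : c = 0 → w = 0) :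
    OperatorData hG hG' (n - c) (-1) ω w (fun a => cof a * ω)
      (fun a b => cof b * (cofLow G a * w)) ((((n : ℝ) - c) / 2) • w)
      (fun a => cofLow G a * ω) := by
  have hw1 : inv w = -w := by
    rcases Nat.eq_zero_or_pos c with h | h
    · rw [hw' h, map_zero, neg_zero]
    · exact inv_odd (Nat.Even.sub_odd h hc odd_one) hw
  have h1 : ∀ a, inv (cofLow G a * w) = cofLow G a * w := fun a => by
    rw [map_mul, inv_cofLow, hw1, neg_mul_neg]
  exact
  { coeff := fun a => by
      rw [cof_mul_of_even hG a (inv_even hc hω)]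
      simp only [CliffordFrame.up, frame, map_smul, map_add, toForm_symm_mul]
    coeff_low := fun a => by
      rw [cofLow_mul_of_even hG hG' a (inv_even hc hω)]
      simp only [CliffordFrame.low, frame, map_smul, map_add, toForm_symm_mul]
    deriv := fun a b => by
      rw [cof_mul_of_even hG b (h1 a), cofLow_mul_of_odd hG hG' a hw1]
      simp only [CliffordFrame.up, CliffordFrame.der, frame, ← map_sub, ← map_smul, ← map_add,
        toForm_symm_mul]
    tilde := rfl
    parity_coeff := fun a => by
      rw [map_mul, inv_cof, inv_even hc hω, neg_mul, neg_one_smul]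
    parity_deriv := fun a b => by
      rw [map_mul, inv_cof, h1, neg_mul, neg_one_smul]
    parity_tilde := by rw [map_smul, hw1, smul_neg, neg_one_smul]
    S_form := frame_S_of_mem hG hG' hω (by rw [sval_even hc]; ring)
    S_der := by
      rcases Nat.eq_zero_or_pos c with h | h
      · simp [hw' h]
      · refine frame_S_of_mem hG hG' hw ?_
        rw [sval_odd (Nat.Even.sub_odd h hc odd_one), Nat.cast_sub h]
        push_cast; ring }

lemma cliff_smul_smul (a b : ℝ) (x y : Form n) : cliff G (a • x) (b • y) = (a * b) • cliff G x y := by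
  simp only [cliffL_apply, map_smul, LinearMap.smul_apply, smul_smul]
  rw [mul_comm]

lemma inv_comm (hG : G.IsSymm) (x y : Form n) : inv (comm G x y) = comm G (inv x) (inv y) := by
  simp only [comm, map_sub, inv_cliff G hG]

section pair

variable {hG : G.IsSymm} {hG' : G * G⁻¹ = 1} {p q ε ε' : ℝ} {κ k lam l : Form n}
  {A : Fin n → Form n} {dA : Fin n → Fin n → Form n} {A' : Form n} {Al : Fin n → Form n}
  {B : Fin n → Form n} {dB : Fin n → Fin n → Form n} {B' : Form n} {Bl : Fin n → Form n}
  (hA : OperatorData hG hG' p ε κ k A dA A' Al) (hB : OperatorData hG hG' q ε' lam l B dB B' Bl)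

include hA hB

lemma inv_curly (b : Fin n) :
    inv (curly G A dA A' B dB B' b) = (ε * ε') • curly G A dA A' B dB B' b := by
  simp only [curly, comm, map_sub, map_add, map_sum, inv_cliff G hG, hA.parity_coeff,
    hA.parity_deriv, hA.parity_tilde, hB.parity_coeff, hB.parity_deriv, hB.parity_tilde,
    cliff_smul_smul, mul_comm ε' ε, smul_sub, smul_add, Finset.smul_sum]

lemma toForm_symm_curly (b : Fin n) : (toForm G).symm (curly G A dA A' B dB B' b)
    = (frame hG hG').curly p q ((toForm G).symm κ) ((toForm G).symm k) ((toForm G).symm lam)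
        ((toForm G).symm l) b := by
  simp only [curly, comm, CliffordFrame.curly, map_sub, map_add, map_sum, ← toForm_symm_mul,
    hA.coeff, hB.coeff, hA.deriv, hB.deriv, hA.tilde, hB.tilde, map_smul]

omit hA hB in
lemma toForm_symm_comm (x y : Form n) : (toForm G).symm (comm G x y)
    = (toForm G).symm x * (toForm G).symm y - (toForm G).symm y * (toForm G).symm x := by
  simp only [comm, map_sub, ← toForm_symm_mul]

/-- The necessary condition says that the Clifford commutator of the two forms lies in an eigenspace
of `x ↦ e^a x e_a`, that is, has only one homogeneous part. -/
lemma degFun_comm_of_sum_comm_eq_zero (h : ∑ a, comm G (A a) (Bl a) = 0) :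
    degFun (sval n) (comm G κ lam) = ((n : ℝ) - 2 * (p + q)) • comm G κ lam := by
  have h2 := congrArg (toForm G).symm h
  simp only [map_sum, toForm_symm_comm, hA.coeff, hB.coeff_low, map_zero] at h2
  have hm := frame_m hG hG'
  rw [(frame hG hG').sum_comm_up_low (p := p) (q := q) (by rw [hm, hA.S_form])
    (by rw [hm, hB.S_form]), hm, ← toForm_symm_comm, smul_eq_zero_iff_right (by norm_num),
    sub_eq_zero] at h2
  rw [← toForm_S hG hG', h2, map_smul, LinearEquiv.apply_symm_apply]

omit hA hB in
/-- The derivative of the commutator of the two forms, for `dκ a = ∇_a κ`, `dλ a = ∇_a λ`. -/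
lemma toForm_derComm {dκ dlam : Form n} {b : Fin n}
    (hdκ : (toForm G).symm dκ = (frame hG hG').der ((toForm G).symm k) b)
    (hdlam : (toForm G).symm dlam = (frame hG hG').der ((toForm G).symm l) b) :
    (toForm G).symm (comm G dκ lam + comm G κ dlam) = (frame hG hG').derComm
      ((toForm G).symm κ) ((toForm G).symm k) ((toForm G).symm lam) ((toForm G).symm l) b := by
  simp only [CliffordFrame.derComm, map_add, toForm_symm_comm, hdκ, hdlam]

variable {dY : Fin n → Form n}
  (hdY : ∀ b, (toForm G).symm (dY b) = (frame hG hG').derComm ((toForm G).symm κ)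
    ((toForm G).symm k) ((toForm G).symm lam) ((toForm G).symm l) b)
  (hS : ∀ b, degFun (sval n) (dY b) = ((n : ℝ) - 2 * (p + q)) • dY b)

include hdY hS

omit hA hB in
lemma S_derComm (b : Fin n) : (frame hG hG').S ((frame hG hG').derComm ((toForm G).symm κ)
    ((toForm G).symm k) ((toForm G).symm lam) ((toForm G).symm l) b)
    = ((frame hG hG').m - 2 * (p + q)) • (frame hG hG').derComm ((toForm G).symm κ)
    ((toForm G).symm k) ((toForm G).symm lam) ((toForm G).symm l) b := by
  rw [← hdY, frame_m, ← map_smul, LinearEquiv.eq_symm_apply, toForm_S, hS]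

/-- The contracted first-order coefficient of the commutator of the two operators. -/
lemma sum_anticomm_curly : ∑ b, (cliff G (cofLow G b) (curly G A dA A' B dB B' b)
      + cliff G (curly G A dA A' B dB B' b) (cofLow G b))
    = (p * q) • (comm G k lam + comm G κ l) := by
  have hm := frame_m hG hG'
  have h := (frame hG hG').sum_f_curly (p := p) (q := q) (by rw [hm, hA.S_form])
    (by rw [hm, hA.S_der]) (by rw [hm, hB.S_form]) (by rw [hm, hB.S_der])
    (S_derComm hdY hS)
  apply (toForm G).symm.injective
  simp only [map_sum, map_add, ← toForm_symm_mul, toForm_symm_curly hA hB, map_smul,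
    toForm_symm_comm]
  exact h

lemma sum_cofLow_curly (hε : ε * ε' = 1) : ∑ b, cofLow G b * curly G A dA A' B dB B' b
    = (p * q / 2) • (comm G k lam + comm G κ l) := by
  have h : ∀ b, cofLow G b * curly G A dA A' B dB B' b = (1 / 2 : ℝ) •
      (cliff G (cofLow G b) (curly G A dA A' B dB B' b)
        + cliff G (curly G A dA A' B dB B' b) (cofLow G b)) := fun b =>
    cofLow_mul_of_even hG hG' b (by rw [inv_curly hA hB, hε, one_smul])
  simp_rw [h, ← Finset.smul_sum]
  rw [sum_anticomm_curly hA hB hdY hS]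
  module

lemma sum_hook_curly (hε : ε * ε' = -1) : ∑ b, hook b (curly G A dA A' B dB B' b)
    = (p * q / 2) • (comm G k lam + comm G κ l) := by
  have h : ∀ b, hook b (curly G A dA A' B dB B' b) = (1 / 2 : ℝ) •
      (cliff G (cofLow G b) (curly G A dA A' B dB B' b)
        + cliff G (curly G A dA A' B dB B' b) (cofLow G b)) := fun b =>
    hook_of_odd hG hG' b (by rw [inv_curly hA hB, hε, neg_one_smul])
  simp_rw [h, ← Finset.smul_sum]
  rw [sum_anticomm_curly hA hB hdY hS]
  module

omit hS in
/-- The divergence of the derivative of the commutator, up to a factor its co-differential or exterior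
derivative. -/
lemma sum_comm_cof_dY : ∑ b, (cliff G (cof b) (dY b) - cliff G (dY b) (cof b))
    = (1 / 2 : ℝ) • ((2 * (p + q) + 2 - n) • (comm G k lam + comm G κ l)
      - degFun (sval n) (comm G k lam + comm G κ l)) := by
  have hm := frame_m hG hG'
  have h := (frame hG hG').sum_comm_e_derComm (p := p) (q := q) (by rw [hm, hA.S_form])
    (by rw [hm, hA.S_der]) (by rw [hm, hB.S_form]) (by rw [hm, hB.S_der])
  apply (toForm G).symm.injective
  rw [← toForm_S hG hG']
  simp only [map_sum, map_sub, map_add, ← toForm_symm_mul, map_smul,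
    toForm_symm_comm, LinearEquiv.symm_apply_apply, hdY]
  rw [hm, show 2 * p + 2 * q + 2 - (n : ℝ) = 2 * (p + q) + 2 - n by ring] at h
  simp only [map_add, map_sub] at h
  exact h

/-- Only two homogeneous parts of `[k, λ] + [κ, l]` can be different from zero. -/
lemma pr_comm_eq_zero_of_sval {d : ℕ} (h1 : sval n d ≠ 2 * (p + q) + 2 - n)
    (h2 : sval n d ≠ 2 * (p + q) - 2 - n) : pr d (comm G k lam + comm G κ l) = 0 := by
  have hm := frame_m hG hG'
  have hW := (frame hG hG').S_sum_comm (S_derComm hdY hS)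
  have h3 := sum_comm_cof_dY hA hB hdY
  have h4 : (toForm G).symm (∑ b, (cliff G (cof b) (dY b) - cliff G (dY b) (cof b)))
      = ∑ b, ((frame hG hG').e b * (frame hG hG').derComm ((toForm G).symm κ) ((toForm G).symm k)
        ((toForm G).symm lam) ((toForm G).symm l) b - (frame hG hG').derComm ((toForm G).symm κ)
        ((toForm G).symm k) ((toForm G).symm lam) ((toForm G).symm l) b * (frame hG hG').e b) := by
    simp only [map_sum, map_sub, ← toForm_symm_mul, hdY]
    rfl
  rw [← h4] at hW
  have h5 := congrArg (toForm G) hW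
  rw [toForm_S, map_smul, LinearEquiv.apply_symm_apply, hm, h3] at h5
  have h6 := congrArg (pr d) h5
  simp only [pr_degFun, map_smul, map_sub, ← sub_smul, smul_smul] at h6
  rw [← sub_eq_zero, ← sub_smul] at h6
  refine (smul_eq_zero.mp h6).resolve_left ?_
  rw [show ∀ s D m : ℝ, s * (1 / 2 * (2 * D + 2 - m - s))
      - (-2 - (m - 2 * D)) * (1 / 2) * (2 * D + 2 - m - s)
      = (-1 / 2) * ((s - (2 * D + 2 - m)) * (s - (2 * D - 2 - m))) by intros; ring]
  exact mul_ne_zero (by norm_num) (mul_ne_zero (sub_ne_zero.mpr h1) (sub_ne_zero.mpr h2))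

end pair

end frame

/-! ### Partial derivatives of fields of forms -/

/-- The `a`-th partial derivative of a function. -/
def partialD (a : Fin n) (f : EuclideanSpace ℝ (Fin n) → ℝ) (y : EuclideanSpace ℝ (Fin n)) : ℝ :=
  fderiv ℝ f y (EuclideanSpace.single a 1)

lemma pderivMetric_eq (G : LocalMetric n) (a i j : Fin n) (y : EuclideanSpace ℝ (Fin n)) :
    pderivMetric G a i j y = partialD a (fun z => G z i j) y := rfl

/-- Differentiability of a field of forms at a point, through its components. -/
def DiffAt (ω : LocalForm n) (y : EuclideanSpace ℝ (Fin n)) : Prop :=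
  ∀ S, DifferentiableAt ℝ (fun z => (formBasis n).repr (ω z) S) y

section pderiv

variable {y : EuclideanSpace ℝ (Fin n)} {a : Fin n} {ω η : LocalForm n}
  {U : Set (EuclideanSpace ℝ (Fin n))}

lemma eq_sum_repr (x : Form n) : ∑ S, (formBasis n).repr x S • formBasis n S = x :=
  (formBasis n).sum_repr x

lemma repr_sum_smul {ι : Type*} [Fintype ι] (f : ι → ℝ) (c : ι → Form n) (S : Finset (Fin n)) :
    (formBasis n).repr (∑ i, f i • c i) S = ∑ i, f i * (formBasis n).repr (c i) S := by
  simp [map_sum, Finsupp.finsetSum_apply]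

lemma partialD_sum {ι : Type*} [Fintype ι] {f : ι → EuclideanSpace ℝ (Fin n) → ℝ}
    (hf : ∀ i, DifferentiableAt ℝ (f i) y) :
    partialD a (fun z => ∑ i, f i z) y = ∑ i, partialD a (f i) y := by
  unfold partialD
  rw [fderiv_fun_sum fun i _ => hf i, _root_.sum_apply]

lemma partialD_mul {f g : EuclideanSpace ℝ (Fin n) → ℝ} (hf : DifferentiableAt ℝ f y)
    (hg : DifferentiableAt ℝ g y) :
    partialD a (fun z => f z * g z) y = partialD a f y * g y + f y * partialD a g y := by
  unfold partialD
  rw [fderiv_fun_mul hf hg]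
  simp
  ring

lemma partialD_const (c : ℝ) : partialD a (fun _ => c) y = 0 := by simp [partialD]

lemma partialD_congr {f g : EuclideanSpace ℝ (Fin n) → ℝ} (h : f =ᶠ[nhds y] g) :
    partialD a f y = partialD a g y := by
  unfold partialD
  rw [h.fderiv_eq]

lemma pderiv_sum_smul {ι : Type*} [Fintype ι] {f : ι → EuclideanSpace ℝ (Fin n) → ℝ}
    (hf : ∀ i, DifferentiableAt ℝ (f i) y) (c : ι → Form n) :
    pderiv a (fun z => ∑ i, f i z • c i) y = ∑ i, partialD a (f i) y • c i := by
  have h : ∀ S, fderiv ℝ (fun z => (formBasis n).repr (∑ i, f i z • c i) S) y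
      (EuclideanSpace.single a 1) = ∑ i, partialD a (f i) y * (formBasis n).repr (c i) S := by
    intro S
    simp_rw [repr_sum_smul]
    refine (partialD_sum (a := a) fun i => (hf i).mul_const _).trans ?_
    refine Finset.sum_congr rfl fun i _ => ?_
    rw [partialD_mul (hf i) (differentiableAt_const _), partialD_const, mul_zero, add_zero]
  simp only [pderiv, h, Finset.sum_smul]
  rw [Finset.sum_comm]
  simp_rw [mul_smul, ← Finset.smul_sum, eq_sum_repr]

lemma smoothOn_sum_smul {ι : Type*} [Fintype ι] {f : ι → EuclideanSpace ℝ (Fin n) → ℝ}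
    (hf : ∀ i, ContDiffOn ℝ (⊤ : ℕ∞) (f i) U) (c : ι → Form n) :
    SmoothOn (fun z => ∑ i, f i z • c i) U := fun S => by
  simp_rw [repr_sum_smul]
  exact ContDiffOn.sum fun i _ => (hf i).mul contDiffOn_const

lemma SmoothOn.diffAt (hω : SmoothOn ω U) (hU : IsOpen U) (hy : y ∈ U) : DiffAt ω y := fun S =>
  ((hω S).contDiffAt (hU.mem_nhds hy)).differentiableAt (by simp)

lemma pderiv_congr (h : ω =ᶠ[nhds y] η) : pderiv a ω y = pderiv a η y := by
  refine Finset.sum_congr rfl fun S _ => ?_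
  congr 1
  exact partialD_congr (h.fun_comp fun x => (formBasis n).repr x S)

lemma SmoothOn.congr (hω : SmoothOn ω U) (h : ∀ z ∈ U, η z = ω z) : SmoothOn η U := fun S =>
  (hω S).congr fun z hz => by rw [h z hz]

lemma linear_expand (L : Form n →ₗ[ℝ] Form n) (ω : LocalForm n) :
    (fun z => L (ω z)) = fun z => ∑ S, (formBasis n).repr (ω z) S • L (formBasis n S) := by
  funext z
  conv_lhs => rw [← eq_sum_repr (ω z), map_sum]
  simp_rw [map_smul]

lemma pderiv_linear (L : Form n →ₗ[ℝ] Form n) (hω : DiffAt ω y) :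
    pderiv a (fun z => L (ω z)) y = L (pderiv a ω y) := by
  rw [linear_expand, pderiv_sum_smul hω, pderiv, map_sum]
  simp_rw [map_smul]
  rfl

lemma SmoothOn.linear (L : Form n →ₗ[ℝ] Form n) (hω : SmoothOn ω U) :
    SmoothOn (fun z => L (ω z)) U := by
  rw [linear_expand]
  exact smoothOn_sum_smul hω _

lemma bilinear_expand (B : Form n →ₗ[ℝ] Form n →ₗ[ℝ] Form n) (ω η : LocalForm n) :
    (fun z => B (ω z) (η z)) = fun z => ∑ ST : Finset (Fin n) × Finset (Fin n),
      ((formBasis n).repr (ω z) ST.1 * (formBasis n).repr (η z) ST.2) •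
        B (formBasis n ST.1) (formBasis n ST.2) := by
  funext z
  conv_lhs => rw [← eq_sum_repr (ω z), ← eq_sum_repr (η z)]
  rw [map_sum, Fintype.sum_prod_type_right]
  refine Finset.sum_congr rfl fun T _ => ?_
  rw [map_sum, LinearMap.sum_apply]
  refine Finset.sum_congr rfl fun S _ => ?_
  rw [map_smul, map_smul, LinearMap.smul_apply, smul_smul, mul_comm]

lemma pderiv_bilinear (B : Form n →ₗ[ℝ] Form n →ₗ[ℝ] Form n) (hω : DiffAt ω y) (hη : DiffAt η y) :
    pderiv a (fun z => B (ω z) (η z)) y = B (pderiv a ω y) (η y) + B (ω y) (pderiv a η y) := by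
  have h1 := congrFun (bilinear_expand B (fun _ => pderiv a ω y) η) y
  have h2 := congrFun (bilinear_expand B ω (fun _ => pderiv a η y)) y
  have hr : ∀ (ω : LocalForm n) S, (formBasis n).repr (pderiv a ω y) S
      = partialD a (fun z => (formBasis n).repr (ω z) S) y := fun ω S => by
    rw [pderiv, repr_sum_smul]
    simp [Finsupp.single_apply, partialD]
  simp only [hr] at h1 h2
  rw [h1, h2, bilinear_expand, pderiv_sum_smul fun ST : Finset (Fin n) × Finset (Fin n) => (hω ST.1).fun_mul (hη ST.2),
    ← Finset.sum_add_distrib]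
  refine Finset.sum_congr rfl fun ST _ => ?_
  rw [partialD_mul (hω _) (hη _), add_smul]

lemma SmoothOn.bilinear (B : Form n →ₗ[ℝ] Form n →ₗ[ℝ] Form n) (hω : SmoothOn ω U)
    (hη : SmoothOn η U) : SmoothOn (fun z => B (ω z) (η z)) U := by
  rw [bilinear_expand]
  exact smoothOn_sum_smul (fun ST : Finset (Fin n) × Finset (Fin n) =>
    (hω ST.1).mul (hη ST.2)) _

variable {f : EuclideanSpace ℝ (Fin n) → ℝ}

lemma smul_expand (f : EuclideanSpace ℝ (Fin n) → ℝ) (ω : LocalForm n) :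
    (fun z => f z • ω z) = fun z => ∑ S, (f z * (formBasis n).repr (ω z) S) • formBasis n S := by
  funext z
  simp_rw [mul_smul, ← Finset.smul_sum, eq_sum_repr]

lemma pderiv_smul (hf : DifferentiableAt ℝ f y) (hω : DiffAt ω y) :
    pderiv a (fun z => f z • ω z) y = partialD a f y • ω y + f y • pderiv a ω y := by
  rw [smul_expand, pderiv_sum_smul fun S => hf.fun_mul (hω S)]
  conv_rhs => rw [← eq_sum_repr (ω y), pderiv, Finset.smul_sum, Finset.smul_sum]
  rw [← Finset.sum_add_distrib]
  refine Finset.sum_congr rfl fun S _ => ?_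
  rw [partialD_mul hf (hω S), smul_smul, smul_smul, ← add_smul]
  rfl

lemma SmoothOn.smul (hf : ContDiffOn ℝ (⊤ : ℕ∞) f U) (hω : SmoothOn ω U) :
    SmoothOn (fun z => f z • ω z) U := by
  rw [smul_expand]
  exact smoothOn_sum_smul (fun S => hf.mul (hω S)) _

lemma SmoothOn.neg (hω : SmoothOn ω U) : SmoothOn (fun z => -ω z) U := fun S => by
  simpa using (hω S).neg

lemma SmoothOn.sub (hω : SmoothOn ω U) (hη : SmoothOn η U) :
    SmoothOn (fun z => ω z - η z) U := fun S => by
  simpa using (hω S).sub (hη S)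

lemma SmoothOn.sum {ι : Type*} {s : Finset ι} {w : ι → LocalForm n}
    (h : ∀ i ∈ s, SmoothOn (w i) U) : SmoothOn (fun z => ∑ i ∈ s, w i z) U := fun S => by
  simp only [map_sum, Finsupp.finsetSum_apply]
  exact ContDiffOn.sum fun i hi => h i hi S

lemma pderiv_add (hω : DiffAt ω y) (hη : DiffAt η y) :
    pderiv a (fun z => ω z + η z) y = pderiv a ω y + pderiv a η y := by
  simp only [pderiv, map_add, Finsupp.add_apply]
  rw [← Finset.sum_add_distrib]
  refine Finset.sum_congr rfl fun S _ => ?_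
  rw [fderiv_fun_add (hω S) (hη S), ← add_smul]
  rfl

lemma pderiv_sum {ι : Type*} {s : Finset ι} {w : ι → LocalForm n} (h : ∀ i ∈ s, DiffAt (w i) y) :
    pderiv a (fun z => ∑ i ∈ s, w i z) y = ∑ i ∈ s, pderiv a (w i) y := by
  simp only [pderiv, map_sum, Finsupp.finsetSum_apply]
  rw [Finset.sum_comm]
  refine Finset.sum_congr rfl fun S _ => ?_
  rw [fderiv_fun_sum fun i hi => h i hi S, _root_.sum_apply, Finset.sum_smul]

lemma pderiv_const (x : Form n) : pderiv a (fun _ => x) y = 0 := by simp [pderiv]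

lemma smoothOn_const (x : Form n) : SmoothOn (fun _ => x) U := fun _ => contDiffOn_const

lemma contDiffOn_partialD (hf : ContDiffOn ℝ (⊤ : ℕ∞) f U) (hU : IsOpen U) (a : Fin n) :
    ContDiffOn ℝ (⊤ : ℕ∞) (partialD a f) U :=
  (hf.fderiv_of_isOpen hU (m := (⊤ : ℕ∞)) (by simp)).clm_apply contDiffOn_const

lemma SmoothOn.pderiv (hω : SmoothOn ω U) (hU : IsOpen U) (a : Fin n) :
    SmoothOn (pderiv a ω) U :=
  smoothOn_sum_smul (fun S => contDiffOn_partialD (hω S) hU a) _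

end pderiv

/-! ### The Levi-Civita connection on a coordinate domain -/

/-- A smooth pseudo-Riemannian metric on an open set, in components. -/
structure MetricOn (G : LocalMetric n) (U : Set (EuclideanSpace ℝ (Fin n))) : Prop where
  isOpen : IsOpen U
  symm : ∀ y ∈ U, (G y).IsSymm
  mul_inv : ∀ y ∈ U, G y * (G y)⁻¹ = 1
  smooth : ∀ i j, ContDiffOn ℝ (⊤ : ℕ∞) (fun y => G y i j) U

lemma contDiffOn_det {U : Set (EuclideanSpace ℝ (Fin n))} {G : LocalMetric n}
    (h : ∀ i j, ContDiffOn ℝ (⊤ : ℕ∞) (fun y => G y i j) U) :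
    ContDiffOn ℝ (⊤ : ℕ∞) (fun y => (G y).det) U := by
  simp_rw [Matrix.det_apply]
  exact ContDiffOn.sum fun σ _ => (contDiffOn_prod fun i _ => h _ _).const_smul _

namespace MetricOn

variable {G : LocalMetric n} {U : Set (EuclideanSpace ℝ (Fin n))} (hG : MetricOn G U)
  {y : EuclideanSpace ℝ (Fin n)} {a : Fin n} {ω η : LocalForm n}

include hG

lemma contDiffOn_inv (i j : Fin n) : ContDiffOn ℝ (⊤ : ℕ∞) (fun y => (G y)⁻¹ i j) U := by
  have h : ∀ y, (G y)⁻¹ i j = ((G y).det)⁻¹ * (Matrix.updateRow (G y) j (Pi.single i 1)).det :=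
    fun y => by
      rw [Matrix.inv_def, Matrix.smul_apply, Matrix.adjugate_apply, Ring.inverse_eq_inv', smul_eq_mul]
  simp_rw [h]
  refine ContDiffOn.mul ((contDiffOn_det hG.smooth).inv fun y hy h0 => ?_)
    (contDiffOn_det fun k l => ?_)
  · have := congrArg Matrix.det (hG.mul_inv y hy)
    rw [Matrix.det_mul, h0, zero_mul, Matrix.det_one] at this
    exact zero_ne_one this
  · by_cases hk : k = j
    · subst hk
      simp only [Matrix.updateRow_self]
      exact contDiffOn_const
    · simp only [Matrix.updateRow_ne hk]
      exact hG.smooth k l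

lemma differentiableAt (hy : y ∈ U) (i j : Fin n) : DifferentiableAt ℝ (fun z => G z i j) y :=
  ((hG.smooth i j).contDiffAt (hG.isOpen.mem_nhds hy)).differentiableAt (by simp)

lemma differentiableAt_inv (hy : y ∈ U) (i j : Fin n) :
    DifferentiableAt ℝ (fun z => (G z)⁻¹ i j) y :=
  ((hG.contDiffOn_inv i j).contDiffAt (hG.isOpen.mem_nhds hy)).differentiableAt (by simp)

lemma pderivMetric_symm (hy : y ∈ U) (i j : Fin n) :
    pderivMetric G a i j y = pderivMetric G a j i y := by
  rw [pderivMetric_eq, pderivMetric_eq]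
  refine partialD_congr ?_
  filter_upwards [hG.isOpen.mem_nhds hy] with z hz
  rw [(hG.symm z hz).apply]

lemma christoffel_symm (hy : y ∈ U) (i j k : Fin n) :
    christoffel G y i j k = christoffel G y i k j := by
  unfold christoffel
  congr 1
  refine Finset.sum_congr rfl fun l _ => ?_
  rw [hG.pderivMetric_symm hy j k]
  ring

lemma contDiffOn_christoffel (i j k : Fin n) :
    ContDiffOn ℝ (⊤ : ℕ∞) (fun y => christoffel G y i j k) U := by
  have h : ∀ a i j, ContDiffOn ℝ (⊤ : ℕ∞) (pderivMetric G a i j) U := fun a i j =>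
    contDiffOn_partialD (hG.smooth i j) hG.isOpen a
  unfold christoffel
  exact contDiffOn_const.mul (ContDiffOn.sum fun l _ =>
    (hG.contDiffOn_inv i l).mul (((h _ _ _).add (h _ _ _)).sub (h _ _ _)))

/-- The inverse metric is parallel. -/
lemma partialD_inv (hy : y ∈ U) (c a b : Fin n) : partialD c (fun z => (G z)⁻¹ a b) y
    = -∑ i, christoffel G y a c i * (G y)⁻¹ i b - ∑ i, christoffel G y b c i * (G y)⁻¹ a i := by
  have hi := inverse_symm (G y) (hG.symm y hy)
  have hinv : (G y)⁻¹ * G y = 1 := mul_eq_one_comm.mp (hG.mul_inv y hy)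
  -- differentiate `G G⁻¹ = 1`
  have h1 : ∀ j, ∑ k, (pderivMetric G c j k y * (G y)⁻¹ k b
      + G y j k * partialD c (fun z => (G z)⁻¹ k b) y) = 0 := fun j => by
    have h2 : partialD c (fun z => ∑ k, G z j k * (G z)⁻¹ k b) y = 0 := by
      have h3 : (fun z => ∑ k, G z j k * (G z)⁻¹ k b)
          =ᶠ[nhds y] fun _ => (1 : Matrix (Fin n) (Fin n) ℝ) j b := by
        filter_upwards [hG.isOpen.mem_nhds hy] with z hz
        rw [← Matrix.mul_apply, hG.mul_inv z hz]
      rw [partialD_congr h3, partialD_const]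
    rw [partialD_sum fun k =>
      (hG.differentiableAt hy j k).fun_mul (hG.differentiableAt_inv hy k b)] at h2
    rw [← h2]
    exact Finset.sum_congr rfl fun k _ =>
      (partialD_mul (hG.differentiableAt hy j k) (hG.differentiableAt_inv hy k b)).symm
  have h4 : partialD c (fun z => (G z)⁻¹ a b) y
      = -∑ j, ∑ k, (G y)⁻¹ a j * pderivMetric G c j k y * (G y)⁻¹ k b := by
    have h5 : ∑ j, (G y)⁻¹ a j * ∑ k, (pderivMetric G c j k y * (G y)⁻¹ k b
      + G y j k * partialD c (fun z => (G z)⁻¹ k b) y) = 0 :=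
      Finset.sum_eq_zero fun j _ => by rw [h1, mul_zero]
    have h6 : ∑ j, ∑ k, (G y)⁻¹ a j * (G y j k * partialD c (fun z => (G z)⁻¹ k b) y)
        = partialD c (fun z => (G z)⁻¹ a b) y := by
      rw [Finset.sum_comm]
      simp_rw [← mul_assoc, ← Finset.sum_mul, ← Matrix.mul_apply, hinv, Matrix.one_apply]
      simp
    simp_rw [Finset.mul_sum, mul_add, Finset.sum_add_distrib, h6, ← mul_assoc] at h5
    linarith
  rw [h4]
  have h7 : ∀ a b, ∑ i, christoffel G y a c i * (G y)⁻¹ i b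
      = ∑ l, ∑ i, (1 / 2) * ((G y)⁻¹ a l * (G y)⁻¹ i b * (pderivMetric G c l i y
        + pderivMetric G i l c y - pderivMetric G l c i y)) := fun a b => by
    rw [Finset.sum_comm]
    refine Finset.sum_congr rfl fun i _ => ?_
    rw [christoffel, Finset.mul_sum, Finset.sum_mul]
    exact Finset.sum_congr rfl fun l _ => by ring
  have h8 : ∑ i, christoffel G y b c i * (G y)⁻¹ a i
      = ∑ l, ∑ i, (1 / 2) * ((G y)⁻¹ a l * (G y)⁻¹ i b * (pderivMetric G c i l y
        + pderivMetric G l i c y - pderivMetric G i c l y)) := by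
    simp_rw [hi a, h7]
    rw [Finset.sum_comm]
    refine Finset.sum_congr rfl fun l _ => Finset.sum_congr rfl fun i _ => ?_
    rw [hi b i, hi l a]; ring
  rw [h7, h8, ← Finset.sum_neg_distrib, ← Finset.sum_neg_distrib, ← Finset.sum_sub_distrib]
  refine Finset.sum_congr rfl fun l _ => ?_
  rw [← Finset.sum_neg_distrib, ← Finset.sum_neg_distrib, ← Finset.sum_sub_distrib]
  refine Finset.sum_congr rfl fun i _ => ?_
  rw [hG.pderivMetric_symm (a := c) hy i l, hG.pderivMetric_symm (a := i) hy c l,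
    hG.pderivMetric_symm (a := l) hy c i]
  ring

end MetricOn

/-- The zeroth-order part of `∇_a`: the derivation of the exterior algebra sending `e^i` to
`Γ^i_{aj} e^j`, so that `∇_a = ∂_a - conn G a y`. -/
def conn (G : LocalMetric n) (a : Fin n) (y : EuclideanSpace ℝ (Fin n)) : Form n →ₗ[ℝ] Form n :=
  ∑ i, ∑ j, christoffel G y i a j • (LinearMap.mulLeft ℝ (cof j) ∘ₗ hook i)

section conn

variable (G : LocalMetric n) (a : Fin n) (y : EuclideanSpace ℝ (Fin n))

lemma conn_apply (x : Form n) :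
    conn G a y x = ∑ i, ∑ j, christoffel G y i a j • (cof j * hook i x) := by
  simp [conn, LinearMap.sum_apply]

lemma nabla_eq (ω : LocalForm n) : nabla G a ω y = pderiv a ω y - conn G a y (ω y) := by
  rw [conn_apply]
  rfl

lemma conn_linear (L : Form n →ₗ[ℝ] Form n)
    (hL : ∀ i j x, L (cof j * hook i x) = cof j * hook i (L x)) (x : Form n) :
    L (conn G a y x) = conn G a y (L x) := by
  simp_rw [conn_apply, map_sum, map_smul, hL]

lemma conn_mul (x z : Form n) : conn G a y (x * z) = conn G a y x * z + x * conn G a y z := by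
  simp_rw [conn_apply, Finset.sum_mul, Finset.mul_sum, ← Finset.sum_add_distrib]
  refine Finset.sum_congr rfl fun i _ => Finset.sum_congr rfl fun j _ => ?_
  rw [hook_eq, ctr_mul, mul_add, smul_add, smul_mul_assoc, mul_smul_comm, ← mul_assoc, ← mul_assoc,
    ← mul_assoc]
  congr 3
  exact (ι_mul_comm _ _).symm

lemma hook_conn (b : Fin n) (x : Form n) :
    hook b (conn G a y x) = conn G a y (hook b x) + ∑ i, christoffel G y i a b • hook i x := by
  simp_rw [conn_apply, map_sum, map_smul, hook_cof_mul, ← Finset.sum_add_distrib]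
  refine Finset.sum_congr rfl fun i _ => ?_
  simp_rw [smul_sub, Finset.sum_sub_distrib, hook_hook b i, mul_neg, smul_neg,
    Finset.sum_neg_distrib, sub_neg_eq_add]
  rw [add_comm]
  simp

lemma conn_cof_mul (b : Fin n) (x : Form n) :
    conn G a y (cof b * x) = cof b * conn G a y x + ∑ j, christoffel G y b a j • (cof j * x) := by
  have h : conn G a y (cof b) = ∑ j, christoffel G y b a j • cof j := by
    rw [conn_apply, Finset.sum_comm]
    simp [hook_cof]
  rw [conn_mul, h, add_comm, Finset.sum_mul]
  simp

lemma conn_one : conn G a y 1 = 0 := by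
  simp [conn_apply, hook_eq, CliffordAlgebra.contractLeft_one]

lemma conn_mem {p : ℕ} {x : Form n} (hx : x ∈ ⋀[ℝ]^p (Fin n → ℝ)) :
    conn G a y x ∈ ⋀[ℝ]^p (Fin n → ℝ) := by
  rw [conn_apply]
  refine Submodule.sum_mem _ fun i _ => Submodule.sum_mem _ fun j _ => Submodule.smul_mem _ _ ?_
  rcases p with _ | p
  · rw [hook_of_mem_zero _ hx, mul_zero]
    exact Submodule.zero_mem _
  · exact cof_mul_mem _ (hook_mem _ hx)

lemma pr_conn (d : ℕ) (x : Form n) : pr d (conn G a y x) = conn G a y (pr d x) := by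
  conv_lhs => rw [← sum_pr x]
  simp_rw [map_sum]
  have h : ∀ e, pr d (conn G a y (pr e x)) = if e = d then conn G a y (pr d x) else 0 := fun e => by
    split_ifs with he
    · subst he
      exact pr_of_mem (conn_mem G a y (pr_mem _ _))
    · exact pr_of_mem_ne (conn_mem G a y (pr_mem _ _)) he
  simp_rw [h]
  rw [Finset.sum_ite_eq']
  split_ifs with hd
  · rfl
  · rw [pr_eq_zero (by simpa using hd), map_zero]

end conn

/-- `degFun f` as a linear map. -/
def degFunL (f : ℕ → ℝ) : Form n →ₗ[ℝ] Form n := ∑ p ∈ Finset.range (n + 1), f p • pr p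

lemma degFunL_apply (f : ℕ → ℝ) (x : Form n) : degFun f x = degFunL f x := by
  simp [degFun, degFunL, LinearMap.sum_apply]

lemma conn_inv (G : LocalMetric n) (a : Fin n) (y : EuclideanSpace ℝ (Fin n)) (x : Form n) :
    inv (conn G a y x) = conn G a y (inv x) :=
  conn_linear G a y inv.toLinearMap (fun i j x => by
    change inv _ = cof j * hook i (inv x)
    rw [map_mul, inv_cof, inv_hook, neg_mul_neg]) x

lemma conn_degFun (G : LocalMetric n) (a : Fin n) (y : EuclideanSpace ℝ (Fin n)) (f : ℕ → ℝ)
    (x : Form n) : degFun f (conn G a y x) = conn G a y (degFun f x) := by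
  change ∑ p ∈ _, f p • pr p (conn G a y x) = conn G a y (∑ p ∈ _, f p • pr p x)
  simp_rw [map_sum, map_smul, pr_conn]

lemma SmoothOn.inv_iterate {ω : LocalForm n} {U : Set (EuclideanSpace ℝ (Fin n))}
    (hω : SmoothOn ω U) (k : ℕ) : SmoothOn (fun z => inv^[k] (ω z)) U := by
  induction k with
  | zero => exact hω
  | succ k ih =>
    simp_rw [Function.iterate_succ', Function.comp_apply]
    exact ih.linear inv.toLinearMap

namespace MetricOn

variable {G : LocalMetric n} {U : Set (EuclideanSpace ℝ (Fin n))} (hG : MetricOn G U)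
  {y : EuclideanSpace ℝ (Fin n)} {a : Fin n} {ω η : LocalForm n}

include hG

lemma nabla_congr (hy : y ∈ U) (h : ∀ z ∈ U, ω z = η z) : nabla G a ω y = nabla G a η y := by
  rw [nabla_eq, nabla_eq, h y hy, pderiv_congr]
  filter_upwards [hG.isOpen.mem_nhds hy] with z hz using h z hz

lemma diffAt (hω : SmoothOn ω U) (hy : y ∈ U) : DiffAt ω y := hω.diffAt hG.isOpen hy

lemma nabla_linear (L : Form n →ₗ[ℝ] Form n) (hL : ∀ x, L (conn G a y x) = conn G a y (L x))
    (hω : SmoothOn ω U) (hy : y ∈ U) : nabla G a (fun z => L (ω z)) y = L (nabla G a ω y) := by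
  rw [nabla_eq, nabla_eq, pderiv_linear L (hG.diffAt hω hy), map_sub, hL]

lemma nabla_inv (hω : SmoothOn ω U) (hy : y ∈ U) :
    nabla G a (fun z => inv (ω z)) y = inv (nabla G a ω y) :=
  hG.nabla_linear inv.toLinearMap (conn_inv G a y) hω hy

lemma nabla_degFun (f : ℕ → ℝ) (hω : SmoothOn ω U) (hy : y ∈ U) :
    nabla G a (fun z => degFun f (ω z)) y = degFun f (nabla G a ω y) := by
  simp_rw [degFunL_apply]
  exact hG.nabla_linear (degFunL f) (fun x => by
    simpa only [degFunL_apply] using conn_degFun G a y f x) hω hy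

lemma nabla_mem {p : ℕ} (hω : SmoothOn ω U) (hp : ∀ z ∈ U, ω z ∈ ⋀[ℝ]^p (Fin n → ℝ)) (hy : y ∈ U) :
    nabla G a ω y ∈ ⋀[ℝ]^p (Fin n → ℝ) := by
  have h := hG.nabla_linear (a := a) (pr p) (pr_conn G a y p) hω hy
  rw [hG.nabla_congr hy (η := ω) fun z hz => pr_of_mem (hp z hz)] at h
  rw [h]
  exact pr_mem _ _

lemma nabla_add (hω : SmoothOn ω U) (hη : SmoothOn η U) (hy : y ∈ U) :
    nabla G a (fun z => ω z + η z) y = nabla G a ω y + nabla G a η y := by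
  simp only [nabla_eq, pderiv_add (hG.diffAt hω hy) (hG.diffAt hη hy), map_add]
  abel

lemma nabla_smul {f : EuclideanSpace ℝ (Fin n) → ℝ} (hf : ContDiffOn ℝ (⊤ : ℕ∞) f U)
    (hω : SmoothOn ω U) (hy : y ∈ U) :
    nabla G a (fun z => f z • ω z) y = partialD a f y • ω y + f y • nabla G a ω y := by
  have hf' : DifferentiableAt ℝ f y :=
    (hf.contDiffAt (hG.isOpen.mem_nhds hy)).differentiableAt (by simp)
  simp only [nabla_eq, pderiv_smul hf' (hG.diffAt hω hy), map_smul, smul_sub]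
  abel

lemma nabla_const_smul (c : ℝ) (hω : SmoothOn ω U) (hy : y ∈ U) :
    nabla G a (fun z => c • ω z) y = c • nabla G a ω y := by
  rw [hG.nabla_smul contDiffOn_const hω hy, partialD_const, zero_smul, zero_add]

lemma nabla_sub (hω : SmoothOn ω U) (hη : SmoothOn η U) (hy : y ∈ U) :
    nabla G a (fun z => ω z - η z) y = nabla G a ω y - nabla G a η y := by
  have h := hG.nabla_add (a := a) hω hη.neg hy
  have h2 := hG.nabla_linear (a := a) (-LinearMap.id) (fun x => by simp) hη hy
  simp only [LinearMap.neg_apply, LinearMap.id_apply] at h2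
  simp only [sub_eq_add_neg]
  rw [h, h2]

lemma nabla_sum {ι : Type*} {s : Finset ι} {w : ι → LocalForm n} (hw : ∀ i ∈ s, SmoothOn (w i) U)
    (hy : y ∈ U) : nabla G a (fun z => ∑ i ∈ s, w i z) y = ∑ i ∈ s, nabla G a (w i) y := by
  simp only [nabla_eq, pderiv_sum fun i hi => hG.diffAt (hw i hi) hy, map_sum,
    Finset.sum_sub_distrib]

lemma smoothOn_hookUp (hω : SmoothOn ω U) (b : Fin n) :
    SmoothOn (fun z => hookUp (G z) b (ω z)) U :=
  SmoothOn.sum fun i _ => SmoothOn.smul (hG.contDiffOn_inv b i) (hω.linear _)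

lemma smoothOn_nabla (hω : SmoothOn ω U) (a : Fin n) : SmoothOn (nabla G a ω) U :=
  (hω.pderiv hG.isOpen a).sub (SmoothOn.sum fun i _ => SmoothOn.sum fun j _ =>
    SmoothOn.smul (hG.contDiffOn_christoffel i a j)
      (hω.linear (LinearMap.mulLeft ℝ (cof j) ∘ₗ hook i)))

lemma nabla_hook (hω : SmoothOn ω U) (hy : y ∈ U) (b : Fin n) :
    nabla G a (fun z => hook b (ω z)) y
      = hook b (nabla G a ω y) + ∑ i, christoffel G y i a b • hook i (ω y) := by
  rw [nabla_eq, nabla_eq, pderiv_linear (hook b) (hG.diffAt hω hy), map_sub, hook_conn]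
  abel

lemma nabla_cof_mul (hω : SmoothOn ω U) (hy : y ∈ U) (b : Fin n) :
    nabla G a (fun z => cof b * ω z) y
      = cof b * nabla G a ω y - ∑ j, christoffel G y b a j • (cof j * ω y) := by
  have h := pderiv_linear (a := a) (LinearMap.mulLeft ℝ (cof b)) (hG.diffAt hω hy)
  simp only [LinearMap.mulLeft_apply] at h
  rw [nabla_eq, nabla_eq, h, mul_sub, conn_cof_mul]
  abel

lemma nabla_mul (hω : SmoothOn ω U) (hη : SmoothOn η U) (hy : y ∈ U) :
    nabla G a (fun z => ω z * η z) y = nabla G a ω y * η y + ω y * nabla G a η y := by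
  have h := pderiv_bilinear (a := a) (LinearMap.mul ℝ (Form n)) (hG.diffAt hω hy) (hG.diffAt hη hy)
  simp only [LinearMap.mul_apply'] at h
  simp only [nabla_eq, h, conn_mul]
  noncomm_ring

lemma nabla_hookUp (hω : SmoothOn ω U) (hy : y ∈ U) (b : Fin n) :
    nabla G a (fun z => hookUp (G z) b (ω z)) y
      = hookUp (G y) b (nabla G a ω y) - ∑ i, christoffel G y b a i • hookUp (G y) i (ω y) := by
  have h := hG.nabla_sum (a := a) (s := Finset.univ)
    (fun d _ => SmoothOn.smul (hG.contDiffOn_inv b d) (hω.linear (hook d))) hy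
  have h2 : ∀ d, nabla G a (fun z => (G z)⁻¹ b d • hook d (ω z)) y
      = (-∑ i, christoffel G y b a i * (G y)⁻¹ i d - ∑ i, christoffel G y d a i * (G y)⁻¹ b i)
          • hook d (ω y)
        + (G y)⁻¹ b d • (hook d (nabla G a ω y) + ∑ i, christoffel G y i a d • hook i (ω y)) :=
    fun d => by
      rw [hG.nabla_smul (hG.contDiffOn_inv b d) (hω.linear (hook d)) hy, hG.nabla_hook hω hy,
        hG.partialD_inv hy]
  change nabla G a (fun z => ∑ d, (G z)⁻¹ b d • hook d (ω z)) y = _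
  rw [h]
  simp_rw [h2, hookUp, sub_smul, neg_smul, smul_add, Finset.sum_add_distrib,
    Finset.sum_sub_distrib, Finset.sum_neg_distrib, Finset.sum_smul, Finset.smul_sum, mul_smul]
  have h3 : ∑ x, ∑ i, (G y)⁻¹ b x • christoffel G y i a x • hook i (ω y)
      = ∑ x, ∑ i, christoffel G y x a i • (G y)⁻¹ b i • hook x (ω y) := by
    rw [Finset.sum_comm]
    exact Finset.sum_congr rfl fun x _ => Finset.sum_congr rfl fun i _ => smul_comm _ _ _
  rw [h3, Finset.sum_comm (f := fun x i => christoffel G y b a i • (G y)⁻¹ i x • hook x (ω y))]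
  abel

lemma smoothOn_cwL (k : ℕ) : ∀ {ω η : LocalForm n}, SmoothOn ω U → SmoothOn η U →
    SmoothOn (fun z => cwL (G z) k (ω z) (η z)) U := by
  induction k with
  | zero => exact fun hω hη => SmoothOn.bilinear (LinearMap.mul ℝ (Form n)) hω hη
  | succ k ih =>
    intro ω η hω hη
    simp_rw [cwL_succ]
    exact SmoothOn.sum fun a _ => ih (hω.linear _) (hG.smoothOn_hookUp hη a)

/-- The Levi-Civita connection is a derivation of the contracted wedge products. -/
lemma nabla_cwL (hy : y ∈ U) (k : ℕ) : ∀ {ω η : LocalForm n}, SmoothOn ω U → SmoothOn η U →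
    nabla G a (fun z => cwL (G z) k (ω z) (η z)) y
      = cwL (G y) k (nabla G a ω y) (η y) + cwL (G y) k (ω y) (nabla G a η y) := by
  induction k with
  | zero => exact fun hω hη => hG.nabla_mul hω hη hy
  | succ k ih =>
    intro ω η hω hη
    simp_rw [cwL_succ]
    rw [hG.nabla_sum (fun i _ => hG.smoothOn_cwL k (hω.linear (hook i)) (hG.smoothOn_hookUp hη i)) hy]
    simp_rw [ih (hω.linear (hook _)) (hG.smoothOn_hookUp hη _), hG.nabla_hook hω hy,
      hG.nabla_hookUp hη hy, map_add, map_sub, map_sum, map_smul, LinearMap.add_apply,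
      LinearMap.sum_apply, LinearMap.smul_apply, Finset.sum_add_distrib, Finset.sum_sub_distrib]
    rw [Finset.sum_comm (f := fun x i => christoffel G y i a x •
      cwL (G y) k (hook i (ω y)) (hookUp (G y) x (η y)))]
    abel

lemma nabla_inv_iterate (hω : SmoothOn ω U) (hy : y ∈ U) (k : ℕ) :
    nabla G a (fun z => inv^[k] (ω z)) y = inv^[k] (nabla G a ω y) := by
  induction k with
  | zero => rfl
  | succ k ih =>
    simp_rw [Function.iterate_succ', Function.comp_apply]
    rw [hG.nabla_inv (hω.inv_iterate k) hy, ih]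

lemma smoothOn_cliff (hω : SmoothOn ω U) (hη : SmoothOn η U) :
    SmoothOn (fun z => cliff (G z) (ω z) (η z)) U := by
  refine SmoothOn.congr (ω := fun z => ∑ k ∈ Finset.range (n + 2),
    clc k • cwL (G z) k (inv^[k] (ω z)) (η z)) ?_ fun z hz => cliff_eq_sum _ (hG.symm z hz) _ _
  exact SmoothOn.sum fun k _ => SmoothOn.smul contDiffOn_const
    (hG.smoothOn_cwL k (hω.inv_iterate k) hη)

/-- The Levi-Civita connection is a derivation of the Clifford product. -/
lemma nabla_cliff (hω : SmoothOn ω U) (hη : SmoothOn η U) (hy : y ∈ U) :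
    nabla G a (fun z => cliff (G z) (ω z) (η z)) y
      = cliff (G y) (nabla G a ω y) (η y) + cliff (G y) (ω y) (nabla G a η y) := by
  rw [hG.nabla_congr hy fun z hz => cliff_eq_sum _ (hG.symm z hz) (ω z) (η z),
    cliff_eq_sum _ (hG.symm y hy), cliff_eq_sum _ (hG.symm y hy), ← Finset.sum_add_distrib,
    hG.nabla_sum (fun k _ => SmoothOn.smul contDiffOn_const
      (hG.smoothOn_cwL k (hω.inv_iterate k) hη)) hy]
  refine Finset.sum_congr rfl fun k _ => ?_
  rw [hG.nabla_const_smul _ (hG.smoothOn_cwL k (hω.inv_iterate k) hη) hy,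
    hG.nabla_cwL hy k (hω.inv_iterate k) hη, hG.nabla_inv_iterate hω hy, smul_add]

lemma smoothOn_comm (hω : SmoothOn ω U) (hη : SmoothOn η U) :
    SmoothOn (fun z => comm (G z) (ω z) (η z)) U :=
  (hG.smoothOn_cliff hω hη).sub (hG.smoothOn_cliff hη hω)

lemma nabla_comm (hω : SmoothOn ω U) (hη : SmoothOn η U) (hy : y ∈ U) :
    nabla G a (fun z => comm (G z) (ω z) (η z)) y
      = comm (G y) (nabla G a ω y) (η y) + comm (G y) (ω y) (nabla G a η y) := by
  have h := hG.nabla_sub (a := a) (hG.smoothOn_cliff hω hη) (hG.smoothOn_cliff hη hω) hy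
  rw [hG.nabla_cliff hω hη hy, hG.nabla_cliff hη hω hy] at h
  refine h.trans ?_
  simp only [comm]
  abel

lemma smoothOn_extd (hω : SmoothOn ω U) : SmoothOn (extd G ω) U :=
  SmoothOn.sum fun a _ => (hG.smoothOn_nabla hω a).linear (LinearMap.mulLeft ℝ (cof a))

lemma smoothOn_codiff (hω : SmoothOn ω U) : SmoothOn (codiff G ω) U :=
  (SmoothOn.sum fun a _ => hG.smoothOn_hookUp (hG.smoothOn_nabla hω a) a).neg

lemma smoothOn_tildeK (hω : SmoothOn ω U) : SmoothOn (tildeK G ω) U :=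
  ((hG.smoothOn_extd hω).linear (degFunL fun p => ((p : ℝ) - 1) / (2 * p))).congr fun _ _ =>
    degFunL_apply _ _

lemma smoothOn_tildeM (hω : SmoothOn ω U) : SmoothOn (tildeM G ω) U :=
  (((hG.smoothOn_codiff hω).linear
    (degFunL fun p => ((n : ℝ) - p - 1) / (2 * ((n : ℝ) - p)))).neg).congr fun _ _ => by
      rw [← degFunL_apply]
      rfl

end MetricOn

/-! ### Commutators of first-order operators -/

/-- The first-order operator `A^a ∇_a + A'`, its coefficients acting by left Clifford
multiplication. -/
def firstOrderOp (G : LocalMetric n) (A : Fin n → LocalForm n) (A' ψ : LocalForm n) :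
    LocalForm n := fun y =>
  ∑ a, cliff (G y) (A a y) (nabla G a ψ y) + cliff (G y) (A' y) (ψ y)

lemma partialD_coord (a i : Fin n) (c : ℝ) (y : EuclideanSpace ℝ (Fin n)) :
    partialD a (fun z : EuclideanSpace ℝ (Fin n) => z i - c) y = if a = i then 1 else 0 := by
  have h : HasFDerivAt (fun z : EuclideanSpace ℝ (Fin n) => z i - c)
      (EuclideanSpace.proj i : EuclideanSpace ℝ (Fin n) →L[ℝ] ℝ) y :=
    (EuclideanSpace.proj i : EuclideanSpace ℝ (Fin n) →L[ℝ] ℝ).hasFDerivAt.sub_const c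
  rw [partialD, h.fderiv]
  simp [eq_comm]

lemma contDiffOn_coord (i : Fin n) (c : ℝ) (U : Set (EuclideanSpace ℝ (Fin n))) :
    ContDiffOn ℝ (⊤ : ℕ∞) (fun z : EuclideanSpace ℝ (Fin n) => z i - c) U :=
  ((EuclideanSpace.proj i : EuclideanSpace ℝ (Fin n) →L[ℝ] ℝ).contDiff.sub
    contDiff_const).contDiffOn

namespace MetricOn

variable {G : LocalMetric n} {U : Set (EuclideanSpace ℝ (Fin n))} (hG : MetricOn G U)
  {y : EuclideanSpace ℝ (Fin n)} {A B C : Fin n → LocalForm n} {A' B' C' : LocalForm n}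
  {f : EuclideanSpace ℝ (Fin n) → ℝ}

include hG

lemma firstOrderOp_smul_one (hf : ContDiffOn ℝ (⊤ : ℕ∞) f U) (hy : y ∈ U) :
    firstOrderOp G A A' (fun z => f z • 1) y = ∑ a, partialD a f y • A a y + f y • A' y := by
  have h : ∀ a, nabla G a (fun z => f z • (1 : Form n)) y = partialD a f y • 1 := fun a => by
    rw [hG.nabla_smul hf (smoothOn_const 1) hy, nabla_eq, pderiv_const, conn_one, sub_zero,
      smul_zero, add_zero]
  simp only [firstOrderOp, h, cliffL_apply, map_smul]
  simp only [← cliffL_apply, cliff_one_right]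

/-- The composition of two first-order operators, applied to a multiple of the unit. -/
lemma firstOrderOp_firstOrderOp (hB : ∀ a, SmoothOn (B a) U) (hB' : SmoothOn B' U)
    (hf : ContDiffOn ℝ (⊤ : ℕ∞) f U) (hy : y ∈ U) (hfy : f y = 0) :
    firstOrderOp G A A' (firstOrderOp G B B' (fun z => f z • 1)) y
      = ∑ a, ∑ b, partialD a (partialD b f) y • cliff (G y) (A a y) (B b y)
        + ∑ b, partialD b f y • (∑ a, cliff (G y) (A a y) (nabla G a (B b) y)
            + cliff (G y) (A b y) (B' y) + cliff (G y) (A' y) (B b y)) := by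
  have hp : ∀ b, ContDiffOn ℝ (⊤ : ℕ∞) (partialD b f) U := contDiffOn_partialD hf hG.isOpen
  have h : ∀ a, nabla G a (firstOrderOp G B B' (fun z => f z • 1)) y
      = ∑ b, (partialD a (partialD b f) y • B b y + partialD b f y • nabla G a (B b) y)
        + partialD a f y • B' y := fun a => by
    rw [hG.nabla_congr hy fun z hz => hG.firstOrderOp_smul_one hf hz,
      hG.nabla_add (SmoothOn.sum fun b _ => SmoothOn.smul (hp b) (hB b)) (SmoothOn.smul hf hB') hy,
      hG.nabla_sum (fun b _ => SmoothOn.smul (hp b) (hB b)) hy, hG.nabla_smul hf hB' hy, hfy,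
      zero_smul, add_zero]
    congr 1
    exact Finset.sum_congr rfl fun b _ => hG.nabla_smul (hp b) (hB b) hy
  rw [firstOrderOp, hG.firstOrderOp_smul_one hf hy, hfy, zero_smul, add_zero]
  simp only [h, cliffL_apply, map_add, map_sum, map_smul, Finset.sum_add_distrib, smul_add,
    Finset.smul_sum]
  rw [Finset.sum_comm (f := fun x i => partialD i f y • cliffL (G y) (A x y) (nabla G x (B i) y))]
  abel

/-- If the commutator of two first-order operators is a first-order operator, its first-order
coefficient is the curly bracket, and the second-order part of the commutator vanishes. -/
theorem coeff_of_commutator (hA : ∀ a, SmoothOn (A a) U) (hA' : SmoothOn A' U)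
    (hB : ∀ a, SmoothOn (B a) U) (hB' : SmoothOn B' U) {dA dB : Fin n → Fin n → Form n}
    (hy : y ∈ U)
    (hdA : ∀ a b, nabla G a (A b) y = dA a b - ∑ d, christoffel G y b a d • A d y)
    (hdB : ∀ a b, nabla G a (B b) y = dB a b - ∑ d, christoffel G y b a d • B d y)
    (h : ∀ ψ, SmoothOn ψ U → firstOrderOp G A A' (firstOrderOp G B B' ψ) y
      - firstOrderOp G B B' (firstOrderOp G A A' ψ) y = firstOrderOp G C C' ψ y) :
    (∀ i j, comm (G y) (A i y) (B j y) + comm (G y) (A j y) (B i y) = 0) ∧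
      ∀ i, curly (G y) (fun a => A a y) dA (A' y) (fun a => B a y) dB (B' y) i = C i y := by
  have key : ∀ f : EuclideanSpace ℝ (Fin n) → ℝ, ContDiffOn ℝ (⊤ : ℕ∞) f U → f y = 0 →
      ∑ a, ∑ b, partialD a (partialD b f) y • cliff (G y) (A a y) (B b y)
        + ∑ b, partialD b f y • (∑ a, cliff (G y) (A a y) (nabla G a (B b) y)
            + cliff (G y) (A b y) (B' y) + cliff (G y) (A' y) (B b y))
        - (∑ a, ∑ b, partialD a (partialD b f) y • cliff (G y) (B a y) (A b y)
          + ∑ b, partialD b f y • (∑ a, cliff (G y) (B a y) (nabla G a (A b) y)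
            + cliff (G y) (B b y) (A' y) + cliff (G y) (B' y) (A b y)))
      = ∑ b, partialD b f y • C b y := fun f hf hfy => by
    have h1 := h (fun z => f z • 1) (SmoothOn.smul hf (smoothOn_const 1))
    rw [hG.firstOrderOp_firstOrderOp hB hB' hf hy hfy,
      hG.firstOrderOp_firstOrderOp hA hA' hf hy hfy, hG.firstOrderOp_smul_one hf hy, hfy,
      zero_smul, add_zero] at h1
    exact h1
  -- only second derivatives of `(z_i - y_i) (z_j - y_j)` survive at `y`
  have h2 : ∀ i j, comm (G y) (A i y) (B j y) + comm (G y) (A j y) (B i y) = 0 := fun i j => by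
    have hd : ∀ b, partialD b (fun z => (z i - y i) * (z j - y j))
        = fun z => (if b = i then 1 else 0) * (z j - y j) + (z i - y i) * if b = j then 1 else 0 :=
      fun b => by
        funext z
        rw [partialD_mul ((contDiffOn_coord i _ Set.univ).contDiffAt Filter.univ_mem
          |>.differentiableAt (by simp)) ((contDiffOn_coord j _ Set.univ).contDiffAt
          Filter.univ_mem |>.differentiableAt (by simp)), partialD_coord, partialD_coord]
    have hdd : ∀ a b, partialD a (partialD b fun z => (z i - y i) * (z j - y j)) y
        = (if b = i then 1 else 0) * (if a = j then 1 else 0)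
          + (if a = i then 1 else 0) * if b = j then 1 else 0 := fun a b => by
      have hc : ∀ i, DifferentiableAt ℝ (fun z : EuclideanSpace ℝ (Fin n) => z i - y i) y := fun i =>
        ((contDiffOn_coord i _ Set.univ).contDiffAt Filter.univ_mem).differentiableAt (by simp)
      have hs : ∀ f g : EuclideanSpace ℝ (Fin n) → ℝ, DifferentiableAt ℝ f y →
          DifferentiableAt ℝ g y →
          partialD a (fun z => f z + g z) y = partialD a f y + partialD a g y := fun f g hf hg => by
        rw [partialD, fderiv_fun_add hf hg]
        rfl
      rw [hd, hs _ _ ((hc j).const_mul _) ((hc i).mul_const _),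
        partialD_mul (differentiableAt_const _) (hc j), partialD_mul (hc i)
        (differentiableAt_const _), partialD_coord, partialD_coord, partialD_const, partialD_const]
      ring
    have h1 := key (fun z => (z i - y i) * (z j - y j))
      ((contDiffOn_coord i _ U).mul (contDiffOn_coord j _ U)) (by simp)
    simp only [hdd] at h1
    simp only [hd, sub_self, mul_zero, zero_mul, add_zero, zero_smul, Finset.sum_const_zero,
      add_smul, Finset.sum_add_distrib, ite_mul, one_mul, ite_smul, one_smul,
      Finset.sum_ite_eq', Finset.mem_univ, if_true] at h1
    simp only [comm]
    rw [← h1]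
    simp
    abel
  refine ⟨h2, fun i => ?_⟩
  -- only first derivatives of `z_i - y_i` survive at `y`
  have hd : ∀ b, partialD b (fun z : EuclideanSpace ℝ (Fin n) => z i - y i)
      = fun _ => if b = i then 1 else 0 := fun b => funext fun z => partialD_coord b i _ z
  have h1 := key (fun z => z i - y i) (contDiffOn_coord i _ U) (sub_self _)
  simp only [hd, partialD_const, zero_smul, Finset.sum_const_zero, zero_add, ite_smul, one_smul,
    Finset.sum_ite_eq', Finset.mem_univ, if_true, hdA, hdB] at h1
  -- the Christoffel symbols are symmetric, the second-order coefficient is antisymmetric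
  have h3 : ∑ a, ∑ d, christoffel G y i a d • comm (G y) (A a y) (B d y) = 0 := by
    have h4 : ∑ a, ∑ d, christoffel G y i a d • comm (G y) (A a y) (B d y)
        = -∑ a, ∑ d, christoffel G y i a d • comm (G y) (A a y) (B d y) := by
      conv_lhs => rw [Finset.sum_comm]
      simp_rw [← Finset.sum_neg_distrib, ← smul_neg]
      refine Finset.sum_congr rfl fun a _ => Finset.sum_congr rfl fun d _ => ?_
      rw [hG.christoffel_symm hy i d a, eq_neg_of_add_eq_zero_left (h2 d a)]
    rw [eq_neg_iff_add_eq_zero, ← two_smul ℝ] at h4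
    exact (smul_eq_zero.mp h4).resolve_left two_ne_zero
  have h5 : ∀ A B : Fin n → Form n, ∑ a, cliff (G y) (A a) (∑ d, christoffel G y i a d • B d)
      = ∑ a, ∑ d, christoffel G y i a d • cliff (G y) (A a) (B d) := fun A B => by
    refine Finset.sum_congr rfl fun a _ => ?_
    simp only [cliffL_apply, map_sum, map_smul]
  have h6 : ∑ a, ∑ d, christoffel G y i a d • cliff (G y) (B a y) (A d y)
      = ∑ a, ∑ d, christoffel G y i a d • cliff (G y) (B d y) (A a y) := by
    rw [Finset.sum_comm]
    refine Finset.sum_congr rfl fun a _ => Finset.sum_congr rfl fun d _ => ?_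
    rw [hG.christoffel_symm hy i d a]
  have h7 : ∀ x z w : Form n, cliff (G y) x (z - w) = cliff (G y) x z - cliff (G y) x w :=
    fun x z w => map_sub (cliffL (G y) x) z w
  simp only [h7, Finset.sum_sub_distrib] at h1
  rw [h5 (fun a => A a y) fun d => B d y, h5 (fun a => B a y) fun d => A d y, h6] at h1
  simp only [comm, smul_sub, Finset.sum_sub_distrib] at h3
  rw [← h1, ← sub_eq_zero, ← h3, curly, Finset.sum_sub_distrib, comm, comm]
  abel

end MetricOn

/-! ### Killing-Yano operators on a coordinate domain -/

/-- The operators of odd KY forms and even CCKY forms on a coordinate domain in a common form: the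
first-order operator `A^a ∇_a + A'` given at each point by `OperatorData`, where `∇_a κ = ½[e_a, k]`
in the Clifford algebra. -/
structure OperatorOn {G : LocalMetric n} {U : Set (EuclideanSpace ℝ (Fin n))} (hG : MetricOn G U)
    (p ε : ℝ) (κ k : LocalForm n) (A : Fin n → LocalForm n)
    (dA : EuclideanSpace ℝ (Fin n) → Fin n → Fin n → Form n) (A' : LocalForm n)
    (low : EuclideanSpace ℝ (Fin n) → Fin n → Form n) : Prop where
  smooth_form : SmoothOn κ U
  smooth_coeff : ∀ a, SmoothOn (A a) U
  smooth_tilde : SmoothOn A' U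
  data : ∀ y (hy : y ∈ U), OperatorData (hG.symm y hy) (hG.mul_inv y hy) p ε (κ y) (k y)
    (fun a => A a y) (dA y) (A' y) (low y)
  nabla_form : ∀ y (hy : y ∈ U) a, (toForm (G y)).symm (nabla G a κ y)
    = (frame (hG.symm y hy) (hG.mul_inv y hy)).der ((toForm (G y)).symm (k y)) a
  nabla_coeff : ∀ y ∈ U, ∀ a b,
    nabla G a (A b) y = dA y a b - ∑ d, christoffel G y b a d • A d y
  low_eq : ∀ y ∈ U, ∀ a, low y a = ∑ b, G y a b • A b y
  parity_form : ∀ y ∈ U, inv (κ y) = -(ε • κ y)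
  parity_der : ∀ y ∈ U, inv (k y) = ε • k y

/-- A Killing-Yano form of degree `p` on a coordinate domain. -/
structure KYOn (G : LocalMetric n) (U : Set (EuclideanSpace ℝ (Fin n))) (p : ℕ) (κ : LocalForm n) :
    Prop where
  smooth : SmoothOn κ U
  mem : ∀ z ∈ U, κ z ∈ ⋀[ℝ]^p (Fin n → ℝ)
  twistor_eq : ∀ z ∈ U, ∀ a, twistor G a κ z = 0
  codiff_eq : ∀ z ∈ U, codiff G κ z = 0

/-- A closed conformal Killing-Yano form of degree `c` on a coordinate domain. -/
structure CCKYOn (G : LocalMetric n) (U : Set (EuclideanSpace ℝ (Fin n))) (c : ℕ)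
    (ω : LocalForm n) : Prop where
  smooth : SmoothOn ω U
  mem : ∀ z ∈ U, ω z ∈ ⋀[ℝ]^c (Fin n → ℝ)
  twistor_eq : ∀ z ∈ U, ∀ a, twistor G a ω z = 0
  extd_eq : ∀ z ∈ U, extd G ω z = 0

section Killing

variable {G : LocalMetric n} {U : Set (EuclideanSpace ℝ (Fin n))}
  {y : EuclideanSpace ℝ (Fin n)} {ω κ : LocalForm n} {p c : ℕ}

lemma extd_mem (hG : MetricOn G U) (hω : SmoothOn ω U) (hp : ∀ z ∈ U, ω z ∈ ⋀[ℝ]^p (Fin n → ℝ))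
    (hy : y ∈ U) : extd G ω y ∈ ⋀[ℝ]^(p + 1) (Fin n → ℝ) :=
  Submodule.sum_mem _ fun a _ => cof_mul_mem a (hG.nabla_mem hω hp hy)

lemma codiff_mem (hG : MetricOn G U) (hω : SmoothOn ω U) (hp : ∀ z ∈ U, ω z ∈ ⋀[ℝ]^p (Fin n → ℝ))
    (hy : y ∈ U) : codiff G ω y ∈ ⋀[ℝ]^(p - 1) (Fin n → ℝ) :=
  Submodule.neg_mem _ (Submodule.sum_mem _ fun a _ =>
    hookUp_mem _ a (hG.nabla_mem hω hp hy))

lemma codiff_eq_zero_of_mem_zero (hG : MetricOn G U) (hω : SmoothOn ω U)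
    (hp : ∀ z ∈ U, ω z ∈ ⋀[ℝ]^0 (Fin n → ℝ)) (hy : y ∈ U) : codiff G ω y = 0 := by
  rw [codiff, Finset.sum_eq_zero fun a _ => hookUp_of_mem_zero _ a (hG.nabla_mem hω hp hy),
    neg_zero]

lemma cofLow_mul_mem (G : Matrix (Fin n) (Fin n) ℝ) (a : Fin n) {x : Form n}
    (hx : x ∈ ⋀[ℝ]^p (Fin n → ℝ)) : cofLow G a * x ∈ ⋀[ℝ]^(p + 1) (Fin n → ℝ) := by
  rw [cofLow, Finset.sum_mul]
  refine Submodule.sum_mem _ fun b _ => ?_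
  rw [smul_mul_assoc]
  exact Submodule.smul_mem _ _ (cof_mul_mem b hx)

/-- The operator `K_κ` of an odd KY form `κ`, where `k = dκ/(p+1)`. -/
lemma operatorOn_KY (hG : MetricOn G U) (hp : Odd p) (hκ : KYOn G U p κ) :
    OperatorOn hG p 1 κ (fun y => (1 / ((p : ℝ) + 1)) • extd G κ y)
      (fun a y => hookUp (G y) a (κ y)) (fun y a b => hookUp (G y) b (nabla G a κ y)) (tildeK G κ)
      (fun y a => hook a (κ y)) := by
  obtain ⟨hκ, hm, ht, hδ⟩ := hκ
  have hk : ∀ y ∈ U, (1 / ((p : ℝ) + 1)) • extd G κ y ∈ ⋀[ℝ]^(p + 1) (Fin n → ℝ) := fun y hy =>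
    Submodule.smul_mem _ _ (extd_mem hG hκ hm hy)
  have hn : ∀ y ∈ U, ∀ a, nabla G a κ y = hook a ((1 / ((p : ℝ) + 1)) • extd G κ y) :=
    fun y hy a => by
      have h := ht y hy a
      rw [twistor, hδ y hy, mul_zero, degFun_of_mem _ (hook_mem a (extd_mem hG hκ hm hy)),
        degFun_of_mem _ (Submodule.zero_mem (⋀[ℝ]^0 (Fin n → ℝ))), smul_zero, add_zero,
        sub_eq_zero] at h
      rw [h, map_smul]
      simp
  refine ⟨hκ, fun a => hG.smoothOn_hookUp hκ a, hG.smoothOn_tildeK hκ, fun y hy => ?_,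
    fun y hy a => ?_, fun y hy a b => hG.nabla_hookUp hκ hy b, fun y hy a =>
      (sum_mul_hookUp (hG.mul_inv y hy) a (κ y)).symm,
    fun y hy => by rw [one_smul, inv_odd hp (hm y hy)],
    fun y hy => by rw [one_smul, inv_even hp.add_one (hk y hy)]⟩
  · have h := operatorData_KY (hG.symm y hy) (hG.mul_inv y hy) hp (hm y hy) (hk y hy)
    have ht : tildeK G κ y = ((p : ℝ) / 2) • (1 / ((p : ℝ) + 1)) • extd G κ y := by
      rw [tildeK, degFun_of_mem _ (extd_mem hG hκ hm hy), smul_smul]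
      congr 1
      have : (p : ℝ) + 1 ≠ 0 := by positivity
      push_cast
      field_simp
      ring
    simp only [hn y hy]
    rw [ht]
    exact h
  · rw [hn y hy, hook_of_even (hG.symm y hy) (hG.mul_inv y hy) a (inv_even hp.add_one (hk y hy))]
    simp only [CliffordFrame.der, frame, ← map_smul, ← map_sub, toForm_symm_mul]

/-- The operator `M_ω` of an even CCKY form `ω`, where `w = -δω/(n-c+1)`. -/
lemma operatorOn_CCKY (hG : MetricOn G U) (hc : Even c) (hω : CCKYOn G U c ω) :
    OperatorOn hG (n - c) (-1) ω (fun y => (-(1 / ((n : ℝ) - c + 1))) • codiff G ω y)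
      (fun a y => cof a * ω y) (fun y a b => cof b * nabla G a ω y) (tildeM G ω)
      (fun y a => cofLow (G y) a * ω y) := by
  obtain ⟨hω, hm, ht, hd⟩ := hω
  have hw : ∀ y ∈ U, (-(1 / ((n : ℝ) - c + 1))) • codiff G ω y ∈ ⋀[ℝ]^(c - 1) (Fin n → ℝ) :=
    fun y hy => Submodule.smul_mem _ _ (codiff_mem hG hω hm hy)
  have hw' : ∀ y ∈ U, c = 0 → (-(1 / ((n : ℝ) - c + 1))) • codiff G ω y = 0 := fun y hy h => by
    rw [codiff_eq_zero_of_mem_zero hG hω (fun z hz => h ▸ hm z hz) hy, smul_zero]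
  have hw1 : ∀ y ∈ U, inv ((-(1 / ((n : ℝ) - c + 1))) • codiff G ω y)
      = -((-(1 / ((n : ℝ) - c + 1))) • codiff G ω y) := fun y hy => by
    rcases Nat.eq_zero_or_pos c with h | h
    · rw [hw' y hy h, map_zero, neg_zero]
    · exact inv_odd (Nat.Even.sub_odd h hc odd_one) (hw y hy)
  have hn : ∀ y ∈ U, ∀ a, nabla G a ω y
      = cofLow (G y) a * ((-(1 / ((n : ℝ) - c + 1))) • codiff G ω y) := fun y hy a => by
    have h := ht y hy a
    have h1 : cofLow (G y) a * codiff G ω y ∈ ⋀[ℝ]^c (Fin n → ℝ) := by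
      rcases Nat.eq_zero_or_pos c with h0 | h0
      · rw [codiff_eq_zero_of_mem_zero hG hω (fun z hz => h0 ▸ hm z hz) hy, mul_zero]
        exact Submodule.zero_mem _
      · have := cofLow_mul_mem (G y) a (codiff_mem hG hω hm hy)
        rwa [Nat.sub_add_cancel h0] at this
    rw [twistor, hd y hy, map_zero, degFun_of_mem _ h1,
      degFun_of_mem _ (Submodule.zero_mem (⋀[ℝ]^0 (Fin n → ℝ))), smul_zero, sub_zero] at h
    rw [eq_neg_of_add_eq_zero_left h, mul_smul_comm, neg_smul]
  refine ⟨hω, fun a => hω.linear (LinearMap.mulLeft ℝ (cof a)), hG.smoothOn_tildeM hω,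
    fun y hy => ?_, fun y hy a => ?_, fun y hy a b => hG.nabla_cof_mul hω hy b, fun y hy a => by
      simp [cofLow, Finset.sum_mul],
    fun y hy => by rw [inv_even hc (hm y hy), neg_one_smul, neg_neg],
    fun y hy => by rw [hw1 y hy, neg_one_smul]⟩
  · have h := operatorData_CCKY (hG.symm y hy) (hG.mul_inv y hy) hc (hm y hy) (hw y hy) (hw' y hy)
    have ht : tildeM G ω y
        = (((n : ℝ) - c) / 2) • (-(1 / ((n : ℝ) - c + 1))) • codiff G ω y := by
      rcases Nat.eq_zero_or_pos c with h0 | h0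
      · rw [hw' y hy h0, tildeM, codiff_eq_zero_of_mem_zero hG hω (fun z hz => h0 ▸ hm z hz) hy,
          degFun_of_mem _ (Submodule.zero_mem (⋀[ℝ]^0 (Fin n → ℝ)))]
        simp
      · rw [tildeM, degFun_of_mem _ (codiff_mem hG hω hm hy), smul_smul, ← neg_smul,
          Nat.cast_sub h0]
        congr 1
        push_cast
        rw [show (n : ℝ) - (c - 1) - 1 = n - c by ring, show (n : ℝ) - (c - 1) = n - c + 1 by ring,
          mul_comm (2 : ℝ), ← div_div, neg_eq_iff_eq_neg]
        ring
    simp only [hn y hy]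
    rw [ht]
    exact h
  · rw [hn y hy, cofLow_mul_of_odd (hG.symm y hy) (hG.mul_inv y hy) a (hw1 y hy)]
    simp only [CliffordFrame.der, frame, ← map_smul, ← map_sub, toForm_symm_mul]

end Killing

section pair

variable {G : LocalMetric n} {U : Set (EuclideanSpace ℝ (Fin n))} {hG : MetricOn G U}
  {y : EuclideanSpace ℝ (Fin n)} {p q ε ε' : ℝ} {κ k lam l : LocalForm n}
  {A : Fin n → LocalForm n} {dA : EuclideanSpace ℝ (Fin n) → Fin n → Fin n → Form n}
  {A' : LocalForm n} {Al : EuclideanSpace ℝ (Fin n) → Fin n → Form n}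
  {B : Fin n → LocalForm n} {dB : EuclideanSpace ℝ (Fin n) → Fin n → Fin n → Form n}
  {B' : LocalForm n} {Bl : EuclideanSpace ℝ (Fin n) → Fin n → Form n}
  (hA : OperatorOn hG p ε κ k A dA A' Al) (hB : OperatorOn hG q ε' lam l B dB B' Bl)

include hA hB

/-- If the commutator of two operators is of first order, the necessary condition holds. -/
lemma necessary_of_commutator {C : Fin n → LocalForm n} {C' : LocalForm n} (hy : y ∈ U)
    (h : ∀ ψ, SmoothOn ψ U → firstOrderOp G A A' (firstOrderOp G B B' ψ) y
      - firstOrderOp G B B' (firstOrderOp G A A' ψ) y = firstOrderOp G C C' ψ y) :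
    ∑ a, comm (G y) (A a y) (Bl y a) = 0 ∧
      ∀ i, curly (G y) (fun a => A a y) (dA y) (A' y) (fun a => B a y) (dB y) (B' y) i = C i y := by
  obtain ⟨h1, h2⟩ := hG.coeff_of_commutator hA.smooth_coeff hA.smooth_tilde hB.smooth_coeff
    hB.smooth_tilde hy (hA.nabla_coeff y hy) (hB.nabla_coeff y hy) h
  refine ⟨eq_zero_of_eq_neg ?_, h2⟩
  have h3 : ∑ a, comm (G y) (A a y) (Bl y a)
      = ∑ a, ∑ b, G y a b • comm (G y) (A a y) (B b y) := by
    refine Finset.sum_congr rfl fun a _ => ?_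
    rw [hB.low_eq y hy]
    simp only [comm, cliffL_apply, map_sum, map_smul, LinearMap.sum_apply, LinearMap.smul_apply,
      smul_sub, Finset.sum_sub_distrib]
  rw [h3]
  conv_lhs => rw [Finset.sum_comm]
  simp_rw [← Finset.sum_neg_distrib, ← smul_neg]
  refine Finset.sum_congr rfl fun a _ => Finset.sum_congr rfl fun b _ => ?_
  rw [(hG.symm y hy).apply, eq_neg_of_add_eq_zero_left (h1 b a)]

lemma toForm_nabla_comm (hy : y ∈ U) (b : Fin n) :
    (toForm (G y)).symm (nabla G b (fun z => comm (G z) (κ z) (lam z)) y)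
      = (frame (hG.symm y hy) (hG.mul_inv y hy)).derComm ((toForm (G y)).symm (κ y))
        ((toForm (G y)).symm (k y)) ((toForm (G y)).symm (lam y)) ((toForm (G y)).symm (l y)) b := by
  rw [hG.nabla_comm hA.smooth_form hB.smooth_form hy]
  exact toForm_derComm (hA.nabla_form y hy b) (hB.nabla_form y hy b)

variable (hN : ∀ z ∈ U, ∑ a, comm (G z) (A a z) (Bl z a) = 0)

include hN

/-- The covariant derivatives of the Clifford commutator of the two forms lie in the same eigenspace
as the commutator. -/
lemma degFun_nabla_comm (hy : y ∈ U) (b : Fin n) :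
    degFun (sval n) (nabla G b (fun z => comm (G z) (κ z) (lam z)) y)
      = ((n : ℝ) - 2 * (p + q)) • nabla G b (fun z => comm (G z) (κ z) (lam z)) y := by
  have hs := hG.smoothOn_comm hA.smooth_form hB.smooth_form
  rw [← hG.nabla_degFun _ hs hy, ← hG.nabla_const_smul _ hs hy]
  exact hG.nabla_congr hy fun z hz =>
    degFun_comm_of_sum_comm_eq_zero (hA.data z hz) (hB.data z hz) (hN z hz)

omit hN in
lemma inv_comm_form (hy : y ∈ U) : inv (comm (G y) (κ y) (lam y))
    = (ε * ε') • comm (G y) (κ y) (lam y) := by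
  rw [inv_comm (hG.symm y hy), hA.parity_form y hy, hB.parity_form y hy]
  simp only [comm_eq, map_neg, map_smul, LinearMap.neg_apply, LinearMap.smul_apply, smul_smul,
    smul_sub, neg_neg, smul_neg, mul_comm ε' ε]

omit hN in
lemma inv_comm_der (hy : y ∈ U) :
    inv (comm (G y) (k y) (lam y) + comm (G y) (κ y) (l y))
      = -((ε * ε') • (comm (G y) (k y) (lam y) + comm (G y) (κ y) (l y))) := by
  rw [map_add, inv_comm (hG.symm y hy), inv_comm (hG.symm y hy), hA.parity_form y hy,
    hB.parity_form y hy, hA.parity_der y hy, hB.parity_der y hy]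
  simp only [comm_eq, map_neg, map_smul, LinearMap.neg_apply, LinearMap.smul_apply, smul_smul,
    smul_sub, smul_neg, smul_add, mul_comm ε' ε]
  abel

/-- The Clifford commutator of the two forms has no part of degree `d` unless `d` is the degree
singled out by the necessary condition. -/
lemma pr_comm_form_eq_zero (hy : y ∈ U) {d : ℕ} (hd : sval n d ≠ n - 2 * (p + q)) :
    pr d (comm (G y) (κ y) (lam y)) = 0 := by
  have h := congrArg (pr d)
    (degFun_comm_of_sum_comm_eq_zero (hA.data y hy) (hB.data y hy) (hN y hy))
  rw [pr_degFun, map_smul, ← sub_eq_zero, ← sub_smul] at h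
  exact (smul_eq_zero.mp h).resolve_left (sub_ne_zero.mpr hd)

/-- For coefficients of the same parity, the contracted first-order coefficient of the commutator has
parts of at most two degrees. -/
lemma pr_sum_cofLow_curly (hε : ε * ε' = 1) (hy : y ∈ U) :
    ∑ b, cofLow (G y) b *
      curly (G y) (fun a => A a y) (dA y) (A' y) (fun a => B a y) (dB y) (B' y) b
      = (p * q / 2) • (comm (G y) (k y) (lam y) + comm (G y) (κ y) (l y)) ∧
    ∀ d : ℕ, (Odd d → (d : ℝ) ≠ p + q + 1 ∧ (d : ℝ) ≠ p + q - 1) →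
      pr d (comm (G y) (k y) (lam y) + comm (G y) (κ y) (l y)) = 0 := by
  refine ⟨sum_cofLow_curly (hA.data y hy) (hB.data y hy) (toForm_nabla_comm hA hB hy)
    (degFun_nabla_comm hA hB hN hy) hε, fun d hd => ?_⟩
  rcases Nat.even_or_odd d with h | h
  · apply pr_eq_zero_of_inv_eq
    rw [inv_comm_der hA hB hy, hε, h.neg_one_pow]
  · obtain ⟨h1, h2⟩ := hd h
    refine pr_comm_eq_zero_of_sval (hA.data y hy) (hB.data y hy) (toForm_nabla_comm hA hB hy)
      (degFun_nabla_comm hA hB hN hy) ?_ ?_ <;> rw [sval_odd h] <;> intro h3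
    · exact h1 (by linarith)
    · exact h2 (by linarith)

/-- For coefficients of different parities, the contracted first-order coefficient of the commutator
has parts of at most two degrees. -/
lemma pr_sum_hook_curly (hε : ε * ε' = -1) (hy : y ∈ U) :
    ∑ b, hook b (curly (G y) (fun a => A a y) (dA y) (A' y) (fun a => B a y) (dB y) (B' y) b)
      = (p * q / 2) • (comm (G y) (k y) (lam y) + comm (G y) (κ y) (l y)) ∧
    ∀ d : ℕ, (Even d → (n : ℝ) - d ≠ p + q + 1 ∧ (n : ℝ) - d ≠ p + q - 1) →
      pr d (comm (G y) (k y) (lam y) + comm (G y) (κ y) (l y)) = 0 := by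
  refine ⟨sum_hook_curly (hA.data y hy) (hB.data y hy) (toForm_nabla_comm hA hB hy)
    (degFun_nabla_comm hA hB hN hy) hε, fun d hd => ?_⟩
  rcases Nat.even_or_odd d with h | h
  · obtain ⟨h1, h2⟩ := hd h
    refine pr_comm_eq_zero_of_sval (hA.data y hy) (hB.data y hy) (toForm_nabla_comm hA hB hy)
      (degFun_nabla_comm hA hB hN hy) ?_ ?_ <;> rw [sval_even h] <;> intro h3
    · exact h1 (by linarith)
    · exact h2 (by linarith)
  · apply pr_eq_zero_of_inv_eq
    rw [inv_comm_der hA hB hy, hε, h.neg_one_pow]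

/-- If the part of degree `p + q + 1` is absent, the bracket is a multiple of the co-differential of
the Clifford commutator. -/
theorem degFun_sum_cofLow_curly (hε : ε * ε' = 1) (hy : y ∈ U)
    (hQ : ∀ d : ℕ, Odd d → (d : ℝ) = p + q + 1 →
      pr d (comm (G y) (k y) (lam y) + comm (G y) (κ y) (l y)) = 0) :
    degFun (fun d => 1 / (d : ℝ)) (∑ b, cofLow (G y) b *
      curly (G y) (fun a => A a y) (dA y) (A' y) (fun a => B a y) (dB y) (B' y) b)
      = (-(p * q / 2 / (p + q - 1))) •
        codiff G (fun z => comm (G z) (κ z) (lam z)) y := by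
  obtain ⟨h1, h2⟩ := pr_sum_cofLow_curly hA hB hN hε hy
  have hs := hG.smoothOn_comm hA.smooth_form hB.smooth_form
  have hY : ∀ b, inv (nabla G b (fun z => comm (G z) (κ z) (lam z)) y)
      = nabla G b (fun z => comm (G z) (κ z) (lam z)) y := fun b => by
    rw [← hG.nabla_inv hs hy]
    exact hG.nabla_congr hy fun z hz => by rw [inv_comm_form hA hB hz, hε, one_smul]
  have h3 := sum_comm_cof_dY (hA.data y hy) (hB.data y hy) (toForm_nabla_comm hA hB hy)
  rw [h1, codiff]
  simp_rw [fun b => hookUp_of_even (hG.symm y hy) b (hY b)]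
  rw [← Finset.smul_sum, h3]
  refine pr_ext fun d => ?_
  simp only [pr_degFun, map_smul, map_neg, map_sub]
  by_cases hd : Odd d ∧ (d : ℝ) = p + q - 1
  · have hc : (2 * (p + q) + 2 - n : ℝ) - sval n d = 4 := by
      rw [sval_odd hd.1, hd.2]; ring
    rw [← sub_smul, hc, smul_smul, ← smul_neg, ← neg_smul, ← hd.2]
    simp only [smul_smul]
    congr 1
    ring
  · have h0 : pr d (comm (G y) (k y) (lam y) + comm (G y) (κ y) (l y)) = 0 := by
      by_cases hd1 : Odd d ∧ (d : ℝ) = p + q + 1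
      · exact hQ d hd1.1 hd1.2
      · exact h2 d fun ho => ⟨fun h => hd1 ⟨ho, h⟩, fun h => hd ⟨ho, h⟩⟩
    simp only [h0, smul_zero, sub_zero, neg_zero]

/-- If the part of degree `n - (p + q + 1)` is absent, the bracket is a multiple of the exterior
derivative of the Clifford commutator. For `p + q = 1` both coefficients are `1 / 0 = 0`. -/
theorem degFun_sum_hook_curly (hε : ε * ε' = -1) (hy : y ∈ U)
    (hQ : ∀ d : ℕ, Even d → (n : ℝ) - d = p + q + 1 →
      pr d (comm (G y) (k y) (lam y) + comm (G y) (κ y) (l y)) = 0) :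
    degFun (fun d => 1 / ((n : ℝ) - d)) (∑ b, hook b
      (curly (G y) (fun a => A a y) (dA y) (A' y) (fun a => B a y) (dB y) (B' y) b))
      = (p * q / 2 / (p + q - 1)) • extd G (fun z => comm (G z) (κ z) (lam z)) y := by
  obtain ⟨h1, h2⟩ := pr_sum_hook_curly hA hB hN hε hy
  have hs := hG.smoothOn_comm hA.smooth_form hB.smooth_form
  have hY : ∀ b, inv (nabla G b (fun z => comm (G z) (κ z) (lam z)) y)
      = -nabla G b (fun z => comm (G z) (κ z) (lam z)) y := fun b => by
    rw [← hG.nabla_inv hs hy, ← neg_one_smul ℝ (nabla G b _ y), ← hG.nabla_const_smul _ hs hy]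
    exact hG.nabla_congr hy fun z hz => by rw [inv_comm_form hA hB hz, hε]
  have h3 := sum_comm_cof_dY (hA.data y hy) (hB.data y hy) (toForm_nabla_comm hA hB hy)
  rw [h1, extd]
  simp_rw [fun b => cof_mul_of_odd (hG.symm y hy) b (hY b)]
  rw [← Finset.smul_sum, h3]
  refine pr_ext fun d => ?_
  simp only [pr_degFun, map_smul, map_sub]
  by_cases hd : Even d ∧ (n : ℝ) - d = p + q - 1
  · have hc : (2 * (p + q) + 2 - n : ℝ) - sval n d = 4 := by
      rw [sval_even hd.1]; linarith [hd.2]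
    rw [← sub_smul, hc, ← hd.2]
    simp only [smul_smul]
    congr 1
    ring
  · have h0 : pr d (comm (G y) (k y) (lam y) + comm (G y) (κ y) (l y)) = 0 := by
      by_cases hd1 : Even d ∧ (n : ℝ) - d = p + q + 1
      · exact hQ d hd1.1 hd1.2
      · exact h2 d fun ho => ⟨fun h => hd1 ⟨ho, h⟩, fun h => hd ⟨ho, h⟩⟩
    simp only [h0, smul_zero, sub_zero]

end pair

/-! ### The brackets on a coordinate domain -/

/-- The coefficients of the bracket formulas are coefficients of the Clifford product. -/
lemma clc_of_odd {k : ℕ} (hk : Odd k) :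
    (-1 : ℝ) ^ ((k - 1) / 2) / (k.factorial : ℝ) = -clc k := by
  obtain ⟨m, rfl⟩ := hk
  have h1 : (2 * m + 1 - 1) / 2 = m := by omega
  have h2 : (2 * m + 1) * (2 * m + 1 + 1) / 2 = (2 * m + 1) * (m + 1) := by
    rw [show (2 * m + 1) * (2 * m + 1 + 1) = (2 * m + 1) * (m + 1) * 2 by ring]
    exact Nat.mul_div_cancel _ two_pos
  rw [clc, h1, h2, pow_mul, Odd.neg_one_pow ⟨m, rfl⟩, pow_succ]
  ring

namespace MetricOn

variable {G : LocalMetric n} {U : Set (EuclideanSpace ℝ (Fin n))} (hG : MetricOn G U)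
  {y : EuclideanSpace ℝ (Fin n)} {ω η : LocalForm n}

include hG

lemma codiff_congr_smul (r : ℝ) (hη : SmoothOn η U) (hy : y ∈ U) (h : ∀ z ∈ U, ω z = r • η z) :
    codiff G ω y = r • codiff G η y := by
  have h1 : ∀ a, nabla G a ω y = r • nabla G a η y := fun a => by
    rw [hG.nabla_congr hy h, hG.nabla_const_smul r hη hy]
  simp only [codiff, h1, hookUp_smul, smul_neg, Finset.smul_sum]

lemma extd_congr_smul (r : ℝ) (hη : SmoothOn η U) (hy : y ∈ U) (h : ∀ z ∈ U, ω z = r • η z) :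
    extd G ω y = r • extd G η y := by
  have h1 : ∀ a, nabla G a ω y = r • nabla G a η y := fun a => by
    rw [hG.nabla_congr hy h, hG.nabla_const_smul r hη hy]
  simp only [extd, h1, mul_smul_comm, Finset.smul_sum]

end MetricOn

section local_brackets

variable {G : LocalMetric n} {U : Set (EuclideanSpace ℝ (Fin n))}
  {y : EuclideanSpace ℝ (Fin n)} {p q r a b c : ℕ} {κ lam μ ω α β ν : LocalForm n}

/-- Two odd KY forms satisfying the necessary condition: `[κ, λ] = 2 κ ∧ λ`. -/
theorem bracketKK_eq (hG : MetricOn G U) (hp : Odd p) (hq : Odd q) (hκ : KYOn G U p κ)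
    (hlam : KYOn G U q lam)
    (hN : ∀ z ∈ U, ∑ a, comm (G z) (hookUp (G z) a (κ z)) (hook a (lam z)) = 0) (hy : y ∈ U) :
    bracketKK G κ lam y
      = (-((p : ℝ) * q / (p + q - 1))) • codiff G (fun z => κ z * lam z) y := by
  have hA := operatorOn_KY hG hp hκ
  have hB := operatorOn_KY hG hq hlam
  have hY : ∀ z ∈ U, comm (G z) (κ z) (lam z) = (2 : ℝ) • (κ z * lam z) := fun z hz => by
    have h1 := pr_comm (G z) (hG.symm z hz) (show p + q + 2 * 0 = p + q by omega)
      (by simpa using hp.mul hq) (hκ.mem z hz) (hlam.mem z hz)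
    rw [clc_zero, mul_zero, pow_zero, mul_one, mul_one] at h1
    refine pr_ext fun d => ?_
    by_cases hd : d = p + q
    · rw [hd, h1, map_smul, pr_of_mem (wedge_mem (hκ.mem z hz) (hlam.mem z hz))]
      rfl
    · rw [map_smul, pr_of_mem_ne (wedge_mem (hκ.mem z hz) (hlam.mem z hz)) (Ne.symm hd), smul_zero]
      rcases Nat.even_or_odd d with he | ho
      · refine pr_comm_form_eq_zero hA hB hN hz ?_
        rw [sval_even he]
        intro h
        apply hd
        have : (d : ℝ) = p + q := by linarith
        exact_mod_cast this
      · apply pr_eq_zero_of_inv_eq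
        rw [inv_comm_form hA hB hz, ho.neg_one_pow]
        simp
  have h := degFun_sum_cofLow_curly hA hB hN (by norm_num) hy fun d hd hd1 => by
    have hd2 : d = p + q + 1 := by exact_mod_cast hd1
    have hk := Submodule.smul_mem _ (1 / ((p : ℝ) + 1)) (extd_mem hG hκ.smooth hκ.mem hy)
    have hl := Submodule.smul_mem _ (1 / ((q : ℝ) + 1)) (extd_mem hG hlam.smooth hlam.mem hy)
    rw [map_add, pr_comm_eq_zero (G y) (hG.symm y hy) (fun j hj => ?_) hk (hlam.mem y hy),
      pr_comm_eq_zero (G y) (hG.symm y hy) (fun j hj => ?_) (hκ.mem y hy) hl, add_zero]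
    · rw [show j = 0 by omega]
      exact hq.add_one.mul_left p
    · rw [show j = 0 by omega]
      exact hp.add_one.mul_right q
  refine h.trans ?_
  rw [hG.codiff_congr_smul 2 (SmoothOn.bilinear (LinearMap.mul ℝ (Form n)) hκ.smooth hlam.smooth)
    hy hY, smul_smul]
  simp only [LinearMap.mul_apply']
  congr 1
  ring

/-- An odd KY form and an even CCKY form satisfying the necessary condition: `[μ, ω]` is a multiple
of `μ ∧_r ω`. -/
theorem bracketKM_eq (hG : MetricOn G U) (hr : Odd r) (hc : Even c) (hμ : KYOn G U r μ)
    (hω : CCKYOn G U c ω)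
    (hN : ∀ z ∈ U, ∑ a, comm (G z) (hookUp (G z) a (μ z)) (cofLow (G z) a * ω z) = 0)
    (hy : y ∈ U) :
    bracketKM G μ ω y
      = ((r : ℝ) * (n - c) / (n + r - c - 1) * ((-1) ^ ((r - 1) / 2) / (r.factorial : ℝ))) •
            extd G (fun z => cwedge (G z) r (μ z) (ω z)) y := by
  have hA := operatorOn_KY hG hr hμ
  have hB := operatorOn_CCKY hG hc hω
  have hY : ∀ z ∈ U, comm (G z) (μ z) (ω z) = (-(2 * clc r)) • cwL (G z) r (μ z) (ω z) :=
    fun z hz => by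
      have h1 : ∀ d : ℕ, (d : ℝ) ≠ c - r → pr d (comm (G z) (μ z) (ω z)) = 0 := fun d hd => by
        rcases Nat.even_or_odd d with he | ho
        · apply pr_eq_zero_of_inv_eq
          rw [inv_comm_form hA hB hz, he.neg_one_pow]
          simp
        · refine pr_comm_form_eq_zero hA hB hN hz ?_
          rw [sval_odd ho]
          intro h
          exact hd (by linarith)
      refine pr_ext fun d => ?_
      rw [map_smul, pr_cwL (G z) d (hμ.mem z hz) (hω.mem z hz)]
      split_ifs with hd
      · rw [pr_comm (G z) (hG.symm z hz) hd ((hc.mul_left r).add_odd hr) (hμ.mem z hz)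
          (hω.mem z hz), (hr.mul hr).neg_one_pow]
        congr 1; ring
      · rw [smul_zero]
        refine h1 d fun h => hd ?_
        have : (d : ℝ) + r = c := by linarith
        have : d + r = c := by exact_mod_cast this
        omega
  have h := degFun_sum_hook_curly hA hB hN (by norm_num) hy fun d hd hd1 => by
    have hd3 : (d : ℝ) + r + 1 = c := by linarith
    have hd2 : d + r + 1 = c := by exact_mod_cast hd3
    have hk := Submodule.smul_mem _ (1 / ((r : ℝ) + 1)) (extd_mem hG hμ.smooth hμ.mem hy)
    have hl := Submodule.smul_mem _ (-(1 / ((n : ℝ) - c + 1))) (codiff_mem hG hω.smooth hω.mem hy)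
    rw [map_add, pr_comm_eq_zero (G y) (hG.symm y hy) (fun j hj => ?_) hk (hω.mem y hy),
      pr_comm_eq_zero (G y) (hG.symm y hy) (fun j hj => ?_) (hμ.mem y hy) hl, add_zero]
    · rw [show j = r by omega, show r * (c - 1) + r = r * (c - 1 + 1) by ring,
        Nat.sub_add_cancel (by omega)]
      exact hc.mul_left r
    · rw [show j = r + 1 by omega]
      exact (hc.mul_left _).add hr.add_one
  refine h.trans ?_
  simp_rw [cwedge_eq]
  rw [hG.extd_congr_smul _ (hG.smoothOn_cwL r hμ.smooth hω.smooth) hy hY, smul_smul, clc_of_odd hr]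
  congr 1
  rw [show (r : ℝ) + (n - c) - 1 = n + r - c - 1 by ring]
  ring

/-- A homogeneous part of `[δα, β]` or `[α, δβ]` coming from an even number of contractions
vanishes. -/
lemma pr_comm_CCKY_eq_zero (hG : MetricOn G U) (hα : CCKYOn G U a α) (hβ : CCKYOn G U b β)
    (ha : Even a) (hb : Even b) (s t : ℝ) (hy : y ∈ U) {d : ℕ}
    (hd : ∀ j, d + 2 * j + 1 = a + b → Even j) :
    pr d (comm (G y) (s • codiff G α y) (β y) + comm (G y) (α y) (t • codiff G β y)) = 0 := by
  have hk := Submodule.smul_mem _ s (codiff_mem hG hα.smooth hα.mem hy)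
  have hl := Submodule.smul_mem _ t (codiff_mem hG hβ.smooth hβ.mem hy)
  rw [map_add]
  have h1 : pr d (comm (G y) (s • codiff G α y) (β y)) = 0 := by
    rcases Nat.eq_zero_or_pos a with h0 | h0
    · rw [codiff_eq_zero_of_mem_zero hG hα.smooth (fun z hz => h0 ▸ hα.mem z hz) hy, smul_zero]
      simp [comm_eq]
    · exact pr_comm_eq_zero (G y) (hG.symm y hy)
        (fun j hj => (hb.mul_left _).add (hd j (by omega))) hk (hβ.mem y hy)
  have h2 : pr d (comm (G y) (α y) (t • codiff G β y)) = 0 := by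
    rcases Nat.eq_zero_or_pos b with h0 | h0
    · rw [codiff_eq_zero_of_mem_zero hG hβ.smooth (fun z hz => h0 ▸ hβ.mem z hz) hy, smul_zero]
      simp [comm_eq]
    · exact pr_comm_eq_zero (G y) (hG.symm y hy)
        (fun j hj => (ha.mul_right _).add (hd j (by omega))) (hα.mem y hy) hl
  rw [h1, h2, add_zero]

/-- A homogeneous part of `[δα, β] + [α, δβ]` coming from an odd number of contractions. -/
lemma pr_comm_CCKY (hG : MetricOn G U) (hα : CCKYOn G U a α) (hβ : CCKYOn G U b β)
    (ha : Even a) (hb : Even b) (s t : ℝ) (hy : y ∈ U) {d j : ℕ} (hj : Odd j)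
    (hd : d + 2 * j + 1 = a + b) :
    pr d (comm (G y) (s • codiff G α y) (β y) + comm (G y) (α y) (t • codiff G β y))
      = (2 * clc j) • (cwL (G y) j (α y) (t • codiff G β y)
        - cwL (G y) j (s • codiff G α y) (β y)) := by
  have hk := Submodule.smul_mem _ s (codiff_mem hG hα.smooth hα.mem hy)
  have hl := Submodule.smul_mem _ t (codiff_mem hG hβ.smooth hβ.mem hy)
  rw [map_add]
  have h1 : pr d (comm (G y) (s • codiff G α y) (β y))
      = -((2 * clc j) • cwL (G y) j (s • codiff G α y) (β y)) := by
    rcases Nat.eq_zero_or_pos a with h0 | h0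
    · rw [codiff_eq_zero_of_mem_zero hG hα.smooth (fun z hz => h0 ▸ hα.mem z hz) hy, smul_zero]
      simp [comm_eq]
    · have ho : Odd (a - 1) := Nat.Even.sub_odd h0 ha odd_one
      rw [pr_comm (G y) (hG.symm y hy) (show d + 2 * j = a - 1 + b by omega)
        ((hb.mul_left _).add_odd hj) hk (hβ.mem y hy), (ho.mul hj).neg_one_pow, ← neg_smul]
      congr 1; ring
  have h2 : pr d (comm (G y) (α y) (t • codiff G β y))
      = (2 * clc j) • cwL (G y) j (α y) (t • codiff G β y) := by
    rcases Nat.eq_zero_or_pos b with h0 | h0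
    · rw [codiff_eq_zero_of_mem_zero hG hβ.smooth (fun z hz => h0 ▸ hβ.mem z hz) hy, smul_zero]
      simp [comm_eq]
    · rw [pr_comm (G y) (hG.symm y hy) (show d + 2 * j = a + (b - 1) by omega)
        ((ha.mul_right _).add_odd hj) (hα.mem y hy) hl, (ha.mul_right j).neg_one_pow, mul_one]
  rw [h1, h2, smul_sub]
  abel

lemma pr_cwL_codiff_right (hG : MetricOn G U) (hα : CCKYOn G U a α) (hβ : CCKYOn G U b β) (t : ℝ)
    (hy : y ∈ U) {d j : ℕ} : pr d (cwL (G y) j (α y) (t • codiff G β y))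
      = if d + 2 * j + 1 = a + b then cwL (G y) j (α y) (t • codiff G β y) else 0 := by
  have hl := Submodule.smul_mem _ t (codiff_mem hG hβ.smooth hβ.mem hy)
  rcases Nat.eq_zero_or_pos b with h0 | h0
  · rw [codiff_eq_zero_of_mem_zero hG hβ.smooth (fun z hz => h0 ▸ hβ.mem z hz) hy]
    simp
  · rw [pr_cwL (G y) d (hα.mem y hy) hl]
    exact if_congr (by omega) rfl rfl

lemma pr_cwL_codiff_left (hG : MetricOn G U) (hα : CCKYOn G U a α) (hβ : CCKYOn G U b β) (s : ℝ)
    (hy : y ∈ U) {d j : ℕ} : pr d (cwL (G y) j (s • codiff G α y) (β y))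
      = if d + 2 * j + 1 = a + b then cwL (G y) j (s • codiff G α y) (β y) else 0 := by
  have hk := Submodule.smul_mem _ s (codiff_mem hG hα.smooth hα.mem hy)
  rcases Nat.eq_zero_or_pos a with h0 | h0
  · rw [codiff_eq_zero_of_mem_zero hG hα.smooth (fun z hz => h0 ▸ hα.mem z hz) hy]
    simp
  · rw [pr_cwL (G y) d hk (hβ.mem y hy)]
    exact if_congr (by omega) rfl rfl

variable (hG : MetricOn G U) (ha : Even a) (hb : Even b) (hα : CCKYOn G U a α)
  (hβ : CCKYOn G U b β)
  (hN : ∀ z ∈ U, ∑ i, comm (G z) (cof i * α z) (cofLow (G z) i * β z) = 0) (hy : y ∈ U)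

include hG ha hb hα hβ hN hy

/-- Two even CCKY forms satisfying the necessary condition, of total degree at most `n`. -/
theorem bracketMM_eq_zero (hab : a + b ≤ n) : bracketMM G α β y = 0 := by
  have hA := operatorOn_CCKY hG ha hα
  have hB := operatorOn_CCKY hG hb hβ
  obtain ⟨h1, h2⟩ := pr_sum_cofLow_curly hA hB hN (by norm_num) hy
  have hab' : (a : ℝ) + b ≤ n := by exact_mod_cast hab
  have hv : ∀ d : ℕ, (n : ℝ) - 1 ≤ d → ∀ s t : ℝ,
      pr d (comm (G y) (s • codiff G α y) (β y) + comm (G y) (α y) (t • codiff G β y)) = 0 :=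
    fun d hd s t => pr_comm_CCKY_eq_zero hG hα hβ ha hb s t hy fun j hj => by
      have : (n : ℝ) ≤ d + 1 := by linarith
      have : n ≤ d + 1 := by exact_mod_cast this
      rw [show j = 0 by omega]
      exact Even.zero
  refine (congrArg (degFun fun d => 1 / (d : ℝ)) h1).trans (pr_ext fun d => ?_)
  rw [pr_degFun, map_smul, map_zero]
  by_cases hd : (n : ℝ) - 1 ≤ d
  · rw [hv d hd, smul_zero, smul_zero]
  · rw [h2 d fun _ => ⟨fun h => hd (by linarith), fun h => hd (by linarith)⟩, smul_zero, smul_zero]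

/-- Two even CCKY forms satisfying the necessary condition, in odd dimension: `[α, β]` is a multiple
of `α ∧_{a+b-n} β`. -/
theorem bracketMM_eq_of_odd (hn : Odd n) (hab : n < a + b) : bracketMM G α β y
    = (((n : ℝ) - a) * (n - b) / (2 * n - a - b - 1) *
          ((-1) ^ ((a + b - n - 1) / 2) / ((a + b - n).factorial : ℝ))) •
        codiff G (fun z => cwedge (G z) (a + b - n) (α z) (β z)) y := by
  have hA := operatorOn_CCKY hG ha hα
  have hB := operatorOn_CCKY hG hb hβ
  have hk : Odd (a + b - n) := Nat.Even.sub_odd hab.le (ha.add hb) hn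
  have hY : ∀ z ∈ U, comm (G z) (α z) (β z)
      = (2 * clc (a + b - n)) • cwL (G z) (a + b - n) (α z) (β z) := fun z hz => by
    refine pr_ext fun d => ?_
    rw [map_smul, pr_cwL (G z) d (hα.mem z hz) (hβ.mem z hz)]
    split_ifs with hd
    · rw [pr_comm (G z) (hG.symm z hz) hd ((ha.mul_right b).add_odd hk) (hα.mem z hz)
        (hβ.mem z hz), (ha.mul_right _).neg_one_pow, mul_one]
    · rw [smul_zero]
      rcases Nat.even_or_odd d with he | ho
      · refine pr_comm_form_eq_zero hA hB hN hz ?_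
        rw [sval_even he]
        intro h
        apply hd
        have h3 : (d : ℝ) + a + b = 2 * n := by linarith
        have h4 : d + a + b = 2 * n := by exact_mod_cast h3
        omega
      · apply pr_eq_zero_of_inv_eq
        rw [inv_comm_form hA hB hz, ho.neg_one_pow]
        simp
  have h := degFun_sum_cofLow_curly hA hB hN (by norm_num) hy fun d hd hd1 => by
    have hd3 : (d : ℝ) + a + b = 2 * n + 1 := by linarith
    have hd2 : d + a + b = 2 * n + 1 := by exact_mod_cast hd3
    refine pr_comm_CCKY_eq_zero hG hα hβ ha hb _ _ hy fun j hj => ?_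
    obtain ⟨m, hm⟩ := hk
    exact ⟨m, by omega⟩
  refine h.trans ?_
  simp_rw [cwedge_eq]
  rw [hG.codiff_congr_smul _ (hG.smoothOn_cwL _ hα.smooth hβ.smooth) hy hY, smul_smul,
    clc_of_odd hk]
  congr 1
  rw [show (n : ℝ) - a + (n - b) - 1 = 2 * n - a - b - 1 by ring]
  ring

/-- Two even CCKY forms satisfying the necessary condition, in even dimension: only the part of
degree `2n - a - b + 1` of the bracket survives, which comes from the odd number `a + b - n - 1` of
contractions. -/
theorem bracketMM_eq_of_even (hn : Even n) (hab : n < a + b) : bracketMM G α β y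
    = (((n : ℝ) - a) * (n - b) / (2 * n - a - b + 1) *
          ((-1) ^ ((a + b - n - 2) / 2) / ((a + b - n - 1).factorial : ℝ))) •
        (cwedge (G y) (a + b - n - 1) (α y) ((1 / ((n : ℝ) - b + 1)) • codiff G β y)
          - cwedge (G y) (a + b - n - 1) ((1 / ((n : ℝ) - a + 1)) • codiff G α y) (β y)) := by
  have hA := operatorOn_CCKY hG ha hα
  have hB := operatorOn_CCKY hG hb hβ
  obtain ⟨h1, h2⟩ := pr_sum_cofLow_curly hA hB hN (by norm_num) hy
  have hk : Even (a + b - n) := (Nat.even_sub hab.le).mpr (by simp [hn, ha.add hb])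
  have hj : Odd (a + b - n - 1) := Nat.Even.sub_odd (by omega) hk odd_one
  have h0 : (a + b - n - 2) / 2 = (a + b - n - 1 - 1) / 2 := by omega
  refine (congrArg (degFun fun d => 1 / (d : ℝ)) h1).trans (pr_ext fun d => ?_)
  rw [pr_degFun, map_smul, h0, clc_of_odd hj, cwedge_eq, cwedge_eq, map_smul, map_sub,
    pr_cwL_codiff_right hG hα hβ _ hy, pr_cwL_codiff_left hG hα hβ _ hy]
  by_cases hd : d + 2 * (a + b - n - 1) + 1 = a + b
  · rw [if_pos hd, if_pos hd, pr_comm_CCKY hG hα hβ ha hb _ _ hy hj hd]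
    have h3 : d + a + b = 2 * n + 1 := by omega
    have h4 : (d : ℝ) + a + b = 2 * n + 1 := by exact_mod_cast h3
    rw [show (2 : ℝ) * n - a - b + 1 = d by linarith]
    simp only [map_smul, LinearMap.smul_apply]
    module
  · rw [if_neg hd, if_neg hd, sub_zero, smul_zero]
    by_cases h3 : d + a + b + 1 = 2 * n
    · rw [pr_comm_CCKY_eq_zero hG hα hβ ha hb _ _ hy fun j hj => ?_, smul_zero, smul_zero]
      rwa [show j = a + b - n by omega]
    · rw [h2 d fun _ => ⟨fun h => hd ?_, fun h => h3 ?_⟩, smul_zero, smul_zero]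
      · have h4 : (d : ℝ) + a + b = 2 * n + 1 := by linarith
        have h5 : d + a + b = 2 * n + 1 := by exact_mod_cast h4
        omega
      · have h4 : (d : ℝ) + a + b + 1 = 2 * n := by linarith
        exact_mod_cast h4

end local_brackets

/-! ### Recovering a form from its operator -/

lemma sum_cof_hook_eq_degFun (x : Form n) :
    ∑ a, cof a * hook a x = degFun (fun d => (d : ℝ)) x := by
  have h : ∀ y : Form n, ∑ a, cof a * hook a y
      = (∑ a, LinearMap.mulLeft ℝ (cof a) ∘ₗ hook a) y := fun y => by simp [LinearMap.sum_apply]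
  rw [h]
  conv_lhs => rw [← sum_pr x]
  rw [map_sum]
  refine Finset.sum_congr rfl fun d _ => ?_
  rw [← h, sum_cof_hook (pr_mem d x)]

lemma sum_hook_cof_eq_degFun (x : Form n) :
    ∑ a, hook a (cof a * x) = degFun (fun d => (n : ℝ) - d) x := by
  have h : ∀ y : Form n, ∑ a, hook a (cof a * y)
      = (∑ a, hook a ∘ₗ LinearMap.mulLeft ℝ (cof a)) y := fun y => by simp [LinearMap.sum_apply]
  rw [h]
  conv_lhs => rw [← sum_pr x]
  rw [map_sum]
  refine Finset.sum_congr rfl fun d _ => ?_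
  rw [← h, sum_hook_cof (pr_mem d x)]

lemma degFun_sum_cofLow_hookUp {G : Matrix (Fin n) (Fin n) ℝ} (hG : G.IsSymm) (hG' : G * G⁻¹ = 1)
    {x : Form n} (hx : pr 0 x = 0) :
    degFun (fun d => 1 / (d : ℝ)) (∑ b, cofLow G b * hookUp G b x) = x := by
  have h : ∑ b, cofLow G b * hookUp G b x = ∑ a, cof a * hook a x := by
    simp_rw [← sum_mul_hookUp hG', cofLow, Finset.sum_mul, Finset.mul_sum]
    rw [Finset.sum_comm]
    refine Finset.sum_congr rfl fun a _ => Finset.sum_congr rfl fun b _ => ?_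
    rw [smul_mul_assoc, mul_smul_comm, hG.apply]
  refine pr_ext fun d => ?_
  rw [h, sum_cof_hook_eq_degFun, pr_degFun, pr_degFun, smul_smul]
  rcases Nat.eq_zero_or_pos d with h0 | h0
  · rw [h0, hx, smul_zero]
  · rw [one_div_mul_cancel (by positivity), one_smul]

lemma degFun_sum_hook_cof {x : Form n} (hx : pr n x = 0) :
    degFun (fun d => 1 / ((n : ℝ) - d)) (∑ b, hook b (cof b * x)) = x := by
  refine pr_ext fun d => ?_
  rw [sum_hook_cof_eq_degFun, pr_degFun, pr_degFun, smul_smul]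
  by_cases h0 : d = n
  · rw [h0, hx, smul_zero]
  · rw [one_div_mul_cancel (sub_ne_zero.mpr (by exact_mod_cast Ne.symm h0)), one_smul]

section local_operators

variable {G : LocalMetric n} {U : Set (EuclideanSpace ℝ (Fin n))}
  {y : EuclideanSpace ℝ (Fin n)} {p q r a b c : ℕ} {κ lam μ ω α β ν : LocalForm n}

/-- If `[K_κ, K_λ] = K_ν`, the necessary condition holds and `ν` is the bracket of `κ` and `λ`. -/
theorem necessary_and_bracketKK_eq (hG : MetricOn G U) (hp : Odd p) (hq : Odd q)
    (hκ : KYOn G U p κ) (hlam : KYOn G U q lam)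
    (h : ∀ ψ, SmoothOn ψ U → ∀ y ∈ U,
      opK G κ (opK G lam ψ) y - opK G lam (opK G κ ψ) y = opK G ν ψ y)
    (hν : ∀ z, pr 0 (ν z) = 0) (hy : y ∈ U) :
    ∑ a, comm (G y) (hookUp (G y) a (κ y)) (hook a (lam y)) = 0 ∧ bracketKK G κ lam y = ν y := by
  obtain ⟨h1, h2⟩ := necessary_of_commutator (operatorOn_KY hG hp hκ) (operatorOn_KY hG hq hlam)
    (C := fun a y => hookUp (G y) a (ν y)) (C' := tildeK G ν) hy fun ψ hψ => h ψ hψ y hy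
  refine ⟨h1, ?_⟩
  rw [bracketKK]
  simp_rw [h2]
  exact degFun_sum_cofLow_hookUp (hG.symm y hy) (hG.mul_inv y hy) (hν y)

/-- If `[K_μ, M_ω] = M_ν`, the necessary condition holds and `ν` is the bracket of `μ` and `ω`. -/
theorem necessary_and_bracketKM_eq (hG : MetricOn G U) (hr : Odd r) (hc : Even c)
    (hμ : KYOn G U r μ) (hω : CCKYOn G U c ω)
    (h : ∀ ψ, SmoothOn ψ U → ∀ y ∈ U,
      opK G μ (opM G ω ψ) y - opM G ω (opK G μ ψ) y = opM G ν ψ y)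
    (hν : ∀ z, pr n (ν z) = 0) (hy : y ∈ U) :
    ∑ a, comm (G y) (hookUp (G y) a (μ y)) (cofLow (G y) a * ω y) = 0
      ∧ bracketKM G μ ω y = ν y := by
  obtain ⟨h1, h2⟩ := necessary_of_commutator (operatorOn_KY hG hr hμ) (operatorOn_CCKY hG hc hω)
    (C := fun a y => cof a * ν y) (C' := tildeM G ν) hy fun ψ hψ => h ψ hψ y hy
  refine ⟨h1, ?_⟩
  rw [bracketKM]
  simp_rw [h2]
  exact degFun_sum_hook_cof (hν y)

/-- If `[M_α, M_β] = K_ν`, the necessary condition holds and `ν` is the bracket of `α` and `β`. -/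
theorem necessary_and_bracketMM_eq (hG : MetricOn G U) (ha : Even a) (hb : Even b)
    (hα : CCKYOn G U a α) (hβ : CCKYOn G U b β)
    (h : ∀ ψ, SmoothOn ψ U → ∀ y ∈ U,
      opM G α (opM G β ψ) y - opM G β (opM G α ψ) y = opK G ν ψ y)
    (hν : ∀ z, pr 0 (ν z) = 0) (hy : y ∈ U) :
    ∑ i, comm (G y) (cof i * α y) (cofLow (G y) i * β y) = 0 ∧ bracketMM G α β y = ν y := by
  obtain ⟨h1, h2⟩ := necessary_of_commutator (operatorOn_CCKY hG ha hα) (operatorOn_CCKY hG hb hβ)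
    (C := fun a y => hookUp (G y) a (ν y)) (C' := tildeK G ν) hy fun ψ hψ => h ψ hψ y hy
  refine ⟨h1, ?_⟩
  rw [bracketMM]
  simp_rw [h2]
  exact degFun_sum_cofLow_hookUp (hG.symm y hy) (hG.mul_inv y hy) (hν y)

end local_operators

/-! ### Coordinate expressions of metrics and forms on a manifold -/

section manifold

variable {M : Type*} [TopologicalSpace M] [ChartedSpace (EuclideanSpace ℝ (Fin n)) M]

lemma map_mem_exteriorPower {V W : Type*} [AddCommGroup V] [Module ℝ V] [AddCommGroup W]
    [Module ℝ W] (f : V →ₗ[ℝ] W) {p : ℕ} {x : ExteriorAlgebra ℝ V} (hx : x ∈ ⋀[ℝ]^p V) :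
    ExteriorAlgebra.map f x ∈ ⋀[ℝ]^p W := by
  have h := Submodule.mem_map_of_mem (f := (ExteriorAlgebra.map f).toLinearMap) hx
  have h2 : Submodule.map (ExteriorAlgebra.map f).toLinearMap
      (LinearMap.range (ExteriorAlgebra.ι ℝ (M := V)))
      ≤ LinearMap.range (ExteriorAlgebra.ι ℝ (M := W)) := by
    rintro _ ⟨_, ⟨v, rfl⟩, rfl⟩
    exact ⟨f v, (ExteriorAlgebra.map_apply_ι f v).symm⟩
  rw [ExteriorAlgebra.exteriorPower, Submodule.map_pow] at h
  exact pow_le_pow_left' h2 p h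

lemma proj_map_eq_zero {V W : Type*} [AddCommGroup V] [Module ℝ V] [AddCommGroup W]
    [Module ℝ W] (f : V →ₗ[ℝ] W) {p : ℕ} {x : ExteriorAlgebra ℝ V}
    (hx : GradedAlgebra.proj (fun i : ℕ => ⋀[ℝ]^i V) p x = 0) :
    GradedAlgebra.proj (fun i : ℕ => ⋀[ℝ]^i W) p (ExteriorAlgebra.map f x) = 0 := by
  classical
  rw [GradedAlgebra.proj_apply] at hx
  rw [← DirectSum.sum_support_decompose (fun i : ℕ => ⋀[ℝ]^i V) x, map_sum, map_sum]
  refine Finset.sum_eq_zero fun e _ => ?_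
  have h := map_mem_exteriorPower f (DirectSum.decompose (fun i : ℕ => ⋀[ℝ]^i V) x e).2
  rw [GradedAlgebra.proj_apply]
  by_cases he : e = p
  · subst he
    rw [hx, map_zero, DirectSum.decompose_zero]
    rfl
  · exact DirectSum.decompose_of_mem_ne _ h he

lemma pr_formRep_eq_zero {ν : FormField n M} {d : ℕ} (hν : NoPart d ν)
    (φ : OpenPartialHomeomorph M (EuclideanSpace ℝ (Fin n))) (y : EuclideanSpace ℝ (Fin n)) :
    pr d (formRep ν φ y) = 0 :=
  proj_map_eq_zero _ (hν (φ.symm y))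

variable {g : MetricField n M} {φ : OpenPartialHomeomorph M (EuclideanSpace ℝ (Fin n))}

lemma kyOn_formRep {p : ℕ} {κ : FormField n M} (hκ : IsKY g κ) (hp : IsHomogeneous p κ)
    (hφ : φ ∈ atlas (EuclideanSpace ℝ (Fin n)) M) :
    KYOn (metricRep g φ) φ.target p (formRep κ φ) :=
  ⟨hκ.1 φ hφ, fun z _ => map_mem_exteriorPower _ (hp (φ.symm z)),
    fun z hz => (hκ.2 φ hφ z hz).1, fun z hz => (hκ.2 φ hφ z hz).2⟩

lemma cckyOn_formRep {c : ℕ} {ω : FormField n M} (hω : IsCCKY g ω) (hc : IsHomogeneous c ω)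
    (hφ : φ ∈ atlas (EuclideanSpace ℝ (Fin n)) M) :
    CCKYOn (metricRep g φ) φ.target c (formRep ω φ) :=
  ⟨hω.1 φ hφ, fun z _ => map_mem_exteriorPower _ (hc (φ.symm z)),
    fun z hz => (hω.2 φ hφ z hz).1, fun z hz => (hω.2 φ hφ z hz).2⟩

variable [IsManifold (𝓡 n) (⊤ : ℕ∞) M]

lemma metricOn_metricRep (hg : IsPseudoRiemannian g)
    (hφ : φ ∈ atlas (EuclideanSpace ℝ (Fin n)) M) : MetricOn (metricRep g φ) φ.target where
  isOpen := φ.open_target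
  symm y _ := Matrix.IsSymm.ext fun i j => (hg.symm (φ.symm y)).eq _ _
  mul_inv y hy := by
    have : IsManifold (𝓡 n) 1 M := IsManifold.of_le (n := (⊤ : ℕ∞)) (by simp)
    -- the coordinate vectors form a basis, as the differential of a chart is invertible
    let L := (mdifferentiable_of_mem_atlas (I := 𝓡 n) hφ).symm.mfderiv (x := y) hy
    let e : Module.Basis (Fin n) ℝ (TangentSpace (𝓡 n) y) :=
      (EuclideanSpace.basisFun (Fin n) ℝ).toBasis
    let b : Module.Basis (Fin n) ℝ (TangentSpace (𝓡 n) (φ.symm y)) := e.map L.toLinearEquiv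
    have hb : ∀ i, b i = coordVec φ y i := fun i => by
      have he : (EuclideanSpace.basisFun (Fin n) ℝ).toBasis i = EuclideanSpace.single i (1 : ℝ) := by
        rw [OrthonormalBasis.coe_toBasis, EuclideanSpace.basisFun_apply]
      exact (e.map_apply L.toLinearEquiv i).trans (congrArg L he)
    have h : metricRep g φ y = LinearMap.BilinForm.toMatrix b (g (φ.symm y)) := by
      ext i j
      rw [LinearMap.BilinForm.toMatrix_apply, hb, hb]
      rfl
    have hd : (metricRep g φ y).det ≠ 0 := by
      rw [h]
      exact (LinearMap.BilinForm.nondegenerate_iff_det_ne_zero b).mp (hg.nondegenerate _)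
    exact Matrix.mul_nonsing_inv _ (isUnit_iff_ne_zero.mpr hd)
  smooth := hg.smooth φ hφ

end manifold

end KillingYano

end

theorem mainTheorem5 {n : ℕ} {M : Type*} [TopologicalSpace M]
    [ChartedSpace (EuclideanSpace ℝ (Fin n)) M] [IsManifold (𝓡 n) (⊤ : ℕ∞) M]
    (g : KillingYano.MetricField n M) (hg : KillingYano.IsPseudoRiemannian g) :
    -- two odd KY forms
    (∀ (p q : ℕ) (κ lam : KillingYano.FormField n M), Odd p → Odd q →
      KillingYano.IsHomogeneous p κ → KillingYano.IsHomogeneous q lam →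
      KillingYano.IsKY g κ → KillingYano.IsKY g lam →
      ∀ φ ∈ atlas (EuclideanSpace ℝ (Fin n)) M, ∀ y ∈ φ.target,
        let G := KillingYano.metricRep g φ
        let κ' := KillingYano.formRep κ φ
        let lam' := KillingYano.formRep lam φ
        let rhs : KillingYano.Form n :=
          (-((p : ℝ) * q / (p + q - 1))) • KillingYano.codiff G (fun z => κ' z * lam' z) y
        (KillingYano.NecessaryKK g κ lam → KillingYano.bracketKK G κ' lam' y = rhs) ∧
        (∀ ν : KillingYano.FormField n M, KillingYano.IsBracketKK g κ lam ν →
          KillingYano.formRep ν φ y = rhs)) ∧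
    -- an odd KY form and an even CCKY form
    (∀ (r c : ℕ) (μ ω : KillingYano.FormField n M), Odd r → Even c → ¬ (r = 1 ∧ c = n) →
      KillingYano.IsHomogeneous r μ → KillingYano.IsHomogeneous c ω →
      KillingYano.IsKY g μ → KillingYano.IsCCKY g ω →
      ∀ φ ∈ atlas (EuclideanSpace ℝ (Fin n)) M, ∀ y ∈ φ.target,
        let G := KillingYano.metricRep g φ
        let μ' := KillingYano.formRep μ φ
        let ω' := KillingYano.formRep ω φ
        let rhs : KillingYano.Form n :=
          ((r : ℝ) * (n - c) / (n + r - c - 1) * ((-1) ^ ((r - 1) / 2) / (r.factorial : ℝ))) •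
            KillingYano.extd G (fun z => KillingYano.cwedge (G z) r (μ' z) (ω' z)) y
        (KillingYano.NecessaryKM g μ ω → KillingYano.bracketKM G μ' ω' y = rhs) ∧
        (∀ ν : KillingYano.FormField n M, KillingYano.IsBracketKM g μ ω ν →
          KillingYano.formRep ν φ y = rhs)) ∧
    -- two even CCKY forms
    (∀ (a b : ℕ) (α β : KillingYano.FormField n M), Even a → Even b →
      KillingYano.IsHomogeneous a α → KillingYano.IsHomogeneous b β →
      KillingYano.IsCCKY g α → KillingYano.IsCCKY g β →
      ∀ φ ∈ atlas (EuclideanSpace ℝ (Fin n)) M, ∀ y ∈ φ.target,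
        let G := KillingYano.metricRep g φ
        let α' := KillingYano.formRep α φ
        let β' := KillingYano.formRep β φ
        let rhs : KillingYano.Form n :=
          if a + b ≤ n then 0
          else if Odd n then
            (((n : ℝ) - a) * (n - b) / (2 * n - a - b - 1) *
                ((-1) ^ ((a + b - n - 1) / 2) / ((a + b - n).factorial : ℝ))) •
              KillingYano.codiff G
                (fun z => KillingYano.cwedge (G z) (a + b - n) (α' z) (β' z)) y
          else
            (((n : ℝ) - a) * (n - b) / (2 * n - a - b + 1) *
                ((-1) ^ ((a + b - n - 2) / 2) / ((a + b - n - 1).factorial : ℝ))) •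
              (KillingYano.cwedge (G y) (a + b - n - 1) (α' y)
                  ((1 / ((n : ℝ) - b + 1)) • KillingYano.codiff G β' y)
                - KillingYano.cwedge (G y) (a + b - n - 1)
                  ((1 / ((n : ℝ) - a + 1)) • KillingYano.codiff G α' y) (β' y))
        (KillingYano.NecessaryMM g α β → KillingYano.bracketMM G α' β' y = rhs) ∧
        (∀ ν : KillingYano.FormField n M, KillingYano.IsBracketMM g α β ν →
          KillingYano.formRep ν φ y = rhs)) := by
  refine ⟨fun p q κ lam hp hq hκp hlamq hκ hlam φ hφ y hy => ?_,
    fun r c μ ω hr hc _ hμr hωc hμ hω φ hφ y hy => ?_,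
    fun a b α β ha hb hαa hβb hα hβ φ hφ y hy => ?_⟩
  · intro G κ' lam' rhs
    have hG := KillingYano.metricOn_metricRep hg hφ
    have hκ' := KillingYano.kyOn_formRep hκ hκp hφ
    have hlam' := KillingYano.kyOn_formRep hlam hlamq hφ
    refine ⟨fun hN => KillingYano.bracketKK_eq hG hp hq hκ' hlam' (hN φ hφ) hy, fun ν hν => ?_⟩
    obtain ⟨_, hν0, hνc⟩ := hν
    have h := fun z hz => KillingYano.necessary_and_bracketKK_eq (y := z) hG hp hq hκ' hlam'
      (hνc φ hφ) (KillingYano.pr_formRep_eq_zero (hν0 0 Even.zero) φ) hz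
    rw [← (h y hy).2]
    exact KillingYano.bracketKK_eq hG hp hq hκ' hlam' (fun z hz => (h z hz).1) hy
  · intro G μ' ω' rhs
    have hG := KillingYano.metricOn_metricRep hg hφ
    have hμ' := KillingYano.kyOn_formRep hμ hμr hφ
    have hω' := KillingYano.cckyOn_formRep hω hωc hφ
    refine ⟨fun hN => KillingYano.bracketKM_eq hG hr hc hμ' hω' (hN φ hφ) hy, fun ν hν => ?_⟩
    obtain ⟨_, _, hνn, hνc⟩ := hν
    have h := fun z hz => KillingYano.necessary_and_bracketKM_eq (y := z) hG hr hc hμ' hω'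
      (hνc φ hφ) (KillingYano.pr_formRep_eq_zero hνn φ) hz
    rw [← (h y hy).2]
    exact KillingYano.bracketKM_eq hG hr hc hμ' hω' (fun z hz => (h z hz).1) hy
  · intro G α' β' rhs
    have hG := KillingYano.metricOn_metricRep hg hφ
    have hα' := KillingYano.cckyOn_formRep hα hαa hφ
    have hβ' := KillingYano.cckyOn_formRep hβ hβb hφ
    have key : (∀ z ∈ φ.target, ∑ i, KillingYano.comm (G z) (KillingYano.cof i * α' z)
        (KillingYano.cofLow (G z) i * β' z) = 0) → KillingYano.bracketMM G α' β' y = rhs :=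
      fun hN => by
        simp only [rhs]
        split_ifs with hab hn
        · exact KillingYano.bracketMM_eq_zero hG ha hb hα' hβ' hN hy hab
        · exact KillingYano.bracketMM_eq_of_odd hG ha hb hα' hβ' hN hy hn (not_le.mp hab)
        · exact KillingYano.bracketMM_eq_of_even hG ha hb hα' hβ' hN hy (Nat.not_odd_iff_even.mp hn)
            (not_le.mp hab)
    refine ⟨fun hN => key (hN φ hφ), fun ν hν => ?_⟩
    obtain ⟨_, hν0, hνc⟩ := hν
    have h := fun z hz => KillingYano.necessary_and_bracketMM_eq (y := z) hG ha hb hα' hβ'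
      (hνc φ hφ) (KillingYano.pr_formRep_eq_zero (hν0 0 Even.zero) φ) hz
    rw [← (h y hy).2]
    exact key fun z hz => (h z hz).1
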